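/- Let $p>0$ and let $h:[0,\infty)\to[0,\infty)$ be a $C^1$ function with $h(t)>0$ for all large $t$ and $$\lim_{t\to\infty}\frac{h'(t)}{t^{p-1}h(t)}=0 ,\qquad f(t):=h(t)e^{t^p}.$$ For $n\in\mathbb N$ let $\lambda_n>0$, $\mu_n\in\mathbb R$ and $u_n:[0,1]\to\mathbb R$ satisfy $$-u_n''-\tfrac1r u_n'=\lambda_n f(u_n),\quad u_n>0\ \text{ in }(0,1),\qquad u_n(0)=\mu_n,\quad u_n'(0)=0=u_n(1),$$ and suppose $\mu_n\to\infty$. Write $\phi_n(r)=p\lambda_n r^2u_n(r)^{p-1}f(u_n(r))$ and $E_n(s,t)=p\mu_n^{p-1}\int_s^t\lambda_nf(u_n)\,r\,dr$. For $m>0$ with $f(m)>0$ let $\gamma_n(m)>0$ be given by $p\lambda_n m^{p-1}f(m)\gamma_n(m)^2=1$, and put $z_n^{m}(r)=p\,m^{p-1}\bigl(u_n(\gamma_n(m)r)-m\bigr)$. For $p>2$ put $a_0=2$, $\delta_0=1$ and, for $k\ge1$, let $\delta_k\in(0,\delta_{k-1})$ and $a_k\in(0,2)$ be the numbers determined by $$\frac{2p}{2+a_{k-1}}\Bigl(1-\frac{\delta_k}{\delta_{k-1}}\Bigr)-1+\Bigl(\frac{\delta_k}{\delta_{k-1}}\Bigr)^p=0,\qquad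 a_k=2-\Bigl(\frac{\delta_k}{\delta_{k-1}}\Bigr)^{p-1}(2+a_{k-1}),$$ and let $b_k=(\sqrt2/a_k)^{a_k}$, $z_k(r)=\log\dfrac{2a_k^2b_k}{r^{2-a_k}(1+b_kr^{a_k})^2}$ for $k\ge 1$. Let $z_0(r)=\log\dfrac{64}{(8+r^2)^2}$. Then, after passing to one subsequence of $\{(\lambda_n,\mu_n,u_n)\}$ (still indexed by $n$), there are sequences as follows. * *First bubble.* With $\gamma_{0,n}=\gamma_n(\mu_n)$ and $z_{0,n}=z_n^{\mu_n}$, there are $0<r_{0,n}<\rho_{0,n}<1$ with $\gamma_{0,n}\to0$, $\rho_{0,n}\to0$, $\rho_{0,n}/\gamma_{0,n}\to\infty$, $u_n(\rho_{0,n})/\mu_n\to1$, $\|z_{0,n}-z_0\|_{C^1([0,\rho_{0,n}/\gamma_{0,n}])}\to0$, $E_n(0,\rho_{0,n})\to4$, $r_{0,n}/\gamma_{0,n}\to2\sqrt2$, $u_n(r_{0,n})/\mu_n\to1$, $\phi_n(r_{0,n})\to2$. * *Further bubbles, if $p>2$.* For every $k\ge1$ there are $r_{k,n},\rho_{k,n},\bar\rho_{k,n}\in(0,1)$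 such that $u_n(r_{k,n})/\mu_n$, $u_n(\rho_{k,n})/\mu_n$ and $u_n(\bar\rho_{k,n})/\mu_n$ tend to $\delta_k$, $\phi_n(r_{k,n})\to a_k^2/2$, the quotients $\rho_{k-1,n}/\bar\rho_{k,n}$, $\bar\rho_{k,n}/r_{k,n}$, $r_{k,n}/\rho_{k,n}$ tend to $0$, and, with $\gamma_{k,n}=\gamma_n(u_n(r_{k,n}))$ and $z_{k,n}=z_n^{u_n(r_{k,n})}$, one has $\gamma_{k,n}\to0$, $\|z_{k,n}-z_k\|_{C^2([\bar\rho_{k,n}/\gamma_{k,n},\,\rho_{k,n}/\gamma_{k,n}])}\to0$, $E_n(\rho_{k-1,n},\bar\rho_{k,n})\to0$, $E_n(\bar\rho_{k,n},\rho_{k,n})\to2a_k/\delta_k^{p-1}$, $p\int_{\rho_{k-1,n}}^{\bar\rho_{k,n}}\lambda_nu_n^{p-1}f(u_n)r\,dr\to0$ and $p\int_{\bar\rho_{k,n}}^{\rho_{k,n}}\lambda_nu_n^{p-1}f(u_n)r\,dr\to2a_k$. Moreover, with these choices, the following holds as $n\to\infty$; every inclusion for $r_n$ and every relation between $r_n$,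 $R_n$, $\delta_n$ is required only for all large $n$. **Inside the first bubble.** For every sequence $r_n=R_n\gamma_{0,n}\in(0,\rho_{0,n}]$, $$p\lambda_nr_n^2u_n(r_n)^{p-1}f(u_n(r_n))=\frac{64R_n^2}{(8+R_n^2)^2}(1+o(1)).$$ If in addition $\mu_n^{-p}\log(r_n/\gamma_{0,n})\to0$, then $u_n(r_n)=\{(\tfrac4p+o(1))\log\tfrac1{r_n}\}^{1/p}$ when $p<2$, and $u_n(r_n)=\{(2+o(1))\log\tfrac1{r_n}\}^{1/p}$ when $p\ge2$. **(i)** If $0<p<2$, then for every sequence $r_n\in[\rho_{0,n},1)$, writing $u_n(r_n)=\delta_n\mu_n$, $$u_n(r_n)=\Bigl\{\Bigl(\frac4p+o(1)\Bigr)\delta_n^{p-1}\log\frac1{r_n}\Bigr\}^{1/p};$$ if $(\delta_n^{p-1})$ is bounded (which is automatic for $p\ge1$), then also $u_n(r_n)=\bigl\{\bigl(\tfrac{4\delta_n^{p-1}}p+o(1)\bigr)\log\tfrac1{r_n}\bigr\}^{1/p}$. **(ii)** If $p=2$, then for every sequence $r_n\in[\rho_{0,n},1)$ and $\delta\in(0,1]$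 with $u_n(r_n)/\mu_n\to\delta$, $\ u_n(r_n)=\{(2\delta+o(1))\log\tfrac1{r_n}\}^{1/2}$. **(iii)** If $p>2$ and $k\ge0$, then for every sequence $r_n\in[\rho_{k,n},\bar\rho_{k+1,n}]$ and $\delta\in[\delta_{k+1},\delta_k]$ with $u_n(r_n)/\mu_n\to\delta$, $$u_n(r_n)=\Bigl\{(\beta_k(\delta)+o(1))\log\frac1{r_n}\Bigr\}^{1/p},\qquad \beta_k(\delta)=\frac{2(2+a_k)(\delta/\delta_k)^p}{2+a_k-2p(1-\delta/\delta_k)}.$$ If $p>2$ and $k\ge1$, then for every sequence $r_n=R_n\gamma_{k,n}\in[\bar\rho_{k,n},\rho_{k,n}]$, $$p\lambda_nr_n^2u_n(r_n)^{p-1}f(u_n(r_n))=\frac{2a_k^2b_kR_n^{a_k}}{(1+b_kR_n^{a_k})^2}(1+o(1)),\qquad u_n(r_n)=\Bigl\{(2+o(1))\log\frac1{r_n}\Bigr\}^{1/p}.$$ -/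

import Mathlib

open Filter Topology Set
open scoped Asymptotics

noncomputable section

/-- Standing assumption on `h : [0,∞) → ℝ`: nonnegative, of class `C¹`, positive near infinity. -/
structure StandingH (h : ℝ → ℝ) : Prop where
  contDiffOn : ContDiffOn ℝ 1 h (Ici 0)
  nonneg : ∀ t, 0 ≤ t → 0 ≤ h t
  eventually_pos : ∃ t₀ : ℝ, 0 < t₀ ∧ ∀ t, t₀ ≤ t → 0 < h t

/-- The growth condition `h'(t) / (t^(p-1) h(t)) → 0` as `t → ∞`. -/
def GrowthH (p : ℝ) (h : ℝ → ℝ) : Prop :=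
  Tendsto (fun t : ℝ => deriv h t / (t ^ (p - 1) * h t)) atTop (𝓝 0)

/-- The nonlinearity `f(t) = h(t) exp(t^p)`. -/
def nonlin (p : ℝ) (h : ℝ → ℝ) (t : ℝ) : ℝ := h t * Real.exp (t ^ p)

/-- `(lam, mu, v)` is a (classical, radial, positive) solution:
`-v'' - v'/r = lam * f(v)`, `v > 0` in `(0,1)`, `v(0) = mu`, `v'(0) = 0 = v(1)`. -/
structure IsRadialSolution (p : ℝ) (h : ℝ → ℝ) (lam mu : ℝ) (v : ℝ → ℝ) : Prop where
  lam_pos : 0 < lam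
  continuousOn : ContinuousOn v (Icc 0 1)
  differentiableAt : ∀ r ∈ Ioo (0 : ℝ) 1, DifferentiableAt ℝ v r
  differentiableAt_deriv : ∀ r ∈ Ioo (0 : ℝ) 1, DifferentiableAt ℝ (deriv v) r
  equation : ∀ r ∈ Ioo (0 : ℝ) 1,
    -deriv (deriv v) r - (1 / r) * deriv v r = lam * nonlin p h (v r)
  pos : ∀ r ∈ Ioo (0 : ℝ) 1, 0 < v r
  at_zero : v 0 = mu
  deriv_zero : HasDerivWithinAt v 0 (Ici 0) 0
  at_one : v 1 = 0

/-- The quantity `p * lam * r^2 * v(r)^(p-1) * f(v(r))`. -/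
def phi (p : ℝ) (h : ℝ → ℝ) (lam : ℝ) (v : ℝ → ℝ) (r : ℝ) : ℝ :=
  p * lam * r ^ 2 * v r ^ (p - 1) * nonlin p h (v r)

/-- The scale `γ` at height `m`: the positive number with `p * lam * m^(p-1) * f(m) * γ^2 = 1`. -/
def scale (p : ℝ) (h : ℝ → ℝ) (lam m : ℝ) : ℝ :=
  1 / √(p * lam * m ^ (p - 1) * nonlin p h m)

/-- The rescaled function `z(r) = p m^(p-1) (v(γ r) - m)` at height `m`,
with `γ` the scale at height `m`. -/
def rescaled (p : ℝ) (h : ℝ → ℝ) (lam : ℝ) (v : ℝ → ℝ) (m r : ℝ) : ℝ :=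
  p * m ^ (p - 1) * (v (scale p h lam m * r) - m)

/-- `‖z n - w‖` tends to zero in `C^m([a n, b n])`. -/
def CkTendsto (m : ℕ) (z : ℕ → ℝ → ℝ) (w : ℝ → ℝ) (a b : ℕ → ℝ) : Prop :=
  ∀ j ≤ m, ∀ ε > 0, ∀ᶠ n in atTop, ∀ r ∈ Icc (a n) (b n),
    |iteratedDerivWithin j (z n) (Icc (a n) (b n)) r
      - iteratedDerivWithin j w (Icc (a n) (b n)) r| ≤ ε

/-- The energy `p mu^(p-1) ∫_s^t lam f(v) r dr`. -/
def energy (p : ℝ) (h : ℝ → ℝ) (lam mu : ℝ) (v : ℝ → ℝ) (s t : ℝ) : ℝ :=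
  p * mu ^ (p - 1) * ∫ r in s..t, lam * nonlin p h (v r) * r

/-- The energy `p ∫_s^t lam v^(p-1) f(v) r dr`. -/
def energy' (p : ℝ) (h : ℝ → ℝ) (lam : ℝ) (v : ℝ → ℝ) (s t : ℝ) : ℝ :=
  p * ∫ r in s..t, lam * v r ^ (p - 1) * nonlin p h (v r) * r

/-- The root `x ∈ (0,1)` of `2p/(2+a) * (1 - x) - 1 + x^p = 0`
(it is unique for `p > 2`, `0 < a ≤ 2`; see `bubbleRatio_spec`). -/
def bubbleRatio (p a : ℝ) : ℝ :=
  sInf {x : ℝ | x ∈ Ioo (0 : ℝ) 1 ∧ 2 * p / (2 + a) * (1 - x) - 1 + x ^ p = 0}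

/-- The numbers `a_k`. -/
def bubbleA (p : ℝ) : ℕ → ℝ
  | 0 => 2
  | k + 1 => 2 - bubbleRatio p (bubbleA p k) ^ (p - 1) * (2 + bubbleA p k)

/-- The numbers `δ_k`. -/
def bubbleDelta (p : ℝ) : ℕ → ℝ
  | 0 => 1
  | k + 1 => bubbleRatio p (bubbleA p k) * bubbleDelta p k

/-- The numbers `b_k = (√2 / a_k)^(a_k)`. -/
def bubbleB (p : ℝ) (k : ℕ) : ℝ := (√2 / bubbleA p k) ^ bubbleA p k

theorem bubbleRatio_aux {p x : ℝ} (hp : 2 < p) (hx : x ∈ Ioo (0 : ℝ) 1) :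
    x ^ p + p * x ^ (p - 1) * (1 - x) < 1 := by
  obtain ⟨h0, h1⟩ := hx
  have hinv : 1 < x⁻¹ := (one_lt_inv₀ h0).2 h1
  have hb := one_add_mul_self_lt_rpow_one_add (s := x⁻¹ - 1) (by linarith) (by linarith)
    (p := p) (by linarith)
  have e : (1 : ℝ) + (x⁻¹ - 1) = x⁻¹ := by ring
  rw [e, Real.inv_rpow h0.le] at hb
  have hxp : 0 < x ^ p := Real.rpow_pos_of_pos h0 p
  have h2 := mul_lt_mul_of_pos_left hb hxp
  rw [mul_inv_cancel₀ hxp.ne'] at h2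
  have e2 : x ^ p = x ^ (p - 1) * x := by
    rw [← Real.rpow_add_one h0.ne']; congr 1; ring
  have e3 : x ^ p * (1 + p * (x⁻¹ - 1)) = x ^ p + p * x ^ (p - 1) * (1 - x) := by
    rw [e2]; field_simp
  linarith

/-- For `p > 2` and `0 < a ≤ 2` the defining equation has exactly one root in `(0,1)`. -/
theorem bubbleRatio_spec {p a : ℝ} (hp : 2 < p) (ha : 0 < a) (ha2 : a ≤ 2) :
    bubbleRatio p a ∈ Ioo (0 : ℝ) 1 ∧
    2 * p / (2 + a) * (1 - bubbleRatio p a) - 1 + bubbleRatio p a ^ p = 0 ∧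
    (∀ x ∈ Ioo (0 : ℝ) 1, 2 * p / (2 + a) * (1 - x) - 1 + x ^ p = 0 → x = bubbleRatio p a) ∧
    bubbleRatio p a ^ (p - 1) * (2 + a) < 2 := by
  set c : ℝ := 2 * p / (2 + a) with hc
  have h2a : (0 : ℝ) < 2 + a := by linarith
  have hc1 : 1 < c := by rw [hc, lt_div_iff₀ h2a]; linarith
  have hcp : c < p := by rw [hc, div_lt_iff₀ h2a]; nlinarith
  -- a point where the function is negative
  set m : ℝ := (c / p) ^ (1 / (p - 1)) with hm
  have hcp0 : 0 < c / p := by positivity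
  have hm0 : 0 < m := Real.rpow_pos_of_pos hcp0 _
  have hm1 : m < 1 := by
    apply Real.rpow_lt_one hcp0.le
    · rw [div_lt_one (by linarith)]; exact hcp
    · apply one_div_pos.2; linarith
  have hmp : m ^ (p - 1) = c / p := by
    rw [hm, ← Real.rpow_mul hcp0.le, one_div_mul_cancel (by linarith), Real.rpow_one]
  have hneg : c * (1 - m) - 1 + m ^ p < 0 := by
    have := bubbleRatio_aux hp ⟨hm0, hm1⟩
    rw [hmp, mul_div_cancel₀ _ (by linarith : p ≠ 0)] at this
    linarith
  have hcont : ContinuousOn (fun x : ℝ => c * (1 - x) - 1 + x ^ p) (Icc 0 m) := by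
    apply Continuous.continuousOn
    have : Continuous fun x : ℝ => x ^ p := Real.continuous_rpow_const (by linarith)
    fun_prop
  have hz : (0 : ℝ) ∈ Ioo ((fun x : ℝ => c * (1 - x) - 1 + x ^ p) m)
      ((fun x : ℝ => c * (1 - x) - 1 + x ^ p) 0) := by
    refine ⟨hneg, ?_⟩
    simp only [Real.zero_rpow (by linarith : p ≠ 0)]
    linarith
  obtain ⟨x, hx, hx0⟩ := intermediate_value_Ioo' hm0.le hcont hz
  simp only at hx0
  have hxI : x ∈ Ioo (0 : ℝ) 1 := ⟨hx.1, hx.2.trans hm1⟩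
  have hsc := strictConvexOn_rpow (by linarith : 1 < p)
  have key : ∀ y z : ℝ, y ∈ Ioo (0 : ℝ) 1 → z ∈ Ioo (0 : ℝ) 1 →
      c * (1 - y) - 1 + y ^ p = 0 → c * (1 - z) - 1 + z ^ p = 0 → y < z → False := by
    intro y z hy hz h1 h2 hyz
    have := hsc.slope_strict_mono_adjacent (x := y) (y := z) (z := 1)
      (mem_Ici.2 hy.1.le) (mem_Ici.2 zero_le_one) hyz hz.2
    rw [Real.one_rpow] at this
    have e1 : (z ^ p - y ^ p) / (z - y) = c := by
      rw [div_eq_iff (by linarith)]; linarith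
    have e2 : (1 - z ^ p) / (1 - z) = c := by
      rw [div_eq_iff (by linarith [hz.2])]; linarith
    rw [e1, e2] at this
    exact lt_irrefl _ this
  have uniq : ∀ y ∈ Ioo (0 : ℝ) 1, c * (1 - y) - 1 + y ^ p = 0 → y = x := by
    intro y hy h1
    rcases lt_trichotomy y x with h | h | h
    · exact (key y x hy hxI h1 hx0 h).elim
    · exact h
    · exact (key x y hxI hy hx0 h1 h).elim
  have hset : {x : ℝ | x ∈ Ioo (0 : ℝ) 1 ∧ 2 * p / (2 + a) * (1 - x) - 1 + x ^ p = 0} = {x} := by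
    ext y
    constructor
    · rintro ⟨h1, h2⟩; exact uniq y h1 h2
    · rintro rfl; exact ⟨hxI, hx0⟩
  have hr : bubbleRatio p a = x := by rw [bubbleRatio, hset, csInf_singleton]
  rw [hr]
  refine ⟨hxI, hx0, uniq, ?_⟩
  have h3 := bubbleRatio_aux hp hxI
  have h4 : p * x ^ (p - 1) * (1 - x) < c * (1 - x) := by linarith
  have h5 : p * x ^ (p - 1) < c := lt_of_mul_lt_mul_right h4 (by linarith [hxI.2])
  rw [hc, lt_div_iff₀ h2a] at h5
  have : p * (x ^ (p - 1) * (2 + a)) < p * 2 := by linarith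
  exact lt_of_mul_lt_mul_left this (by linarith)

theorem bubble_range {p : ℝ} (hp : 2 < p) (k : ℕ) :
    0 < bubbleA p k ∧ bubbleA p k ≤ 2 ∧ 0 < bubbleDelta p k := by
  induction k with
  | zero => simp [bubbleA, bubbleDelta]
  | succ k ih =>
    obtain ⟨h1, h2, h3⟩ := ih
    obtain ⟨s1, -, -, s4⟩ := bubbleRatio_spec hp h1 h2
    have : 0 < bubbleRatio p (bubbleA p k) ^ (p - 1) := Real.rpow_pos_of_pos s1.1 _
    refine ⟨?_, ?_, ?_⟩
    · simp only [bubbleA]; linarith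
    · simp only [bubbleA]
      have : 0 < bubbleRatio p (bubbleA p k) ^ (p - 1) * (2 + bubbleA p k) := by positivity
      linarith
    · simp only [bubbleDelta]; exact mul_pos s1.1 h3

/-- For `p > 2` the numbers `δ_k ∈ (0, δ_{k-1})`, `a_k ∈ (0,2)` satisfy the recurrence relations
by which they are defined, and the first relation determines `δ_k` uniquely. -/
theorem bubble_spec {p : ℝ} (hp : 2 < p) (k : ℕ) :
    bubbleDelta p (k + 1) ∈ Ioo 0 (bubbleDelta p k) ∧
    bubbleA p (k + 1) ∈ Ioo (0 : ℝ) 2 ∧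
    2 * p / (2 + bubbleA p k) * (1 - bubbleDelta p (k + 1) / bubbleDelta p k) - 1
      + (bubbleDelta p (k + 1) / bubbleDelta p k) ^ p = 0 ∧
    bubbleA p (k + 1)
      = 2 - (bubbleDelta p (k + 1) / bubbleDelta p k) ^ (p - 1) * (2 + bubbleA p k) ∧
    ∀ d ∈ Ioo 0 (bubbleDelta p k),
      2 * p / (2 + bubbleA p k) * (1 - d / bubbleDelta p k) - 1 + (d / bubbleDelta p k) ^ p = 0 →
      d = bubbleDelta p (k + 1) := by
  obtain ⟨h1, h2, h3⟩ := bubble_range hp k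
  obtain ⟨s1, s2, s3, s4⟩ := bubbleRatio_spec hp h1 h2
  have e : bubbleDelta p (k + 1) / bubbleDelta p k = bubbleRatio p (bubbleA p k) := by
    simp only [bubbleDelta]; exact mul_div_cancel_right₀ _ h3.ne'
  rw [e]
  refine ⟨⟨(bubble_range hp (k + 1)).2.2, ?_⟩, ⟨(bubble_range hp (k + 1)).1, ?_⟩, s2, ?_, ?_⟩
  · simp only [bubbleDelta]
    nlinarith [s1.2]
  · simp only [bubbleA]
    have : 0 < bubbleRatio p (bubbleA p k) ^ (p - 1) := Real.rpow_pos_of_pos s1.1 _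
    have : 0 < bubbleRatio p (bubbleA p k) ^ (p - 1) * (2 + bubbleA p k) := by positivity
    linarith
  · simp only [bubbleA]
  · intro d hd hd0
    have := s3 (d / bubbleDelta p k) ⟨div_pos hd.1 h3, (div_lt_one h3).2 hd.2⟩ hd0
    simp only [bubbleDelta]
    rw [← this, div_mul_cancel₀ _ h3.ne']

/-- The profile `z_0(r) = log (64 / (8 + r^2)^2)` of the first bubble. -/
def profileZero (r : ℝ) : ℝ := Real.log (64 / (8 + r ^ 2) ^ 2)

/-- The profile `z_k(r) = log (2 a_k^2 b_k / (r^(2-a_k) (1 + b_k r^(a_k))^2))`, `k ≥ 1`. -/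
def profile (p : ℝ) (k : ℕ) (r : ℝ) : ℝ :=
  Real.log (2 * bubbleA p k ^ 2 * bubbleB p k /
    (r ^ (2 - bubbleA p k) * (1 + bubbleB p k * r ^ bubbleA p k) ^ 2))

/-- The function `β_k` on `[δ_{k+1}, δ_k]`. -/
def beta (p : ℝ) (k : ℕ) (δ : ℝ) : ℝ :=
  2 * (2 + bubbleA p k) * (δ / bubbleDelta p k) ^ p /
    (2 + bubbleA p k - 2 * p * (1 - δ / bubbleDelta p k))

/-- The sequences `(r_{0,n})` (centre) and `(ρ_{0,n})` (outer radius) of the first bubble of a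
sequence of solutions, with everything that characterizes the bubble. -/
structure IsFirstBubble (p : ℝ) (h : ℝ → ℝ) (lam mu : ℕ → ℝ) (u : ℕ → ℝ → ℝ)
    (r ρ : ℕ → ℝ) : Prop where
  rho_mem : ∀ n, ρ n ∈ Ioo (0 : ℝ) 1
  r_mem : ∀ n, r n ∈ Ioo 0 (ρ n)
  scale_tendsto : Tendsto (fun n => scale p h (lam n) (mu n)) atTop (𝓝 0)
  rho_tendsto : Tendsto ρ atTop (𝓝 0)
  rho_div_scale : Tendsto (fun n => ρ n / scale p h (lam n) (mu n)) atTop atTop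
  height_rho : Tendsto (fun n => u n (ρ n) / mu n) atTop (𝓝 1)
  profile_tendsto : CkTendsto 1 (fun n => rescaled p h (lam n) (u n) (mu n)) profileZero
    (fun _ => 0) (fun n => ρ n / scale p h (lam n) (mu n))
  energy_tendsto : Tendsto (fun n => energy p h (lam n) (mu n) (u n) 0 (ρ n)) atTop (𝓝 4)
  r_div_scale : Tendsto (fun n => r n / scale p h (lam n) (mu n)) atTop (𝓝 (2 * √2))
  height_r : Tendsto (fun n => u n (r n) / mu n) atTop (𝓝 1)
  phi_r : Tendsto (fun n => phi p h (lam n) (u n) (r n)) atTop (𝓝 2)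

/-- The sequences `(r_{k,n})` (centre), `(ρ_{k,n})` (outer radius) and `(ρbar_{k,n})` (inner radius)
of the bubble with index `k ≥ 1` (case `p > 2`), with everything that characterizes the bubble;
`ρprev` is the sequence of outer radii of the preceding bubble. -/
structure IsLaterBubble (p : ℝ) (h : ℝ → ℝ) (lam mu : ℕ → ℝ) (u : ℕ → ℝ → ℝ)
    (k : ℕ) (ρprev r ρ ρbar : ℕ → ℝ) : Prop where
  r_mem : ∀ n, r n ∈ Ioo (0 : ℝ) 1
  rho_mem : ∀ n, ρ n ∈ Ioo (0 : ℝ) 1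
  rhobar_mem : ∀ n, ρbar n ∈ Ioo (0 : ℝ) 1
  height_r : Tendsto (fun n => u n (r n) / mu n) atTop (𝓝 (bubbleDelta p k))
  phi_r : Tendsto (fun n => phi p h (lam n) (u n) (r n)) atTop (𝓝 (bubbleA p k ^ 2 / 2))
  height_rho : Tendsto (fun n => u n (ρ n) / mu n) atTop (𝓝 (bubbleDelta p k))
  height_rhobar : Tendsto (fun n => u n (ρbar n) / mu n) atTop (𝓝 (bubbleDelta p k))
  rhoprev_div_rhobar : Tendsto (fun n => ρprev n / ρbar n) atTop (𝓝 0)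
  rhobar_div_r : Tendsto (fun n => ρbar n / r n) atTop (𝓝 0)
  r_div_rho : Tendsto (fun n => r n / ρ n) atTop (𝓝 0)
  scale_tendsto : Tendsto (fun n => scale p h (lam n) (u n (r n))) atTop (𝓝 0)
  profile_tendsto : CkTendsto 2 (fun n => rescaled p h (lam n) (u n) (u n (r n))) (profile p k)
    (fun n => ρbar n / scale p h (lam n) (u n (r n)))
    (fun n => ρ n / scale p h (lam n) (u n (r n)))
  energy_neck : Tendsto (fun n => energy p h (lam n) (mu n) (u n) (ρprev n) (ρbar n)) atTop (𝓝 0)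
  energy_bubble : Tendsto (fun n => energy p h (lam n) (mu n) (u n) (ρbar n) (ρ n)) atTop
    (𝓝 (2 * bubbleA p k / bubbleDelta p k ^ (p - 1)))
  energy'_neck : Tendsto (fun n => energy' p h (lam n) (u n) (ρprev n) (ρbar n)) atTop (𝓝 0)
  energy'_bubble : Tendsto (fun n => energy' p h (lam n) (u n) (ρbar n) (ρ n)) atTop
    (𝓝 (2 * bubbleA p k))

/-- `x n = {q n * log (1 / s n)}^(1/p)` for all large `n`
(the nonnegativity of the base excludes junk values of the real power). -/
def EventuallyEqPowLog (p : ℝ) (x q s : ℕ → ℝ) : Prop :=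
  ∀ᶠ n in atTop, 0 ≤ q n * Real.log (1 / s n) ∧ x n = (q n * Real.log (1 / s n)) ^ (1 / p)

/-- `x n = {(c + o(1)) log (1 / s n)}^(1/p)` as `n → ∞`. -/
def PowLogAsymp (p : ℝ) (x s : ℕ → ℝ) (c : ℝ) : Prop :=
  ∃ e : ℕ → ℝ, Tendsto e atTop (𝓝 0) ∧ EventuallyEqPowLog p x (fun n => c + e n) s

end

noncomputable section

/-! ### Calculus helpers -/

/-! In logarithmic time `t = log r` the height `W` and the flux `Q = -W'` satisfy `Q' = λ e^{2t}
f(W) ≥ 0`. Thus `W` is concave, energies are differences of fluxes, and everything is read off from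
the pair (height, flux). Since `log f(t)` behaves like `t^p`, also in its derivative, the exponent
`log λ + 2t + W^p`, measured in units of `μ^p`, decides where the density `Q'` matters.

Bubbles. Around a height `m` the rescaled solution almost solves `ζ'' = -exp(2S + ζ)`, whose
solutions used here are the profiles with parameters `a`, `b`. By a Gronwall estimate
(`exists_window_close`) closeness at one point of a bounded window gives closeness on the window, so
identifying a bubble means matching one height and one slope (`BubbleConv.of_base`). For the first
bubble the matching is done on a half line by a contraction (`exists_inner_close`). The profile
enters with slope parameter `2 - a` and leaves with `2 + a`.

Necks. After a bubble at relative height `x`, with slope `A = 2 + a`, the solution lies below its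
tangent. Along the tangent `W^p` falls faster than `2t` grows, as long as the relative height `q`
satisfies `1 - q^p > (2p/A)(1 - q)`. There the density decays exponentially and the flux stays
constant (`NeckState.exists_dens_le`, `NeckState.exists_flux_le`). For `p < 2` this persists to the
boundary, for `p = 2` down to every positive relative height. For `p > 2` the inequality becomes an
equality at a ratio in `(0,1)`, which is the equation for `δ_{k+1}/δ_k`. Constancy of the flux
between the two heights is the recurrence for `a_{k+1}`.

The next bubble. Near the critical height `y` the normalized density `D` and flux `X` obey the
approximate conservation law `D - 2X + X²/2 = const`. Starting from `D = 0`, `X = 2 - a`, it gives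
`D = (a² - (2 - X)²)/2`. Once the flux is known to pass the value `2` near height `y`
(`NeckState.flux_growth`, `NeckState.flux_passes`), the centre is the time with `X = 2`, where `D =
a²/2` (`NeckState.exists_center`). These are the data of the profile at its centre, so a bubble
forms, a new neck follows, and induction applies (`exists_bubble_sequence`).

Asymptotics. In units of `μ^p` both `u^p` and `log λ + 2 log r` are known at all the points
considered, so only `log λ / μ^p` is missing. It is `p/2 - 1` for `p < 2` and `0` for `p ≥ 2`. For
`p > 2` each neck encloses it between multiples of `δ_k^p`, and `δ_k → 0` by `tendsto_bubbleDelta`.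
-/

theorem sub_le_sub_of_hasDerivAt_le {f g f' g' : ℝ → ℝ} {a b : ℝ} (hab : a ≤ b)
    (hf : ∀ x ∈ Icc a b, HasDerivAt f (f' x) x) (hg : ∀ x ∈ Icc a b, HasDerivAt g (g' x) x)
    (hle : ∀ x ∈ Icc a b, f' x ≤ g' x) : f b - f a ≤ g b - g a := by
  have hd : ∀ x ∈ Icc a b, HasDerivAt (fun x => g x - f x) (g' x - f' x) x :=
    fun x hx => (hg x hx).sub (hf x hx)
  have := monotoneOn_of_hasDerivWithinAt_nonneg (convex_Icc a b)
    (fun x hx => (hd x hx).continuousAt.continuousWithinAt)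
    (fun x hx => (hd x (interior_subset hx)).hasDerivWithinAt)
    (fun x hx => sub_nonneg.2 (hle x (interior_subset hx)))
  have := this (left_mem_Icc.2 hab) (right_mem_Icc.2 hab) hab
  simp only at this
  linarith

theorem hasDerivAt_rpow_pos (p : ℝ) {t : ℝ} (ht : 0 < t) :
    HasDerivAt (fun t : ℝ => t ^ p) (p * t ^ (p - 1)) t :=
  Real.hasDerivAt_rpow_const (Or.inl ht.ne')

/-- Diagonal choice of a slowly growing index. -/
theorem exists_tendsto_diagonal {P : ℕ → ℕ → Prop} (hP : ∀ k, ∀ᶠ n in atTop, P k n) :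
    ∃ N : ℕ → ℕ, Tendsto N atTop atTop ∧ ∀ᶠ n in atTop, P (N n) n := by
  classical
  choose a ha using fun k => eventually_atTop.1 (hP k)
  -- The index is the largest `k ≤ n` whose threshold `a k` has been passed. Each fixed `k`
  -- qualifies eventually, and `0` qualifies as soon as `n ≥ a 0`.
  refine ⟨fun n => Nat.findGreatest (fun k => a k ≤ n) n, ?_, ?_⟩
  · refine tendsto_atTop.2 fun k => ?_
    filter_upwards [eventually_ge_atTop (max k (a k))] with n hn
    exact Nat.le_findGreatest ((le_max_left _ _).trans hn) ((le_max_right _ _).trans hn)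
  · filter_upwards [eventually_ge_atTop (a 0)] with n hn
    have := Nat.findGreatest_spec (P := fun k => a k ≤ n) (Nat.zero_le n) hn
    exact ha _ _ this

/-! ### The nonlinearity -/

section Nonlinearity

variable {p : ℝ} {h : ℝ → ℝ}

theorem nonlin_nonneg (hH0 : StandingH h) {t : ℝ} (ht : 0 ≤ t) : 0 ≤ nonlin p h t :=
  mul_nonneg (hH0.nonneg t ht) (Real.exp_pos _).le

theorem nonlin_continuousOn (hp : 0 < p) (hH0 : StandingH h) :
    ContinuousOn (nonlin p h) (Ici 0) := by
  unfold nonlin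
  have := (Real.continuous_rpow_const hp.le).rexp
  exact hH0.contDiffOn.continuousOn.mul this.continuousOn

/-- The logarithmic derivative of the nonlinearity is asymptotic to `p t^(p-1)`. -/
theorem exists_hasDerivAt_log_nonlin (hp : 0 < p) (hH0 : StandingH h) (hH1 : GrowthH p h)
    {ε : ℝ} (hε : 0 < ε) : ∃ T : ℝ, 0 < T ∧ ∃ d : ℝ → ℝ, ∀ t, T ≤ t → 0 < nonlin p h t ∧
      HasDerivAt (fun t => Real.log (nonlin p h t)) (d t) t ∧
      (1 - ε) * (p * t ^ (p - 1)) ≤ d t ∧ d t ≤ (1 + ε) * (p * t ^ (p - 1)) := by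
  obtain ⟨t₀, ht₀, hpos⟩ := hH0.eventually_pos
  have hev := (Metric.tendsto_nhds.1 hH1 (ε * p) (by positivity))
  obtain ⟨t₁, ht₁⟩ := eventually_atTop.1 hev
  refine ⟨max t₀ t₁, lt_max_of_lt_left ht₀, fun t => deriv h t / h t + p * t ^ (p - 1), ?_⟩
  intro t ht
  have h0 : t₀ ≤ t := (le_max_left _ _).trans ht
  have htp : 0 < t := ht₀.trans_le h0
  have hh := hpos t h0
  have hq : 0 < t ^ (p - 1) := Real.rpow_pos_of_pos htp _
  have hd : HasDerivAt h (deriv h t) t :=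
    ((hH0.contDiffOn.differentiableOn one_ne_zero).differentiableAt
      (Ici_mem_nhds htp)).hasDerivAt
  have hn : 0 < nonlin p h t := mul_pos hh (Real.exp_pos _)
  have hnd : HasDerivAt (nonlin p h)
      (deriv h t * Real.exp (t ^ p) + h t * (Real.exp (t ^ p) * (p * t ^ (p - 1)))) t :=
    hd.mul ((hasDerivAt_rpow_pos p htp).exp)
  have hb := ht₁ t ((le_max_right _ _).trans ht)
  rw [Real.dist_eq, sub_zero, abs_lt, lt_div_iff₀ (by positivity), div_lt_iff₀ (by positivity)]
    at hb
  have e : deriv h t = (deriv h t / h t) * h t := by field_simp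
  refine ⟨hn, ?_, ?_, ?_⟩
  · have := hnd.log hn.ne'
    convert this using 1
    unfold nonlin
    have := Real.exp_pos (t ^ p)
    field_simp
  · have : -(ε * p) * t ^ (p - 1) < deriv h t / h t := by
      rw [lt_div_iff₀ hh]; linarith [hb.1]
    linarith
  · have : deriv h t / h t < (ε * p) * t ^ (p - 1) := by
      rw [div_lt_iff₀ hh]; linarith [hb.2]
    linarith

/-- Integration of the bounds on the logarithmic derivative. The relative error is uniform over
intervals of any length, as needed on necks, where the height changes by a multiple of `μ`. -/
theorem exists_log_nonlin_sub_bounds (hp : 0 < p) (hH0 : StandingH h) (hH1 : GrowthH p h)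
    {ε : ℝ} (hε : 0 < ε) : ∃ T : ℝ, 0 < T ∧ ∀ s t, T ≤ s → s ≤ t → 0 < nonlin p h s ∧
      (1 - ε) * (t ^ p - s ^ p) ≤ Real.log (nonlin p h t) - Real.log (nonlin p h s) ∧
      Real.log (nonlin p h t) - Real.log (nonlin p h s) ≤ (1 + ε) * (t ^ p - s ^ p) := by
  obtain ⟨T, hT, d, hd⟩ := exists_hasDerivAt_log_nonlin hp hH0 hH1 hε
  refine ⟨T, hT, fun s t hs hst => ⟨(hd s hs).1, ?_, ?_⟩⟩
  · have := sub_le_sub_of_hasDerivAt_le (f := fun t => (1 - ε) * t ^ p) hst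
      (fun x hx => (hasDerivAt_rpow_pos p (hT.trans_le (hs.trans hx.1))).const_mul (1 - ε))
      (fun x hx => (hd x (hs.trans hx.1)).2.1) (fun x hx => (hd x (hs.trans hx.1)).2.2.1)
    linarith
  · have := sub_le_sub_of_hasDerivAt_le (g := fun t => (1 + ε) * t ^ p) hst
      (fun x hx => (hd x (hs.trans hx.1)).2.1)
      (fun x hx => (hasDerivAt_rpow_pos p (hT.trans_le (hs.trans hx.1))).const_mul (1 + ε))
      (fun x hx => (hd x (hs.trans hx.1)).2.2.2)
    linarith

theorem tendsto_log_nonlin_div (hp : 0 < p) (hH0 : StandingH h) (hH1 : GrowthH p h) :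
    Tendsto (fun t => Real.log (nonlin p h t) / t ^ p) atTop (𝓝 1) := by
  rw [Metric.tendsto_nhds]
  intro ε hε
  obtain ⟨T, hT, hb⟩ := exists_log_nonlin_sub_bounds hp hH0 hH1 (half_pos hε)
  set K : ℝ := |Real.log (nonlin p h T)| + (1 + ε / 2) * T ^ p with hK
  have h1 : Tendsto (fun t : ℝ => t ^ p) atTop atTop := tendsto_rpow_atTop hp
  filter_upwards [eventually_ge_atTop T, h1.eventually_gt_atTop (K / (ε / 2)),
    h1.eventually_gt_atTop 0] with t ht h2 h3
  obtain ⟨-, b1, b2⟩ := hb T t le_rfl ht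
  have hTp : 0 < T ^ p := Real.rpow_pos_of_pos hT p
  rw [div_lt_iff₀ (by positivity)] at h2
  have e : Real.log (nonlin p h t) / t ^ p - 1 = (Real.log (nonlin p h t) - t ^ p) / t ^ p := by
    field_simp
  rw [Real.dist_eq, e, abs_div, abs_of_pos h3, div_lt_iff₀ h3, abs_lt]
  have := abs_le.1 (le_refl |Real.log (nonlin p h T)|)
  have h5 : 0 < ε * T ^ p := by positivity
  constructor <;> nlinarith

theorem tendsto_nonlin_atTop (hp : 0 < p) (hH0 : StandingH h) (hH1 : GrowthH p h) :
    Tendsto (nonlin p h) atTop atTop := by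
  obtain ⟨t₀, ht₀, hpos⟩ := hH0.eventually_pos
  have h1 : Tendsto (fun t : ℝ => t ^ p) atTop atTop := tendsto_rpow_atTop hp
  have h2 := (tendsto_log_nonlin_div hp hH0 hH1).eventually_const_lt
    (show (1 / 2 : ℝ) < 1 by norm_num)
  have h3 : Tendsto (fun t => Real.log (nonlin p h t)) atTop atTop := by
    refine tendsto_atTop_mono' _ ?_ (h1.const_mul_atTop (show (0 : ℝ) < 1 / 2 by norm_num))
    filter_upwards [h2, h1.eventually_gt_atTop 0] with t a b
    rw [lt_div_iff₀ b] at a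
    exact a.le
  refine (Real.tendsto_exp_atTop.comp h3).congr' ?_
  filter_upwards [eventually_ge_atTop t₀] with t ht
  exact Real.exp_log (mul_pos (hpos t ht) (Real.exp_pos _))

/-- The nonlinearity at a large argument dominates its values at all smaller ones. -/
theorem exists_nonlin_le (hp : 0 < p) (hH0 : StandingH h) (hH1 : GrowthH p h) :
    ∃ T : ℝ, 0 < T ∧ ∀ v, T ≤ v → 0 < nonlin p h v ∧ ∀ u, 0 ≤ u → u ≤ v →
      nonlin p h u ≤ nonlin p h v := by
  obtain ⟨T, hT, hb⟩ := exists_log_nonlin_sub_bounds hp hH0 hH1 (ε := 1 / 2) (by norm_num)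
  obtain ⟨C, hC⟩ := (isCompact_Icc (a := (0 : ℝ)) (b := T)).bddAbove_image
    ((nonlin_continuousOn hp hH0).mono Icc_subset_Ici_self)
  obtain ⟨T', hT'⟩ := eventually_atTop.1
    ((tendsto_nonlin_atTop hp hH0 hH1).eventually_ge_atTop C)
  refine ⟨max T T', lt_max_of_lt_left hT, fun v hv => ?_⟩
  have hTv : T ≤ v := (le_max_left _ _).trans hv
  have hv0 := (hb v v hTv le_rfl).1
  refine ⟨hv0, fun u hu huv => ?_⟩
  -- `f` need not be monotone. Values below `T` are dominated because they are bounded on a compact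
  -- interval and `f → ∞`; above `T` the increments of `log f` are at least half those of `t^p`.
  rcases le_total u T with h1 | h1
  · exact (hC (mem_image_of_mem _ ⟨hu, h1⟩)).trans (hT' v ((le_max_right _ _).trans hv))
  · obtain ⟨h2, h3, -⟩ := hb u v h1 huv
    have : u ^ p ≤ v ^ p := Real.rpow_le_rpow hu huv hp.le
    refine (Real.log_le_log_iff h2 hv0).1 ?_
    linarith

/-- Local expansion of `log f` at the scale on which the bubbles live. -/
theorem exists_log_nonlin_expansion (hp : 0 < p) (hH0 : StandingH h) (hH1 : GrowthH p h)
    (B : ℝ) {ε : ℝ} (hε : 0 < ε) : ∃ T : ℝ, 0 < T ∧ ∀ m, T ≤ m → ∀ ζ, |ζ| ≤ B →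
      0 < m + ζ / (p * m ^ (p - 1)) ∧ 0 < nonlin p h (m + ζ / (p * m ^ (p - 1))) ∧
      |Real.log (nonlin p h (m + ζ / (p * m ^ (p - 1)))) - Real.log (nonlin p h m) - ζ| ≤ ε ∧
      |((m + ζ / (p * m ^ (p - 1))) / m) ^ (p - 1) - 1| ≤ ε := by
  set B' : ℝ := |B| + 1 with hB'
  have hB'0 : 0 < B' := by positivity
  -- The two errors, from `log f` to `t^p` and from `t^p` to its linearization, add up to at most `3
  -- ε₁ |ζ|`. The cap `1/2` keeps the increment of `t^p` below `2|ζ|`.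
  set ε₁ : ℝ := min (ε / (4 * B')) (1 / 2) with hε₁
  have hε₁0 : 0 < ε₁ := by positivity
  obtain ⟨T, hT, hb⟩ := exists_log_nonlin_sub_bounds hp hH0 hH1 hε₁0
  -- first order expansion of the power at `1`
  have hder := (hasDerivAt_rpow_pos p (zero_lt_one' ℝ)).isLittleO
  have hder1 := (Asymptotics.isLittleO_iff.1 hder) (show 0 < ε₁ * p by positivity)
  have hcont : ContinuousAt (fun y : ℝ => y ^ (p - 1)) 1 :=
    Real.continuousAt_rpow_const _ _ (Or.inl one_ne_zero)
  have hcont1 := Metric.tendsto_nhds.1 hcont.tendsto ε hε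
  obtain ⟨η, hη, hball⟩ := Metric.eventually_nhds_iff.1 (hder1.and hcont1)
  have h1 : Tendsto (fun t : ℝ => t ^ p) atTop atTop := tendsto_rpow_atTop hp
  set η' := min η (1 / 2) with hη'
  have hη'0 : 0 < η' := by positivity
  obtain ⟨T₂, hT₂⟩ := eventually_atTop.1 (h1.eventually_gt_atTop (B' / (p * η')))
  -- The point is written below as `m (1 + y)` with `y = ζ / (p m^p)`. For large `m` one has `|y| <
  -- 1/2`, so the threshold `2T` for `m` keeps it above `T`.
  refine ⟨max (2 * T) T₂, by positivity, fun m hm ζ hζ => ?_⟩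
  have hm1 : 2 * T ≤ m := (le_max_left _ _).trans hm
  have hm0 : 0 < m := by linarith
  have hmp : 0 < m ^ p := Real.rpow_pos_of_pos hm0 p
  have hζ' : |ζ| < B' := by
    have := le_abs_self B
    linarith
  have hm2 := hT₂ m ((le_max_right _ _).trans hm)
  rw [div_lt_iff₀ (by positivity)] at hm2
  set y : ℝ := ζ / (p * m ^ p) with hy
  have hyabs : |y| < η' := by
    rw [hy, abs_div, abs_of_pos (show 0 < p * m ^ p by positivity), div_lt_iff₀ (by positivity)]
    linarith
  have e1 : m + ζ / (p * m ^ (p - 1)) = m * (1 + y) := by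
    have : m ^ p = m ^ (p - 1) * m := by
      rw [← Real.rpow_add_one hm0.ne']; congr 1; ring
    have h2 : m ^ (p - 1) ≠ 0 := (Real.rpow_pos_of_pos hm0 _).ne'
    rw [hy, this]; field_simp
  have hy2 : |y| < 1 / 2 := hyabs.trans_le (min_le_right _ _)
  have hy3 := abs_lt.1 hy2
  have hy1 : dist (1 + y) 1 < η := by
    rw [Real.dist_eq, add_sub_cancel_left]; exact hyabs.trans_le (min_le_left _ _)
  obtain ⟨c1, c2⟩ := hball hy1
  rw [e1]
  have hu0 : 0 < m * (1 + y) := by nlinarith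
  have huT : T ≤ m * (1 + y) := by nlinarith
  refine ⟨hu0, (hb _ _ huT le_rfl).1, ?_, ?_⟩
  · simp only [Real.one_rpow, mul_one, add_sub_cancel_left, smul_eq_mul, Real.norm_eq_abs] at c1
    have e2 : (m * (1 + y)) ^ p - m ^ p = m ^ p * ((1 + y) ^ p - 1) := by
      rw [Real.mul_rpow hm0.le (by linarith)]; ring
    have e3 : m ^ p * (y * p) = ζ := by rw [hy]; field_simp
    have e4 : |(m * (1 + y)) ^ p - m ^ p - ζ| ≤ ε₁ * |ζ| := by
      have : (m * (1 + y)) ^ p - m ^ p - ζ = m ^ p * ((1 + y) ^ p - 1 - y * p) := by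
        rw [e2]; linear_combination e3
      rw [this, abs_mul, abs_of_pos hmp]
      calc m ^ p * |(1 + y) ^ p - 1 - y * p| ≤ m ^ p * (ε₁ * p * |y|) := by gcongr
        _ = ε₁ * |m ^ p * (y * p)| := by
            rw [abs_mul, abs_mul, abs_of_pos hmp, abs_of_pos hp]; ring
        _ = ε₁ * |ζ| := by rw [e3]
    have e5 : |Real.log (nonlin p h (m * (1 + y))) - Real.log (nonlin p h m)
        - ((m * (1 + y)) ^ p - m ^ p)| ≤ ε₁ * |(m * (1 + y)) ^ p - m ^ p| := by
      have hmT : T ≤ m := by linarith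
      rcases le_total (m * (1 + y)) m with hle | hle
      · obtain ⟨-, d1, d2⟩ := hb _ _ huT hle
        have : (m * (1 + y)) ^ p ≤ m ^ p := Real.rpow_le_rpow hu0.le hle hp.le
        rw [abs_of_nonpos (show (m * (1 + y)) ^ p - m ^ p ≤ 0 by linarith), abs_le]
        constructor <;> linarith
      · obtain ⟨-, d1, d2⟩ := hb _ _ hmT hle
        have : m ^ p ≤ (m * (1 + y)) ^ p := Real.rpow_le_rpow hm0.le hle hp.le
        rw [abs_of_nonneg (show 0 ≤ (m * (1 + y)) ^ p - m ^ p by linarith), abs_le]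
        constructor <;> linarith
    have e6 : |(m * (1 + y)) ^ p - m ^ p| ≤ 2 * |ζ| := by
      have : |(m * (1 + y)) ^ p - m ^ p| ≤ |(m * (1 + y)) ^ p - m ^ p - ζ| + |ζ| := by
        simpa using abs_add_le ((m * (1 + y)) ^ p - m ^ p - ζ) ζ
      have h2 : ε₁ ≤ 1 / 2 := min_le_right _ _
      have := abs_nonneg ζ
      nlinarith
    have e7 : ε₁ * (4 * B') ≤ ε := by
      have : ε₁ ≤ ε / (4 * B') := min_le_left _ _
      rwa [le_div_iff₀ (by positivity)] at this
    calc |Real.log (nonlin p h (m * (1 + y))) - Real.log (nonlin p h m) - ζ|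
        = |(Real.log (nonlin p h (m * (1 + y))) - Real.log (nonlin p h m)
          - ((m * (1 + y)) ^ p - m ^ p)) + ((m * (1 + y)) ^ p - m ^ p - ζ)| := by ring_nf
      _ ≤ _ := abs_add_le _ _
      _ ≤ ε₁ * (2 * |ζ|) + ε₁ * |ζ| := by
          gcongr
          exact e5.trans (by gcongr)
      _ ≤ ε₁ * (4 * B') := by nlinarith
      _ ≤ ε := e7
  · rw [Real.dist_eq, Real.one_rpow] at c2
    rw [mul_div_cancel_left₀ _ hm0.ne']
    exact c2.le

end Nonlinearity

/-! ### Solutions in logarithmic time -/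

/-- A radial solution in the variable `t = log r < 0`; `W` is the height and `Q = -W'` the flux. -/
structure LogSol (p : ℝ) (h : ℝ → ℝ) (lam mu : ℝ) (W Q : ℝ → ℝ) : Prop where
  lam_pos : 0 < lam
  deriv_W : ∀ t < 0, HasDerivAt W (-Q t) t
  deriv_Q : ∀ t < 0, HasDerivAt Q (lam * Real.exp (2 * t) * nonlin p h (W t)) t
  pos : ∀ t < 0, 0 < W t
  Q_nonneg : ∀ t < 0, 0 ≤ Q t
  Q_mono : ∀ s t, s ≤ t → t < 0 → Q s ≤ Q t
  lim_W : Tendsto W atBot (𝓝 mu)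
  lim_Q : Tendsto Q atBot (𝓝 0)
  lim_zero : Tendsto W (𝓝[<] 0) (𝓝 0)

/-- The density of the energy in logarithmic time. -/
def dens (p : ℝ) (h : ℝ → ℝ) (lam : ℝ) (W : ℝ → ℝ) (t : ℝ) : ℝ :=
  lam * Real.exp (2 * t) * nonlin p h (W t)

/-- The height as a function of `log r`. -/
def logHeight (v : ℝ → ℝ) (t : ℝ) : ℝ := v (Real.exp t)

/-- The flux `-r v'(r)` as a function of `log r`. -/
def logFlux (v : ℝ → ℝ) (t : ℝ) : ℝ := -(Real.exp t * deriv v (Real.exp t))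

theorem exp_mem_Ioo {t : ℝ} (ht : t < 0) : Real.exp t ∈ Ioo (0 : ℝ) 1 :=
  ⟨Real.exp_pos t, by simpa using ht⟩

/-- The first order term disappears in logarithmic time, which makes `W` concave. Concavity,
together with positivity of `W` and its finite limit at `-∞`, gives the sign and the limit of the
flux. -/
theorem IsRadialSolution.logSol {p : ℝ} {h : ℝ → ℝ} {lam mu : ℝ} {v : ℝ → ℝ}
    (hH0 : StandingH h) (hs : IsRadialSolution p h lam mu v) :
    LogSol p h lam mu (logHeight v) (logFlux v) := by
  have hW : ∀ t < 0, HasDerivAt (logHeight v) (-logFlux v t) t := fun t ht => by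
    have h1 := (hs.differentiableAt _ (exp_mem_Ioo ht)).hasDerivAt.comp t (Real.hasDerivAt_exp t)
    refine h1.congr_deriv ?_
    simp only [logFlux]; ring
  have hQ : ∀ t < 0, HasDerivAt (logFlux v)
      (lam * Real.exp (2 * t) * nonlin p h (logHeight v t)) t := fun t ht => by
    have h1 := (hs.differentiableAt_deriv _ (exp_mem_Ioo ht)).hasDerivAt.comp t
      (Real.hasDerivAt_exp t)
    have h2 := ((Real.hasDerivAt_exp t).mul h1).neg
    refine h2.congr_deriv ?_
    have e := hs.equation _ (exp_mem_Ioo ht)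
    have e2 : Real.exp (2 * t) = Real.exp t * Real.exp t := by rw [← Real.exp_add]; ring_nf
    have e3 := Real.exp_pos t
    simp only [logHeight, Function.comp_apply]
    rw [e2]
    have e4 : lam * (Real.exp t * Real.exp t) * nonlin p h (v (Real.exp t))
      = (Real.exp t * Real.exp t) * (lam * nonlin p h (v (Real.exp t))) := by ring
    rw [e4, ← e]
    field_simp
    ring
  have hpos : ∀ t < 0, 0 < logHeight v t := fun t ht => hs.pos _ (exp_mem_Ioo ht)
  have hmono : ∀ s t, s ≤ t → t < 0 → logFlux v s ≤ logFlux v t := fun s t hst ht => by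
    have := sub_le_sub_of_hasDerivAt_le (f := fun _ => 0) (f' := fun _ => 0) hst
      (fun x _ => hasDerivAt_const x 0) (fun x hx => hQ x (hx.2.trans_lt ht))
      (fun x hx => mul_nonneg (mul_nonneg hs.lam_pos.le (Real.exp_pos _).le)
        (nonlin_nonneg hH0 (hpos x (hx.2.trans_lt ht)).le))
    linarith
  have hlimW : Tendsto (logHeight v) atBot (𝓝 mu) := by
    have h1 : Tendsto v (𝓝[Icc 0 1] 0) (𝓝 mu) := by
      have := hs.continuousOn 0 (left_mem_Icc.2 zero_le_one)
      rwa [ContinuousWithinAt, hs.at_zero] at this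
    refine h1.comp (tendsto_nhdsWithin_iff.2 ⟨Real.tendsto_exp_atBot, ?_⟩)
    filter_upwards [eventually_lt_atBot 0] with t ht using Ioo_subset_Icc_self (exp_mem_Ioo ht)
  have hlim0 : Tendsto (logHeight v) (𝓝[<] 0) (𝓝 0) := by
    have h1 : Tendsto v (𝓝[Icc 0 1] 1) (𝓝 0) := by
      have := hs.continuousOn 1 (right_mem_Icc.2 zero_le_one)
      rwa [ContinuousWithinAt, hs.at_one] at this
    refine h1.comp (tendsto_nhdsWithin_iff.2 ⟨?_, ?_⟩)
    · have := Real.continuous_exp.tendsto 0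
      rw [Real.exp_zero] at this
      exact this.mono_left nhdsWithin_le_nhds
    · filter_upwards [self_mem_nhdsWithin] with t ht using Ioo_subset_Icc_self (exp_mem_Ioo ht)
  -- comparison of the height with the flux at the right end point
  have hlin : ∀ s t, s ≤ t → t < 0 → logHeight v s ≤ logHeight v t + logFlux v t * (t - s) :=
    fun s t hst ht => by
      have := sub_le_sub_of_hasDerivAt_le (f := fun x => -logFlux v t * x) hst
        (fun x _ => by simpa using (hasDerivAt_id x).const_mul (-logFlux v t))
        (fun x hx => hW x (hx.2.trans_lt ht))
        (fun x hx => neg_le_neg (hmono x t hx.2 ht))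
      linarith
  have hlin' : ∀ s t, s ≤ t → t < 0 → logHeight v t + logFlux v s * (t - s) ≤ logHeight v s :=
    fun s t hst ht => by
      have := sub_le_sub_of_hasDerivAt_le (g := fun x => -logFlux v s * x) hst
        (fun x hx => hW x (hx.2.trans_lt ht))
        (fun x _ => by simpa using (hasDerivAt_id x).const_mul (-logFlux v s))
        (fun x hx => neg_le_neg (hmono s x hx.1 (hx.2.trans_lt ht)))
      linarith
  have hQ0 : ∀ t < 0, 0 ≤ logFlux v t := fun t ht => by
    by_contra hneg
    -- A negative flux would, by concavity, force `W` to `-∞` as time goes to `-∞`, against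
    -- positivity.
    push Not at hneg
    have hl : Tendsto (fun s => logHeight v t + logFlux v t * (t - s)) atBot atBot := by
      apply tendsto_atBot_add_const_left
      exact (tendsto_atTop_add_const_left _ t tendsto_neg_atBot_atTop).const_mul_atTop_of_neg hneg
    obtain ⟨s, h1, h2, h3⟩ := ((hl.eventually_lt_atBot 0).and
      ((eventually_le_atBot t).and (eventually_lt_atBot 0))).exists
    exact absurd (hlin s t h2 ht) (not_le.2 (h1.trans (hpos s h3)))
  refine ⟨hs.lam_pos, hW, hQ, hpos, hQ0, hmono, hlimW, ?_, hlim0⟩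
  rw [Metric.tendsto_nhds]
  intro ε hε
  suffices H : ∃ t < 0, logFlux v t < ε by
    obtain ⟨t, ht, h1⟩ := H
    filter_upwards [eventually_le_atBot t] with s hs'
    rw [Real.dist_eq, sub_zero, abs_of_nonneg (hQ0 s (hs'.trans_lt ht))]
    exact (hmono s t hs' ht).trans_lt h1
  by_contra hcon
  -- A flux bounded below by `ε` would make `W` grow linearly towards `-∞`, against its limit `mu`.
  push Not at hcon
  have hl : Tendsto (fun s => logHeight v (-1) + ε * (-1 - s)) atBot atTop := by
    apply tendsto_atTop_add_const_left
    exact (tendsto_atTop_add_const_left _ _ tendsto_neg_atBot_atTop).const_mul_atTop hε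
  obtain ⟨s, h1, h2, h3⟩ := ((hl.eventually_gt_atTop (mu + 1)).and
    ((eventually_le_atBot (-1)).and (hlimW.eventually_lt_const (lt_add_one mu)))).exists
  have h4 := hlin' s (-1) h2 (by norm_num)
  have h5 := hcon s (by linarith)
  have : ε * (-1 - s) ≤ logFlux v s * (-1 - s) := mul_le_mul_of_nonneg_right h5 (by linarith)
  linarith

namespace LogSol

variable {p : ℝ} {h : ℝ → ℝ} {lam mu : ℝ} {W Q : ℝ → ℝ}

/-- The graph of the concave function `W` lies below its tangents. This bound and the following one
convert drops of the height into elapsed times and back. -/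
theorem sub_le (hs : LogSol p h lam mu W Q) {s t : ℝ} (hst : s ≤ t) (ht : t < 0) :
    W s - W t ≤ Q t * (t - s) := by
  have := sub_le_sub_of_hasDerivAt_le (f := fun x => -Q t * x) hst
    (fun x _ => by simpa using (hasDerivAt_id x).const_mul (-Q t))
    (fun x hx => hs.deriv_W x (hx.2.trans_lt ht))
    (fun x hx => neg_le_neg (hs.Q_mono x t hx.2 ht))
  linarith

theorem le_sub (hs : LogSol p h lam mu W Q) {s t : ℝ} (hst : s ≤ t) (ht : t < 0) :
    Q s * (t - s) ≤ W s - W t := by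
  have := sub_le_sub_of_hasDerivAt_le (g := fun x => -Q s * x) hst
    (fun x hx => hs.deriv_W x (hx.2.trans_lt ht))
    (fun x _ => by simpa using (hasDerivAt_id x).const_mul (-Q s))
    (fun x hx => neg_le_neg (hs.Q_mono s x hx.1 (hx.2.trans_lt ht)))
  linarith

theorem W_anti (hs : LogSol p h lam mu W Q) {s t : ℝ} (hst : s ≤ t) (ht : t < 0) : W t ≤ W s := by
  have := hs.le_sub hst ht
  have h2 := mul_nonneg (hs.Q_nonneg s (hst.trans_lt ht)) (sub_nonneg.2 hst)
  linarith

theorem W_le (hs : LogSol p h lam mu W Q) {t : ℝ} (ht : t < 0) : W t ≤ mu := by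
  refine ge_of_tendsto hs.lim_W ?_
  filter_upwards [eventually_le_atBot t] with s hst using hs.W_anti hst ht

theorem mu_pos (hs : LogSol p h lam mu W Q) : 0 < mu :=
  (hs.pos (-1) (by norm_num)).trans_le (hs.W_le (by norm_num))

/-- The flux, bounded by means of the boundary condition. -/
theorem Q_mul_le (hs : LogSol p h lam mu W Q) {t : ℝ} (ht : t < 0) : Q t * (-t) ≤ W t := by
  have h1 : Tendsto (fun x => Q t * (x - t)) (𝓝[<] 0) (𝓝 (Q t * (0 - t))) :=
    ((tendsto_nhdsWithin_of_tendsto_nhds tendsto_id).sub_const t).const_mul _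
  have h2 : Tendsto (fun x => W t - W x) (𝓝[<] 0) (𝓝 (W t - 0)) := hs.lim_zero.const_sub _
  rw [zero_sub] at h1
  rw [sub_zero] at h2
  refine le_of_tendsto_of_tendsto h1 h2 ?_
  filter_upwards [self_mem_nhdsWithin, Ioo_mem_nhdsLT ht] with x hx hx'
  exact hs.le_sub hx'.1.le hx

theorem W_le_of_Q_le (hs : LogSol p h lam mu W Q) {t q : ℝ} (ht : t < 0)
    (hq : ∀ x, t ≤ x → x < 0 → Q x ≤ q) : W t ≤ q * (-t) := by
  have h1 : Tendsto (fun x => q * (x - t)) (𝓝[<] 0) (𝓝 (q * (0 - t))) :=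
    ((tendsto_nhdsWithin_of_tendsto_nhds tendsto_id).sub_const t).const_mul _
  have h2 : Tendsto (fun x => W t - W x) (𝓝[<] 0) (𝓝 (W t - 0)) := hs.lim_zero.const_sub _
  rw [zero_sub] at h1
  rw [sub_zero] at h2
  refine le_of_tendsto_of_tendsto h2 h1 ?_
  filter_upwards [self_mem_nhdsWithin, Ioo_mem_nhdsLT ht] with x hx hx'
  refine (hs.sub_le hx'.1.le hx).trans ?_
  exact mul_le_mul_of_nonneg_right (hq x hx'.1.le hx) (by linarith [hx'.1])

theorem continuousOn_W (hs : LogSol p h lam mu W Q) : ContinuousOn W (Iio 0) :=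
  fun t ht => (hs.deriv_W t ht).continuousAt.continuousWithinAt

theorem continuousOn_Q (hs : LogSol p h lam mu W Q) : ContinuousOn Q (Iio 0) :=
  fun t ht => (hs.deriv_Q t ht).continuousAt.continuousWithinAt

/-- Every height below the present one is attained later. -/
theorem exists_W_eq (hs : LogSol p h lam mu W Q) {e y : ℝ} (he : e < 0) (hy : 0 < y)
    (hye : y ≤ W e) : ∃ t, e ≤ t ∧ t < 0 ∧ W t = y := by
  obtain ⟨x, h1, h2, h3⟩ := ((hs.lim_zero.eventually_lt_const hy).and
    (eventually_mem_nhdsWithin.and (Ioo_mem_nhdsLT he))).exists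
  obtain ⟨t, ht, hty⟩ := intermediate_value_Icc' h3.1.le
    (hs.continuousOn_W.mono fun z hz => hz.2.trans_lt h2) ⟨h1.le, hye⟩
  exact ⟨t, ht.1, ht.2.trans_lt h2, hty⟩

/-- Every positive flux below the present one is attained earlier. -/
theorem exists_Q_eq (hs : LogSol p h lam mu W Q) {e y : ℝ} (he : e < 0) (hy : 0 < y)
    (hye : y ≤ Q e) : ∃ t, t ≤ e ∧ Q t = y := by
  obtain ⟨x, h1, h3⟩ := ((hs.lim_Q.eventually_lt_const hy).and (eventually_le_atBot e)).exists
  obtain ⟨t, ht, hty⟩ := intermediate_value_Icc h3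
    (hs.continuousOn_Q.mono fun z hz => hz.2.trans_lt he) ⟨h1.le, hye⟩
  exact ⟨t, ht.2, hty⟩

theorem le_of_W_lt (hs : LogSol p h lam mu W Q) {s t : ℝ} (hs0 : s < 0) (hW : W t < W s) :
    s ≤ t := by
  by_contra hc
  push Not at hc
  exact absurd (hs.W_anti hc.le hs0) (not_le.2 hW)

theorem le_of_Q_lt (hs : LogSol p h lam mu W Q) {s t : ℝ} (hs0 : s < 0) (hQ : Q s < Q t) :
    s ≤ t := by
  by_contra hc
  push Not at hc
  exact absurd (hs.Q_mono t s hc.le hs0) (not_le.2 hQ)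

theorem hasDerivAt_Q (hs : LogSol p h lam mu W Q) {t : ℝ} (ht : t < 0) :
    HasDerivAt Q (dens p h lam W t) t := hs.deriv_Q t ht

theorem dens_nonneg (hs : LogSol p h lam mu W Q) (hH0 : StandingH h) {t : ℝ} (ht : t < 0) :
    0 ≤ dens p h lam W t :=
  mul_nonneg (mul_nonneg hs.lam_pos.le (Real.exp_pos _).le) (nonlin_nonneg hH0 (hs.pos t ht).le)

end LogSol

/-! ### Profiles of the bubbles in logarithmic variables -/

/-- The profile with parameters `a`, `b` as a function of `S = log R`. -/
def logProfile (a b S : ℝ) : ℝ :=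
  Real.log (2 * a ^ 2 * b) + (a - 2) * S - 2 * Real.log (1 + b * Real.exp (a * S))

/-- The derivative of `logProfile`. -/
def logProfile' (a b S : ℝ) : ℝ :=
  a - 2 - 2 * a * (b * Real.exp (a * S) / (1 + b * Real.exp (a * S)))

theorem hasDerivAt_logProfile {a b : ℝ} (hb : 0 < b) (S : ℝ) :
    HasDerivAt (logProfile a b) (logProfile' a b S) S := by
  have h1 : HasDerivAt (fun S => Real.exp (a * S)) (Real.exp (a * S) * a) S := by
    simpa using ((hasDerivAt_id S).const_mul a).exp
  have hpos : 0 < 1 + b * Real.exp (a * S) := by positivity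
  have h2 := ((h1.const_mul b).const_add 1).log hpos.ne'
  have h3 : HasDerivAt (fun S => Real.log (2 * a ^ 2 * b) + (a - 2) * S) (a - 2) S := by
    simpa using ((hasDerivAt_id S).const_mul (a - 2)).const_add (Real.log (2 * a ^ 2 * b))
  refine (h3.sub (h2.const_mul 2)).congr_deriv ?_
  simp only [logProfile']
  field_simp

theorem exp_logProfile {a b : ℝ} (ha : 0 < a) (hb : 0 < b) (S : ℝ) :
    Real.exp (2 * S + logProfile a b S) =
      2 * a ^ 2 * b * Real.exp (a * S) / (1 + b * Real.exp (a * S)) ^ 2 := by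
  have hpos : 0 < 1 + b * Real.exp (a * S) := by positivity
  have e : 2 * S + logProfile a b S = Real.log (2 * a ^ 2 * b) + a * S
      - (Real.log (1 + b * Real.exp (a * S)) + Real.log (1 + b * Real.exp (a * S))) := by
    simp only [logProfile]; ring
  rw [e, Real.exp_sub, Real.exp_add, Real.exp_add, Real.exp_log (by positivity),
    Real.exp_log hpos, ← sq (1 + _)]

/-- The profile solves `ζ'' = -exp(2S + ζ)`. This is the limit equation of the rescaled solutions,
since `f` at height `m + ζ/(p m^{p-1})`, divided by `f(m)`, tends to `exp ζ`. -/
theorem hasDerivAt_logProfile' {a b : ℝ} (ha : 0 < a) (hb : 0 < b) (S : ℝ) :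
    HasDerivAt (logProfile' a b) (-Real.exp (2 * S + logProfile a b S)) S := by
  have h1 : HasDerivAt (fun S => Real.exp (a * S)) (Real.exp (a * S) * a) S := by
    simpa using ((hasDerivAt_id S).const_mul a).exp
  have hpos : 0 < 1 + b * Real.exp (a * S) := by positivity
  have h2 := (((h1.const_mul b).div ((h1.const_mul b).const_add 1) hpos.ne').const_mul
    (2 * a)).const_sub (a - 2)
  refine h2.congr_deriv ?_
  rw [exp_logProfile ha hb]
  field_simp
  ring

theorem logProfile'_mem {a b : ℝ} (ha : 0 < a) (hb : 0 < b) (S : ℝ) :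
    |logProfile' a b S| ≤ 2 + a := by
  have hpos : 0 < 1 + b * Real.exp (a * S) := by positivity
  have h1 : 0 ≤ b * Real.exp (a * S) / (1 + b * Real.exp (a * S)) := by positivity
  have h2 : b * Real.exp (a * S) / (1 + b * Real.exp (a * S)) ≤ 1 := by
    rw [div_le_one hpos]; linarith
  simp only [logProfile']
  rw [abs_le]
  constructor <;> nlinarith

/-- With the limit `a - 2` at `-∞` this describes the passage of a bubble: it receives the
normalized flux `2 - a` and releases `2 + a`, and the gain `2a` is its energy. -/
theorem tendsto_logProfile'_atTop {a b : ℝ} (ha : 0 < a) (hb : 0 < b) :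
    Tendsto (logProfile' a b) atTop (𝓝 (-(2 + a))) := by
  have h1 : Tendsto (fun S => 1 + b * Real.exp (a * S)) atTop atTop :=
    tendsto_atTop_add_const_left _ _ ((Real.tendsto_exp_atTop.comp
      (tendsto_id.const_mul_atTop ha)).const_mul_atTop hb)
  have h2 := ((h1.inv_tendsto_atTop.const_sub 1).const_mul (2 * a)).const_sub (a - 2)
  refine (h2.congr fun S => ?_).trans (by ring_nf; exact le_rfl)
  have hpos : 0 < 1 + b * Real.exp (a * S) := by positivity
  simp only [logProfile', Pi.inv_apply]
  field_simp
  ring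

theorem tendsto_logProfile'_atBot {a b : ℝ} (ha : 0 < a) :
    Tendsto (logProfile' a b) atBot (𝓝 (a - 2)) := by
  have h1 : Tendsto (fun S => b * Real.exp (a * S)) atBot (𝓝 (b * 0)) :=
    (Real.tendsto_exp_atBot.comp (tendsto_id.const_mul_atBot ha)).const_mul b
  have h2 := (((h1.div (h1.const_add 1) (by simp))).const_mul (2 * a)).const_sub (a - 2)
  simp only [mul_zero, add_zero, zero_div, sub_zero] at h2
  exact h2

theorem tendsto_exp_logProfile_atTop {a b : ℝ} (ha : 0 < a) (hb : 0 < b) :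
    Tendsto (fun S => Real.exp (2 * S + logProfile a b S)) atTop (𝓝 0) := by
  have h1 : Tendsto (fun S => 1 + b * Real.exp (a * S)) atTop atTop :=
    tendsto_atTop_add_const_left _ _ ((Real.tendsto_exp_atTop.comp
      (tendsto_id.const_mul_atTop ha)).const_mul_atTop hb)
  have h2 := h1.inv_tendsto_atTop.const_mul (2 * a ^ 2)
  rw [mul_zero] at h2
  refine tendsto_of_tendsto_of_tendsto_of_le_of_le tendsto_const_nhds h2
    (fun S => (Real.exp_pos _).le) (fun S => ?_)
  have hpos : 0 < 1 + b * Real.exp (a * S) := by positivity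
  simp only [exp_logProfile ha hb, Pi.inv_apply]
  rw [div_le_iff₀ (by positivity)]
  field_simp
  have := Real.exp_pos (a * S)
  nlinarith [mul_pos hb this, sq_nonneg a, mul_nonneg (sq_nonneg a) (mul_pos hb this).le]

/-- Bounds for the profile away from `-∞`. -/
theorem abs_logProfile_le {a b : ℝ} (hb : 0 < b) (S : ℝ) :
    |logProfile a b S| ≤ |Real.log (2 * a ^ 2 * b)| + (|a - 2| + 2 * |a|) * |S|
      + 2 * Real.log (1 + b) := by
  have h0 := Real.exp_pos (a * S)
  have hl0 : 0 ≤ Real.log (1 + b * Real.exp (a * S)) := Real.log_nonneg (by nlinarith)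
  have hl1 : Real.log (1 + b * Real.exp (a * S)) ≤ Real.log (1 + b) + |a| * |S| := by
    have h1 : 1 ≤ Real.exp |a * S| := Real.one_le_exp (abs_nonneg _)
    have h2 : Real.exp (a * S) ≤ Real.exp |a * S| := Real.exp_le_exp.2 (le_abs_self _)
    have h3 : 1 + b * Real.exp (a * S) ≤ (1 + b) * Real.exp |a * S| := by nlinarith
    have := Real.log_le_log (by positivity) h3
    rwa [Real.log_mul (by positivity) (by positivity), Real.log_exp, abs_mul] at this
  simp only [logProfile]
  have e1 := abs_add_le (Real.log (2 * a ^ 2 * b) + (a - 2) * S)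
    (-(2 * Real.log (1 + b * Real.exp (a * S))))
  have e2 := abs_add_le (Real.log (2 * a ^ 2 * b)) ((a - 2) * S)
  rw [abs_neg, abs_of_nonneg (show 0 ≤ 2 * Real.log (1 + b * Real.exp (a * S)) by linarith),
    ← sub_eq_add_neg] at e1
  rw [abs_mul] at e2
  nlinarith

/-! ### A Gronwall estimate for second order equations -/

/-- The function `N = D² + E² + θ²` satisfies `|N'| ≤ (2 + K) N`; the constant `θ²` is included to
absorb the inhomogeneity. The base point may be anywhere in the interval, so `N` is compared with a
growing or a decaying exponential according to the side. -/
theorem sq_add_sq_le_exp {D E E' : ℝ → ℝ} {α β K θ : ℝ} (hK : 0 ≤ K)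
    (hD : ∀ S ∈ Icc α β, HasDerivAt D (E S) S) (hE : ∀ S ∈ Icc α β, HasDerivAt E (E' S) S)
    (hE' : ∀ S ∈ Icc α β, |E' S| ≤ K * |D S| + θ) {S₀ S : ℝ} (hS₀ : S₀ ∈ Icc α β)
    (hS : S ∈ Icc α β) :
    D S ^ 2 + E S ^ 2 ≤ (D S₀ ^ 2 + E S₀ ^ 2 + θ ^ 2) * Real.exp ((2 + K) * (β - α)) := by
  have hN : ∀ x ∈ Icc α β, HasDerivAt (fun x => D x ^ 2 + E x ^ 2 + θ ^ 2)
      (2 * D x * E x + 2 * E x * E' x) x := fun x hx => by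
    have := (((hD x hx).pow 2).add ((hE x hx).pow 2)).add_const (θ ^ 2)
    refine this.congr_deriv ?_
    norm_num
  have hbd : ∀ x ∈ Icc α β, |2 * D x * E x + 2 * E x * E' x|
      ≤ (2 + K) * (D x ^ 2 + E x ^ 2 + θ ^ 2) := fun x hx => by
    have h1 := hE' x hx
    have h2 : |2 * D x * E x + 2 * E x * E' x| ≤ 2 * |D x| * |E x| + 2 * |E x| * |E' x| := by
      refine (abs_add_le _ _).trans_eq ?_
      simp [abs_mul]
    have h3 : 2 * |E x| * |E' x| ≤ 2 * |E x| * (K * |D x| + θ) := by gcongr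
    rw [← sq_abs (D x), ← sq_abs (E x)]
    nlinarith [sq_nonneg (|D x| - |E x|), mul_nonneg hK (sq_nonneg (|D x| - |E x|)),
      sq_nonneg (|E x| - θ), sq_nonneg θ, mul_nonneg hK (sq_nonneg θ), sq_nonneg (|D x|),
      sq_nonneg (|E x|), mul_nonneg hK (sq_nonneg (|D x|)), mul_nonneg hK (sq_nonneg (|E x|))]
  have hexp : ∀ c x : ℝ, HasDerivAt (fun x => Real.exp (c * x)) (Real.exp (c * x) * c) x :=
    fun c x => by simpa using ((hasDerivAt_id x).const_mul c).exp
  set L := 2 + K with hL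
  have hL0 : 0 < L := by positivity
  set N : ℝ → ℝ := fun x => D x ^ 2 + E x ^ 2 + θ ^ 2 with hNdef
  have hN0 : ∀ x, 0 ≤ N x := fun x => by positivity
  have key : N S ≤ N S₀ * Real.exp (L * (β - α)) := by
    rcases le_total S₀ S with hle | hle
    · have := sub_le_sub_of_hasDerivAt_le (g := fun _ => 0) (g' := fun _ => 0) hle
        (fun x hx => (hN x ⟨hS₀.1.trans hx.1, hx.2.trans hS.2⟩).mul (hexp (-L) x))
        (fun x _ => hasDerivAt_const x 0) (fun x hx => by
          have := (abs_le.1 (hbd x ⟨hS₀.1.trans hx.1, hx.2.trans hS.2⟩)).2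
          have h5 := Real.exp_pos (-L * x)
          nlinarith)
      have h1 : N S * Real.exp (-L * S) ≤ N S₀ * Real.exp (-L * S₀) := by
        simp only [Pi.mul_apply] at this; linarith
      have h2 : N S ≤ N S₀ * Real.exp (L * (S - S₀)) := by
        have h3 := mul_le_mul_of_nonneg_right h1 (Real.exp_pos (L * S)).le
        rw [mul_assoc, mul_assoc, ← Real.exp_add, ← Real.exp_add] at h3
        ring_nf at h3 ⊢
        simpa using h3
      refine h2.trans ?_
      have : S - S₀ ≤ β - α := by linarith [hS.2, hS₀.1]
      have := hN0 S₀
      gcongr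
    · have := sub_le_sub_of_hasDerivAt_le (f := fun _ => 0) (f' := fun _ => 0) hle
        (fun x _ => hasDerivAt_const x 0)
        (fun x hx => (hN x ⟨hS.1.trans hx.1, hx.2.trans hS₀.2⟩).mul (hexp L x))
        (fun x hx => by
          have := (abs_le.1 (hbd x ⟨hS.1.trans hx.1, hx.2.trans hS₀.2⟩)).1
          have h5 := Real.exp_pos (L * x)
          nlinarith)
      have h1 : N S * Real.exp (L * S) ≤ N S₀ * Real.exp (L * S₀) := by
        simp only [Pi.mul_apply] at this; linarith
      have h2 : N S ≤ N S₀ * Real.exp (L * (S₀ - S)) := by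
        have h3 := mul_le_mul_of_nonneg_right h1 (Real.exp_pos (-L * S)).le
        rw [mul_assoc, mul_assoc, ← Real.exp_add, ← Real.exp_add] at h3
        ring_nf at h3 ⊢
        simpa using h3
      refine h2.trans ?_
      have : S₀ - S ≤ β - α := by linarith [hS.1, hS₀.2]
      have := hN0 S₀
      gcongr
  have : D S ^ 2 + E S ^ 2 ≤ N S := le_add_of_nonneg_right (sq_nonneg θ)
  exact this.trans key

/-! ### Compactness-free convergence of rescaled solutions on windows -/

theorem abs_exp_sub_one_le_mul_exp (x : ℝ) : |Real.exp x - 1| ≤ |x| * Real.exp |x| := by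
  have h1 := Real.add_one_le_exp x
  have h2 := Real.add_one_le_exp (-x)
  have h3 := Real.exp_pos x
  have h4 : Real.exp x * Real.exp (-x) = 1 := by rw [← Real.exp_add]; simp
  have h5 : Real.exp x ≤ Real.exp |x| := Real.exp_le_exp.2 (le_abs_self x)
  have h6 : 1 ≤ Real.exp |x| := Real.one_le_exp (abs_nonneg x)
  have h7 := abs_nonneg x
  rw [abs_le]
  constructor
  · have : |x| * 1 ≤ |x| * Real.exp |x| := mul_le_mul_of_nonneg_left h6 h7
    linarith [neg_abs_le x]
  · have : Real.exp x - 1 ≤ x * Real.exp x := by nlinarith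
    have h8 : x * Real.exp x ≤ |x| * Real.exp x := mul_le_mul_of_nonneg_right (le_abs_self x) h3.le
    have h9 : |x| * Real.exp x ≤ |x| * Real.exp |x| := mul_le_mul_of_nonneg_left h5 h7
    linarith

/-- `Z`, with derivative `Y`, solves on `[α, β]` the equation of the rescaled solutions
at the height `m`, in the variable `S = log R`. -/
structure RescaledSol (p : ℝ) (h : ℝ → ℝ) (m : ℝ) (Z Y : ℝ → ℝ) (α β : ℝ) : Prop where
  deriv_Z : ∀ S ∈ Icc α β, HasDerivAt Z (Y S) S
  deriv_Y : ∀ S ∈ Icc α β, HasDerivAt Y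
    (-(Real.exp (2 * S) * (nonlin p h (m + Z S / (p * m ^ (p - 1))) / nonlin p h m))) S
  nonneg : ∀ S ∈ Icc α β, 0 ≤ m + Z S / (p * m ^ (p - 1))

section Window

variable {p : ℝ} {h : ℝ → ℝ}

/-- A priori bound: the solution lies below its tangent, hence stays bounded on windows. -/
theorem exists_window_bound (hp : 0 < p) (hH0 : StandingH h) (hH1 : GrowthH p h)
    (B α β : ℝ) : ∃ T C : ℝ, 0 < T ∧ ∀ m, T ≤ m → ∀ (Z Y : ℝ → ℝ) (β' : ℝ), β' ≤ β →
      RescaledSol p h m Z Y α β' → ∀ S₀ ∈ Icc α β', |Z S₀| ≤ B → |Y S₀| ≤ B →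
      ∀ S ∈ Icc α β', |Z S| ≤ C ∧ |Y S| ≤ C := by
  -- `B1` bounds the tangent at the base point and hence `Z` from above; `K` then bounds `|Y'|`
  -- through the value of `f` at the height belonging to `B1`. Integrating once and twice gives `B2`
  -- and the bound for `|Z|`.
  set B1 := B + B * (β - α) with hB1
  set K := Real.exp (2 * β) * Real.exp (B1 + 1) with hK
  have hK0 : 0 < K := by positivity
  set B2 := B + K * (β - α) with hB2
  obtain ⟨T1, hT1, hexp⟩ := exists_log_nonlin_expansion hp hH0 hH1 |B1| one_pos
  obtain ⟨T2, hT2, hmon⟩ := exists_nonlin_le hp hH0 hH1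
  -- The constants depend on `β` but not on the actual right end `β' ≤ β`. This allows windows that
  -- a priori could be cut off by the boundary of the ball.
  refine ⟨max T1 T2, max B2 (B + B2 * (β - α)), lt_max_of_lt_left hT1, ?_⟩
  intro m hm Z Y β' hβ' hs S₀ hS₀ hZ0 hY0 S hS
  have hB0 : 0 ≤ B := (abs_nonneg _).trans hZ0
  have hlen : 0 ≤ β - α := by linarith [hS₀.1, hS₀.2]
  have hB10 : 0 ≤ B1 := by positivity
  have hB20 : 0 ≤ B2 := by positivity
  have hm1 : T1 ≤ m := (le_max_left _ _).trans hm
  have hm2 : T2 ≤ m := (le_max_right _ _).trans hm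
  have hm0 : 0 < m := hT1.trans_le hm1
  set c := p * m ^ (p - 1) with hc
  have hc0 : 0 < c := mul_pos hp (Real.rpow_pos_of_pos hm0 _)
  have hfm : 0 < nonlin p h m := (hmon m hm2).1
  have hG0 : ∀ x ∈ Icc α β', 0 ≤ Real.exp (2 * x) * (nonlin p h (m + Z x / c) / nonlin p h m) :=
    fun x hx => mul_nonneg (Real.exp_pos _).le
      (div_nonneg (nonlin_nonneg hH0 (hs.nonneg x hx)) hfm.le)
  have habs : ∀ x ∈ Icc α β', ∀ y ∈ Icc α β', |x - y| ≤ β - α := fun x hx y hy => by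
    rw [abs_le]; constructor <;> linarith [hx.1, hx.2, hy.1, hy.2]
  have hYanti : ∀ x ∈ Icc α β', ∀ y ∈ Icc α β', x ≤ y → Y y ≤ Y x := fun x hx y hy hxy => by
    have := sub_le_sub_of_hasDerivAt_le (g := fun _ => 0) (g' := fun _ => 0) hxy
      (fun z hz => hs.deriv_Y z ⟨hx.1.trans hz.1, hz.2.trans hy.2⟩)
      (fun z _ => hasDerivAt_const z 0)
      (fun z hz => neg_nonpos.2 (hG0 z ⟨hx.1.trans hz.1, hz.2.trans hy.2⟩))
    linarith
  have hlinear : ∀ (k x : ℝ), HasDerivAt (fun x => k * x) k x := fun k x => by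
    simpa using (hasDerivAt_id x).const_mul k
  have htan : ∀ x ∈ Icc α β', Z x ≤ B1 := fun x hx => by
    have h1 : Z x ≤ Z S₀ + Y S₀ * (x - S₀) := by
      rcases le_total S₀ x with hle | hle
      · have := sub_le_sub_of_hasDerivAt_le (g := fun y => Y S₀ * y) hle
          (fun z hz => hs.deriv_Z z ⟨hS₀.1.trans hz.1, hz.2.trans hx.2⟩)
          (fun z _ => hlinear _ z)
          (fun z hz => hYanti S₀ hS₀ z ⟨hS₀.1.trans hz.1, hz.2.trans hx.2⟩ hz.1)
        linarith
      · have := sub_le_sub_of_hasDerivAt_le (f := fun y => Y S₀ * y) hle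
          (fun z _ => hlinear _ z)
          (fun z hz => hs.deriv_Z z ⟨hx.1.trans hz.1, hz.2.trans hS₀.2⟩)
          (fun z hz => hYanti z ⟨hx.1.trans hz.1, hz.2.trans hS₀.2⟩ S₀ hS₀ hz.2)
        linarith
    have h2 : Y S₀ * (x - S₀) ≤ B * (β - α) := by
      calc Y S₀ * (x - S₀) ≤ |Y S₀| * |x - S₀| := by rw [← abs_mul]; exact le_abs_self _
        _ ≤ B * (β - α) := mul_le_mul hY0 (habs x hx S₀ hS₀) (abs_nonneg _) hB0
    linarith [le_abs_self (Z S₀)]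
  have hG : ∀ x ∈ Icc α β', Real.exp (2 * x) * (nonlin p h (m + Z x / c) / nonlin p h m) ≤ K :=
    fun x hx => by
      obtain ⟨a1, a2, a3, -⟩ := hexp m hm1 B1 (le_refl |B1|)
      have b1 : nonlin p h (m + Z x / c) ≤ nonlin p h (m + B1 / c) := by
        refine (hmon _ ?_).2 _ (hs.nonneg x hx) ?_
        · have : 0 ≤ B1 / c := by positivity
          linarith
        · have := htan x hx
          gcongr
      have b2 : nonlin p h (m + B1 / c) ≤ Real.exp (B1 + 1) * nonlin p h m := by
        rw [← Real.log_le_log_iff a2 (by positivity), Real.log_mul (by positivity) hfm.ne',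
          Real.log_exp]
        linarith [(abs_le.1 a3).2]
      have b3 : nonlin p h (m + Z x / c) / nonlin p h m ≤ Real.exp (B1 + 1) := by
        rw [div_le_iff₀ hfm]; linarith
      have b4 : Real.exp (2 * x) ≤ Real.exp (2 * β) :=
        Real.exp_le_exp.2 (by linarith [hx.2])
      exact mul_le_mul b4 b3 (div_nonneg (nonlin_nonneg hH0 (hs.nonneg x hx)) hfm.le)
        (Real.exp_pos _).le
  have hYb : ∀ x ∈ Icc α β', |Y x| ≤ B2 := fun x hx => by
    have := (convex_Icc α β').norm_image_sub_le_of_norm_hasDerivWithin_le (C := K)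
      (fun z hz => (hs.deriv_Y z hz).hasDerivWithinAt) (fun z hz => by
        rw [Real.norm_eq_abs, abs_neg, abs_of_nonneg (hG0 z hz)]; exact hG z hz) hS₀ hx
    rw [Real.norm_eq_abs, Real.norm_eq_abs] at this
    have h1 : K * |x - S₀| ≤ K * (β - α) := mul_le_mul_of_nonneg_left (habs x hx S₀ hS₀) hK0.le
    have h2 := abs_sub_abs_le_abs_sub (Y x) (Y S₀)
    linarith
  refine ⟨?_, (hYb S hS).trans (le_max_left _ _)⟩
  have := (convex_Icc α β').norm_image_sub_le_of_norm_hasDerivWithin_le (C := B2)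
    (fun z hz => (hs.deriv_Z z hz).hasDerivWithinAt) (fun z hz => hYb z hz) hS₀ hS
  rw [Real.norm_eq_abs, Real.norm_eq_abs] at this
  have h1 : B2 * |S - S₀| ≤ B2 * (β - α) := mul_le_mul_of_nonneg_left (habs S hS S₀ hS₀) hB20
  have h2 := abs_sub_abs_le_abs_sub (Z S) (Z S₀)
  exact le_trans (by linarith) (le_max_right _ _)

set_option maxHeartbeats 800000 in
/-- Continuous dependence on the window. -/
theorem exists_window_close (hp : 0 < p) (hH0 : StandingH h) (hH1 : GrowthH p h)
    (B α β : ℝ) {η : ℝ} (hη : 0 < η) : ∃ T κ : ℝ, 0 < T ∧ 0 < κ ∧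
      ∀ m, T ≤ m → ∀ (Z Y ζ ξ : ℝ → ℝ), RescaledSol p h m Z Y α β →
      (∀ S ∈ Icc α β, HasDerivAt ζ (ξ S) S) →
      (∀ S ∈ Icc α β, HasDerivAt ξ (-Real.exp (2 * S + ζ S)) S) →
      (∀ S ∈ Icc α β, |ζ S| ≤ B) →
      ∀ S₀ ∈ Icc α β, |Z S₀| ≤ B → |Y S₀| ≤ B → |Z S₀ - ζ S₀| ≤ κ → |Y S₀ - ξ S₀| ≤ κ →
      ∀ S ∈ Icc α β, |Z S - ζ S| ≤ η ∧ |Y S - ξ S| ≤ η ∧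
        |nonlin p h (m + Z S / (p * m ^ (p - 1))) / nonlin p h m * Real.exp (-ζ S) - 1| ≤ η ∧
        |((m + Z S / (p * m ^ (p - 1))) / m) ^ (p - 1) - 1| ≤ η := by
  obtain ⟨T1, C, hT1, hbound⟩ := exists_window_bound hp hH0 hH1 B α β
  set X := |C| + |B| + 1 with hX
  set K := Real.exp (2 * β + |B| + X) with hK
  have hK0 : 0 < K := Real.exp_pos _
  set R := Real.exp ((2 + K) * |β - α|) with hR
  have hR1 : 1 ≤ R := Real.one_le_exp (by positivity)
  set η' := min (η / 4) (1 / 2) with hη'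
  have hη'0 : 0 < η' := by positivity
  -- `R` is the Gronwall amplification of the squares. The two initial errors `κ` and the
  -- inhomogeneity `K κ` give `(2 + K²) κ² R ≤ ((2 + K) R κ)² = η'²`.
  set κ := η' / ((2 + K) * R) with hκ
  have hκ0 : 0 < κ := by positivity
  have hκη : κ * ((2 + K) * R) = η' := by rw [hκ]; field_simp
  have hκle : κ ≤ η' := by
    rw [← hκη]
    have : 1 ≤ (2 + K) * R := by nlinarith
    nlinarith
  obtain ⟨T2, hT2, hexp⟩ := exists_log_nonlin_expansion hp hH0 hH1 |C| hκ0
  obtain ⟨T3, hT3, hmon⟩ := exists_nonlin_le hp hH0 hH1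
  refine ⟨max T1 (max T2 T3), κ, lt_max_of_lt_left hT1, hκ0, ?_⟩
  intro m hm Z Y ζ ξ hs hζ hξ hζB S₀ hS₀ hZ0 hY0 hZκ hYκ S hS
  have hm1 : T1 ≤ m := (le_max_left _ _).trans hm
  have hm2 : T2 ≤ m := (le_max_left _ _).trans ((le_max_right _ _).trans hm)
  have hm3 : T3 ≤ m := (le_max_right _ _).trans ((le_max_right _ _).trans hm)
  have hfm : 0 < nonlin p h m := (hmon m hm3).1
  set c := p * m ^ (p - 1) with hc
  have hb := hbound m hm1 Z Y β le_rfl hs S₀ hS₀ hZ0 hY0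
  have hx : ∀ x ∈ Icc α β, 0 < nonlin p h (m + Z x / c) ∧
      |Real.log (nonlin p h (m + Z x / c)) - Real.log (nonlin p h m) - Z x| ≤ κ ∧
      |((m + Z x / c) / m) ^ (p - 1) - 1| ≤ κ := fun x hx => by
    obtain ⟨-, a2, a3, a4⟩ := hexp m hm2 (Z x) ((hb x hx).1.trans (le_abs_self C))
    exact ⟨a2, a3, a4⟩
  have hratio : ∀ x ∈ Icc α β, nonlin p h (m + Z x / c) / nonlin p h m = Real.exp (ζ x) *
      Real.exp (Real.log (nonlin p h (m + Z x / c)) - Real.log (nonlin p h m) - ζ x) :=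
    fun x hx' => by
      rw [← Real.exp_add, add_sub_cancel, Real.exp_sub, Real.exp_log (hx x hx').1,
        Real.exp_log hfm]
  have hdiff : ∀ x ∈ Icc α β,
      |Real.log (nonlin p h (m + Z x / c)) - Real.log (nonlin p h m) - ζ x| ≤ |Z x - ζ x| + κ :=
    fun x hx' => by
      have := abs_add_le (Real.log (nonlin p h (m + Z x / c)) - Real.log (nonlin p h m) - Z x)
        (Z x - ζ x)
      rw [show Real.log (nonlin p h (m + Z x / c)) - Real.log (nonlin p h m) - Z x + (Z x - ζ x)
        = Real.log (nonlin p h (m + Z x / c)) - Real.log (nonlin p h m) - ζ x by ring] at this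
      linarith [(hx x hx').2.1]
  -- The two second derivatives differ by `exp(2x + ζ)(exp y - 1)`, where `y` is the error of `log
  -- f` relative to `ζ`, and `|y| ≤ |Z - ζ| + κ`. On the bounded window this is Lipschitz in `Z - ζ`
  -- up to the error `K κ`.
  have hgr := sq_add_sq_le_exp (D := fun x => Z x - ζ x) (E := fun x => Y x - ξ x)
    (E' := fun x => -(Real.exp (2 * x) * (nonlin p h (m + Z x / c) / nonlin p h m))
      - -Real.exp (2 * x + ζ x)) (K := K) (θ := K * κ) (α := α) (β := β) hK0.le
    (fun x hx' => (hs.deriv_Z x hx').sub (hζ x hx'))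
    (fun x hx' => (hs.deriv_Y x hx').sub (hξ x hx')) (fun x hx' => by
      have e : -(Real.exp (2 * x) * (nonlin p h (m + Z x / c) / nonlin p h m))
          - -Real.exp (2 * x + ζ x) = -(Real.exp (2 * x + ζ x) *
          (Real.exp (Real.log (nonlin p h (m + Z x / c)) - Real.log (nonlin p h m) - ζ x) - 1)) := by
        rw [hratio x hx', Real.exp_add]; ring
      rw [e, abs_neg, abs_mul, abs_of_pos (Real.exp_pos _)]
      have h1 := hdiff x hx'
      have h2 := abs_exp_sub_one_le_mul_exp
        (Real.log (nonlin p h (m + Z x / c)) - Real.log (nonlin p h m) - ζ x)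
      set y := Real.log (nonlin p h (m + Z x / c)) - Real.log (nonlin p h m) - ζ x
      have h3 : |y| ≤ X := by
        have a1 : |Z x| ≤ |C| := (hb x hx').1.trans (le_abs_self C)
        have a2 : |ζ x| ≤ |B| := (hζB x hx').trans (le_abs_self B)
        have a3 : κ ≤ 1 := hκle.trans ((min_le_right _ _).trans (by norm_num))
        have a4 := abs_sub (Z x) (ζ x)
        linarith
      have h4 : Real.exp (2 * x + ζ x) ≤ Real.exp (2 * β + |B|) := by
        apply Real.exp_le_exp.2
        have := (le_abs_self (ζ x)).trans ((hζB x hx').trans (le_abs_self B))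
        linarith [hx'.2]
      calc Real.exp (2 * x + ζ x) * |Real.exp y - 1|
          ≤ Real.exp (2 * β + |B|) * (|y| * Real.exp |y|) := by gcongr
        _ ≤ Real.exp (2 * β + |B|) * ((|Z x - ζ x| + κ) * Real.exp X) := by gcongr
        _ = K * |Z x - ζ x| + K * κ := by
            rw [hK, Real.exp_add (2 * β + |B|) X]; ring) hS₀ hS
  have hlen : 0 ≤ β - α := by linarith [hS.1, hS.2]
  rw [← abs_of_nonneg hlen, ← hR] at hgr
  have hfin : (Z S - ζ S) ^ 2 + (Y S - ξ S) ^ 2 ≤ η' ^ 2 := by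
    refine hgr.trans ?_
    have a1 : (Z S₀ - ζ S₀) ^ 2 ≤ κ ^ 2 := sq_le_sq' (by linarith [(abs_le.1 hZκ).1])
      (abs_le.1 hZκ).2
    have a2 : (Y S₀ - ξ S₀) ^ 2 ≤ κ ^ 2 := sq_le_sq' (by linarith [(abs_le.1 hYκ).1])
      (abs_le.1 hYκ).2
    calc ((Z S₀ - ζ S₀) ^ 2 + (Y S₀ - ξ S₀) ^ 2 + (K * κ) ^ 2) * R
        ≤ (κ ^ 2 + κ ^ 2 + (K * κ) ^ 2) * R := by gcongr
      _ = κ ^ 2 * (2 + K ^ 2) * R := by ring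
      _ ≤ κ ^ 2 * (2 + K) ^ 2 * R ^ 2 := by
          have : 2 + K ^ 2 ≤ (2 + K) ^ 2 := by nlinarith
          have : R ≤ R ^ 2 := by nlinarith
          gcongr
      _ = η' ^ 2 := by rw [← hκη]; ring
  have hη'4 : η' ≤ η / 4 := min_le_left _ _
  have hη'2 : η' ≤ 1 / 2 := min_le_right _ _
  have hZ : |Z S - ζ S| ≤ η' := abs_le_of_sq_le_sq (by nlinarith [sq_nonneg (Y S - ξ S)]) hη'0.le
  have hY : |Y S - ξ S| ≤ η' := abs_le_of_sq_le_sq (by nlinarith [sq_nonneg (Z S - ζ S)]) hη'0.le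
  refine ⟨by linarith, by linarith, ?_, ?_⟩
  · have h1 := hdiff S hS
    have e : nonlin p h (m + Z S / c) / nonlin p h m * Real.exp (-ζ S) =
        Real.exp (Real.log (nonlin p h (m + Z S / c)) - Real.log (nonlin p h m) - ζ S) := by
      rw [hratio S hS, mul_right_comm, ← Real.exp_add]; simp
    rw [e]
    refine (Real.abs_exp_sub_one_le (by linarith)).trans (by linarith)
  · exact (hx S hS).2.2.trans (by linarith)

end Window

/-! ### Rescaled solutions in logarithmic variables -/

/-- The rescaled solution at height `m` as a function of `S = log R`. -/
def logRescaled (p : ℝ) (h : ℝ → ℝ) (lam m : ℝ) (W : ℝ → ℝ) (S : ℝ) : ℝ :=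
  p * m ^ (p - 1) * (W (Real.log (scale p h lam m) + S) - m)

/-- The derivative of `logRescaled`. -/
def logRescaled' (p : ℝ) (h : ℝ → ℝ) (lam m : ℝ) (Q : ℝ → ℝ) (S : ℝ) : ℝ :=
  -(p * m ^ (p - 1) * Q (Real.log (scale p h lam m) + S))

/-- Closeness, up to `η`, of the rescaled solution and the profile at the point `S`. -/
structure WindowClose (p : ℝ) (h : ℝ → ℝ) (lam m : ℝ) (W Q : ℝ → ℝ) (a b η S : ℝ) : Prop where
  Z : |logRescaled p h lam m W S - logProfile a b S| ≤ η
  Y : |logRescaled' p h lam m Q S - logProfile' a b S| ≤ η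
  ratio : |nonlin p h (W (Real.log (scale p h lam m) + S)) / nonlin p h m
    * Real.exp (-logProfile a b S) - 1| ≤ η
  height : |(W (Real.log (scale p h lam m) + S) / m) ^ (p - 1) - 1| ≤ η

section Rescaling

variable {p : ℝ} {h : ℝ → ℝ} {lam m : ℝ}

theorem scale_pos (hp : 0 < p) (hl : 0 < lam) (hm : 0 < m) (hf : 0 < nonlin p h m) :
    0 < scale p h lam m := by
  have := Real.rpow_pos_of_pos hm (p - 1)
  unfold scale
  positivity

theorem scale_sq (hp : 0 < p) (hl : 0 < lam) (hm : 0 < m) (hf : 0 < nonlin p h m) :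
    p * m ^ (p - 1) * lam * scale p h lam m ^ 2 * nonlin p h m = 1 := by
  have := Real.rpow_pos_of_pos hm (p - 1)
  unfold scale
  rw [div_pow, Real.sq_sqrt (by positivity)]
  field_simp

theorem add_logRescaled_div (hp : 0 < p) (hm : 0 < m) (W : ℝ → ℝ) (S : ℝ) :
    m + logRescaled p h lam m W S / (p * m ^ (p - 1)) =
      W (Real.log (scale p h lam m) + S) := by
  have := Real.rpow_pos_of_pos hm (p - 1)
  unfold logRescaled
  field_simp
  ring

theorem hasDerivAt_logRescaled {mu : ℝ} {W Q : ℝ → ℝ} (hs : LogSol p h lam mu W Q) {S : ℝ}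
    (hS : Real.log (scale p h lam m) + S < 0) :
    HasDerivAt (logRescaled p h lam m W) (logRescaled' p h lam m Q S) S := by
  have h1 := ((hs.deriv_W _ hS).comp_const_add _ _).sub_const m
  refine (h1.const_mul (p * m ^ (p - 1))).congr_deriv ?_
  simp only [logRescaled']; ring

theorem hasDerivAt_logRescaled' (hp : 0 < p) (hm : 0 < m) (hf : 0 < nonlin p h m) {mu : ℝ}
    {W Q : ℝ → ℝ} (hs : LogSol p h lam mu W Q) {S : ℝ}
    (hS : Real.log (scale p h lam m) + S < 0) :
    HasDerivAt (logRescaled' p h lam m Q)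
      (-(Real.exp (2 * S) * (nonlin p h (W (Real.log (scale p h lam m) + S)) / nonlin p h m))) S := by
  have h1 := (hs.deriv_Q _ hS).comp_const_add _ _
  refine (h1.const_mul (p * m ^ (p - 1))).neg.congr_deriv ?_
  have hg := scale_pos hp hs.lam_pos hm hf
  have e : Real.exp (2 * (Real.log (scale p h lam m) + S)) =
      scale p h lam m ^ 2 * Real.exp (2 * S) := by
    rw [mul_add, Real.exp_add, two_mul, Real.exp_add, Real.exp_log hg, sq]
  have h2 := scale_sq hp hs.lam_pos hm hf
  rw [e]
  have h3 : p * m ^ (p - 1) * lam * scale p h lam m ^ 2 = 1 / nonlin p h m := by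
    rw [eq_div_iff hf.ne', h2]
  rw [neg_inj]
  calc _ = (p * m ^ (p - 1) * lam * scale p h lam m ^ 2) * (Real.exp (2 * S) *
        nonlin p h (W (Real.log (scale p h lam m) + S))) := by ring
    _ = _ := by rw [h3]; ring

theorem rescaledSol (hp : 0 < p) (hm : 0 < m) (hf : 0 < nonlin p h m) {mu : ℝ} {W Q : ℝ → ℝ}
    (hs : LogSol p h lam mu W Q) {α β : ℝ} (hβ : Real.log (scale p h lam m) + β < 0) :
    RescaledSol p h m (logRescaled p h lam m W) (logRescaled' p h lam m Q) α β := by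
  have hlt : ∀ S ∈ Icc α β, Real.log (scale p h lam m) + S < 0 := fun S hS => by
    linarith [hS.2]
  refine ⟨fun S hS => hasDerivAt_logRescaled hs (hlt S hS), fun S hS => ?_, fun S hS => ?_⟩
  · rw [add_logRescaled_div hp hm]
    exact hasDerivAt_logRescaled' hp hm hf hs (hlt S hS)
  · rw [add_logRescaled_div hp hm]
    exact (hs.pos _ (hlt S hS)).le

theorem tendsto_logRescaled_zero {mu : ℝ} {W Q : ℝ → ℝ} (hs : LogSol p h lam mu W Q) :
    Tendsto (logRescaled p h lam m W) (𝓝[<] (-Real.log (scale p h lam m)))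
      (𝓝 (p * m ^ (p - 1) * (0 - m))) := by
  refine ((hs.lim_zero.comp ?_).sub_const m).const_mul _
  refine tendsto_nhdsWithin_iff.2 ⟨?_, ?_⟩
  · have : Tendsto (fun S => Real.log (scale p h lam m) + S) (𝓝 (-Real.log (scale p h lam m)))
        (𝓝 (Real.log (scale p h lam m) + -Real.log (scale p h lam m))) :=
      tendsto_id.const_add _
    rw [add_neg_cancel] at this
    exact this.mono_left nhdsWithin_le_nhds
  · filter_upwards [self_mem_nhdsWithin] with S hS
    have : S < -Real.log (scale p h lam m) := hS
    simp only [mem_Iio]; linarith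

theorem mul_rpow_sub_one_mul (hm : 0 < m) : p * m ^ (p - 1) * m = p * m ^ p := by
  rw [mul_assoc, ← Real.rpow_add_one hm.ne']; ring_nf

/-- The boundary of the ball is far away on the scale of a bubble. -/
theorem exists_log_scale_add_lt (hp : 0 < p) (hH0 : StandingH h) (hH1 : GrowthH p h) (B M : ℝ) :
    ∃ T : ℝ, 0 < T ∧ ∀ m, T ≤ m → ∀ (lam mu : ℝ) (W Q : ℝ → ℝ), LogSol p h lam mu W Q →
      ∀ S₀, -M ≤ S₀ → S₀ ≤ M → Real.log (scale p h lam m) + S₀ < 0 →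
      |logRescaled p h lam m W S₀| ≤ B → |logRescaled' p h lam m Q S₀| ≤ B →
      Real.log (scale p h lam m) + M < 0 := by
  obtain ⟨T1, C, hT1, hb⟩ := exists_window_bound hp hH0 hH1 B (-M) M
  obtain ⟨T2, hT2, hmon⟩ := exists_nonlin_le hp hH0 hH1
  obtain ⟨T3, hT3⟩ := eventually_atTop.1 ((tendsto_rpow_atTop hp).eventually_gt_atTop (C / p))
  refine ⟨max T1 (max T2 T3), lt_max_of_lt_left hT1, ?_⟩
  intro m hm lam mu W Q hs S₀ hl hr h0 hZ hY
  have hm1 : T1 ≤ m := (le_max_left _ _).trans hm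
  have hm2 : T2 ≤ m := (le_max_left _ _).trans ((le_max_right _ _).trans hm)
  have hm3 : T3 ≤ m := (le_max_right _ _).trans ((le_max_right _ _).trans hm)
  have hm0 : 0 < m := hT1.trans_le hm1
  have hf := (hmon m hm2).1
  by_contra hcon
  push Not at hcon
  -- At the boundary the height is zero, so the rescaled function tends to `-p m^p`. If the boundary
  -- lay inside the window, this would violate the uniform bound `C` for large `m`.
  have hlim := (tendsto_logRescaled_zero (m := m) hs).abs
  have : |p * m ^ (p - 1) * (0 - m)| ≤ C := by
    refine le_of_tendsto hlim ?_
    have h1 : S₀ < -Real.log (scale p h lam m) := by linarith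
    filter_upwards [self_mem_nhdsWithin, Ioo_mem_nhdsLT h1] with S hS hS'
    have hS1 : S < -Real.log (scale p h lam m) := hS
    exact (hb m hm1 _ _ S (by linarith) (rescaledSol hp hm0 hf hs (by linarith)) S₀
      ⟨hl, hS'.1.le⟩ hZ hY S ⟨by linarith [hS'.1], le_rfl⟩).1
  rw [zero_sub, mul_neg, abs_neg, mul_rpow_sub_one_mul hm0, abs_of_pos (by positivity)] at this
  have h3 := hT3 m hm3
  rw [div_lt_iff₀ hp] at h3
  linarith

/-- Integrating `exp(2S)` from `-∞` gains a factor `1/2`. Two integrations gain `1/4`, which is the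
contraction constant in `exists_inner_close`. -/
theorem abs_le_exp_of_abs_deriv_le {D E : ℝ → ℝ} {K β : ℝ}
    (hD : ∀ S ≤ β, HasDerivAt D (E S) S) (hE : ∀ S ≤ β, |E S| ≤ K * Real.exp (2 * S))
    (hlim : Tendsto D atBot (𝓝 0)) : ∀ S ≤ β, |D S| ≤ K / 2 * Real.exp (2 * S) := by
  intro S hS
  have hexp : ∀ c x : ℝ, HasDerivAt (fun x => c / 2 * Real.exp (2 * x)) (c * Real.exp (2 * x)) x :=
    fun c x => by
      have : HasDerivAt (fun x : ℝ => Real.exp (2 * x)) (Real.exp (2 * x) * 2) x := by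
        simpa using ((hasDerivAt_id x).const_mul 2).exp
      refine (this.const_mul (c / 2)).congr_deriv (by ring)
  have hl : ∀ c : ℝ, Tendsto (fun x => D x - c / 2 * Real.exp (2 * x)) atBot (𝓝 0) := fun c => by
    have h1 : Tendsto (fun x : ℝ => c / 2 * Real.exp (2 * x)) atBot (𝓝 (c / 2 * 0)) :=
      (Real.tendsto_exp_atBot.comp (tendsto_id.const_mul_atBot two_pos)).const_mul _
    simpa using hlim.sub h1
  have hup : D S - K / 2 * Real.exp (2 * S) ≤ 0 := by
    refine ge_of_tendsto (hl K) ?_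
    filter_upwards [eventually_le_atBot S] with x hx
    have := sub_le_sub_of_hasDerivAt_le hx (fun z hz => hD z (hz.2.trans hS))
      (fun z _ => hexp K z) (fun z hz => (abs_le.1 (hE z (hz.2.trans hS))).2)
    linarith
  have hdown : 0 ≤ D S - -K / 2 * Real.exp (2 * S) := by
    refine le_of_tendsto (hl (-K)) ?_
    filter_upwards [eventually_le_atBot S] with x hx
    have := sub_le_sub_of_hasDerivAt_le hx (fun z _ => hexp (-K) z)
      (fun z hz => hD z (hz.2.trans hS))
      (fun z hz => by linarith [(abs_le.1 (hE z (hz.2.trans hS))).1])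
    linarith
  rw [abs_le]
  constructor <;> linarith

theorem logProfile_two (S : ℝ) :
    logProfile 2 (1 / 8) S = -2 * Real.log (1 + 1 / 8 * Real.exp (2 * S)) := by
  simp only [logProfile]
  norm_num

theorem logProfile_two_nonpos (S : ℝ) : logProfile 2 (1 / 8) S ≤ 0 := by
  rw [logProfile_two]
  have := Real.log_nonneg (show 1 ≤ 1 + 1 / 8 * Real.exp (2 * S) by
    have := Real.exp_pos (2 * S); linarith)
  linarith

theorem tendsto_logProfile_two : Tendsto (logProfile 2 (1 / 8)) atBot (𝓝 0) := by
  have h1 : Tendsto (fun S : ℝ => 1 + 1 / 8 * Real.exp (2 * S)) atBot (𝓝 (1 + 1 / 8 * 0)) :=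
    ((Real.tendsto_exp_atBot.comp (tendsto_id.const_mul_atBot two_pos)).const_mul _).const_add 1
  have h2 := (h1.log (by norm_num)).const_mul (-2)
  simp only [mul_zero, add_zero, Real.log_one] at h2
  exact h2.congr fun S => (logProfile_two S).symm

theorem abs_exp_sub_exp_le {x y : ℝ} (hx : x ≤ 0) (hy : y ≤ 0) :
    |Real.exp x - Real.exp y| ≤ |x - y| := by
  have key : ∀ x y : ℝ, y ≤ 0 → Real.exp y - Real.exp x ≤ |x - y| := fun x y hy => by
    have h1 := Real.add_one_le_exp (x - y)
    have h2 : Real.exp x = Real.exp y * Real.exp (x - y) := by rw [← Real.exp_add]; ring_nf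
    have h3 := Real.exp_pos y
    have h4 : Real.exp y ≤ 1 := Real.exp_le_one_iff.2 hy
    have h5 := neg_abs_le (x - y)
    have h6 := abs_nonneg (x - y)
    nlinarith
  have a1 := key x y hy
  have a2 := key y x hx
  rw [abs_sub_comm y x] at a2
  rw [abs_le]; constructor <;> linarith

/-- Convergence of the first bubble on the inner half line, by contraction. -/
theorem exists_inner_close (hp : 0 < p) (hH0 : StandingH h) (hH1 : GrowthH p h) {η : ℝ}
    (hη : 0 < η) : ∃ T : ℝ, 0 < T ∧ ∀ m, T ≤ m → ∀ (lam : ℝ) (W Q : ℝ → ℝ),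
      LogSol p h lam m W Q → Real.log (scale p h lam m) < 0 ∧ ∀ S ≤ 0,
      WindowClose p h lam m W Q 2 (1 / 8) η S ∧
      |logRescaled p h lam m W S - logProfile 2 (1 / 8) S| ≤ η * Real.exp (2 * S) ∧
      |logRescaled' p h lam m Q S - logProfile' 2 (1 / 8) S| ≤ η * Real.exp (2 * S) := by
  set κ := min (η / 4) (1 / 4) with hκ
  have hκ0 : 0 < κ := by positivity
  obtain ⟨T1, hT1, hexp⟩ := exists_log_nonlin_expansion hp hH0 hH1 1 hκ0
  obtain ⟨T2, hT2, hmon⟩ := exists_nonlin_le hp hH0 hH1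
  obtain ⟨T3, hT3⟩ := eventually_atTop.1 ((tendsto_rpow_atTop hp).eventually_gt_atTop (1 / p))
  refine ⟨max T1 (max T2 T3), lt_max_of_lt_left hT1, ?_⟩
  intro m hm lam W Q hs
  have hm1 : T1 ≤ m := (le_max_left _ _).trans hm
  have hm2 : T2 ≤ m := (le_max_left _ _).trans ((le_max_right _ _).trans hm)
  have hm3 : T3 ≤ m := (le_max_right _ _).trans ((le_max_right _ _).trans hm)
  have hm0 : 0 < m := hT1.trans_le hm1
  obtain ⟨hf, hmono⟩ := hmon m hm2
  set L := Real.log (scale p h lam m) with hL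
  set c := p * m ^ (p - 1) with hc
  have hc0 : 0 < c := mul_pos hp (Real.rpow_pos_of_pos hm0 _)
  have hshift : Tendsto (fun S : ℝ => L + S) atBot atBot := tendsto_atBot_add_const_left _ _ tendsto_id
  have hZlim : Tendsto (logRescaled p h lam m W) atBot (𝓝 0) := by
    have := ((hs.lim_W.comp hshift).sub_const m).const_mul c
    rw [sub_self, mul_zero] at this
    exact this
  have hYlim : Tendsto (logRescaled' p h lam m Q) atBot (𝓝 0) := by
    have := ((hs.lim_Q.comp hshift).const_mul c).neg
    rw [mul_zero, neg_zero] at this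
    exact this
  -- Here `m` is the maximal height, so the quotient is at most `1`. This alone gives the a priori
  -- bounds `exp(2S)/2` for the slope and `exp(2S)/4` for the rescaled function.
  have hratio : ∀ S, L + S < 0 → 0 ≤ nonlin p h (W (L + S)) / nonlin p h m ∧
      nonlin p h (W (L + S)) / nonlin p h m ≤ 1 := fun S hS => by
    have h1 := (hs.pos _ hS).le
    exact ⟨div_nonneg (nonlin_nonneg hH0 h1) hf.le, (div_le_one hf).2 (hmono _ h1 (hs.W_le hS))⟩
  have hY1 : ∀ S, L + S < 0 → |logRescaled' p h lam m Q S| ≤ 1 / 2 * Real.exp (2 * S) :=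
    fun S hS => abs_le_exp_of_abs_deriv_le (β := S)
      (fun x hx => hasDerivAt_logRescaled' hp hm0 hf hs (by rw [← hL]; linarith))
      (fun x hx => by
        obtain ⟨a1, a2⟩ := hratio x (by linarith)
        rw [abs_neg, abs_mul, abs_of_pos (Real.exp_pos _), abs_of_nonneg a1]
        nlinarith [Real.exp_pos (2 * x)]) hYlim S le_rfl
  have hZ1 : ∀ S, L + S < 0 → |logRescaled p h lam m W S| ≤ 1 / 2 / 2 * Real.exp (2 * S) :=
    fun S hS => abs_le_exp_of_abs_deriv_le (β := S)
      (fun x hx => hasDerivAt_logRescaled hs (by rw [← hL]; linarith))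
      (fun x hx => hY1 x (by linarith)) hZlim S le_rfl
  have hL0 : L < 0 := by
    by_contra hcon
    push Not at hcon
    have hlim := (tendsto_logRescaled_zero (m := m) hs).abs
    have : |p * m ^ (p - 1) * (0 - m)| ≤ 1 := by
      refine le_of_tendsto hlim ?_
      filter_upwards [self_mem_nhdsWithin] with S hS
      have hS1 : S < -L := hS
      refine (hZ1 S (by linarith)).trans ?_
      have : Real.exp (2 * S) ≤ 1 := Real.exp_le_one_iff.2 (by linarith)
      linarith
    rw [zero_sub, mul_neg, abs_neg, mul_rpow_sub_one_mul hm0, abs_of_pos (by positivity)] at this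
    have h3 := hT3 m hm3
    rw [div_lt_iff₀ hp] at h3
    linarith
  have hneg : ∀ S ≤ 0, L + S < 0 := fun S hS => by linarith
  refine ⟨hL0, ?_⟩
  have he1 : ∀ S ≤ (0 : ℝ), Real.exp (2 * S) ≤ 1 := fun S hS => Real.exp_le_one_iff.2 (by linarith)
  have hζ1 : ∀ S ≤ 0, |logProfile' 2 (1 / 8) S| ≤ 1 / 2 * Real.exp (2 * S) :=
    abs_le_exp_of_abs_deriv_le
      (fun x _ => hasDerivAt_logProfile' two_pos (by norm_num) x)
      (fun x _ => by
        rw [abs_neg, abs_of_pos (Real.exp_pos _), one_mul]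
        exact Real.exp_le_exp.2 (by linarith [logProfile_two_nonpos x]))
      (by simpa using tendsto_logProfile'_atBot (a := 2) (b := 1 / 8) two_pos)
  have hζ2 : ∀ S ≤ 0, |logProfile 2 (1 / 8) S| ≤ 1 / 2 / 2 * Real.exp (2 * S) :=
    abs_le_exp_of_abs_deriv_le
      (fun x _ => hasDerivAt_logProfile (by norm_num) x) hζ1 tendsto_logProfile_two
  have hex : ∀ S ≤ 0, 0 < nonlin p h (W (L + S)) ∧
      |Real.log (nonlin p h (W (L + S))) - Real.log (nonlin p h m)
        - logRescaled p h lam m W S| ≤ κ ∧ |(W (L + S) / m) ^ (p - 1) - 1| ≤ κ := fun S hS => by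
    have h1 : |logRescaled p h lam m W S| ≤ 1 := by
      refine (hZ1 S (hneg S hS)).trans ?_
      linarith [he1 S hS]
    obtain ⟨-, a2, a3, a4⟩ := hexp m hm1 _ h1
    rw [add_logRescaled_div hp hm0] at a2 a3 a4
    exact ⟨a2, a3, a4⟩
  set x : ℝ → ℝ := fun S => Real.log (nonlin p h (W (L + S))) - Real.log (nonlin p h m) with hx
  have hxe : ∀ S ≤ 0, nonlin p h (W (L + S)) / nonlin p h m = Real.exp (x S) := fun S hS => by
    rw [hx]; simp only; rw [Real.exp_sub, Real.exp_log (hex S hS).1, Real.exp_log hf]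
  have hx0 : ∀ S ≤ 0, x S ≤ 0 := fun S hS => by
    have := (hratio S (hneg S hS)).2
    rw [hxe S hS] at this
    exact Real.exp_le_one_iff.1 this
  set s := (fun S => |logRescaled p h lam m W S - logProfile 2 (1 / 8) S|) '' Iic 0 with hsdef
  -- Both the rescaled function and the profile are bounded by `1/4` on the half line, so their
  -- uniform distance `d` is finite; without this the contraction would be void.
  have hbdd : BddAbove s := by
    refine ⟨1, ?_⟩
    rintro _ ⟨S, hS, rfl⟩
    simp only
    refine (abs_sub _ _).trans ?_
    linarith [hZ1 S (hneg S hS), hζ2 S hS, he1 S hS]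
  set d := sSup s with hd
  have hdle : ∀ S ≤ 0, |logRescaled p h lam m W S - logProfile 2 (1 / 8) S| ≤ d :=
    fun S hS => le_csSup hbdd (mem_image_of_mem _ hS)
  have hd0 : 0 ≤ d := (abs_nonneg _).trans (hdle 0 le_rfl)
  have hxd : ∀ S ≤ 0, |x S - logProfile 2 (1 / 8) S| ≤ d + κ := fun S hS => by
    have := abs_add_le (x S - logRescaled p h lam m W S)
      (logRescaled p h lam m W S - logProfile 2 (1 / 8) S)
    rw [sub_add_sub_cancel] at this
    linarith [(hex S hS).2.1, hdle S hS]
  have hYd : ∀ S ≤ 0, |logRescaled' p h lam m Q S - logProfile' 2 (1 / 8) S|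
      ≤ (d + κ) / 2 * Real.exp (2 * S) :=
    abs_le_exp_of_abs_deriv_le (D := fun S => logRescaled' p h lam m Q S - logProfile' 2 (1 / 8) S)
      (fun S hS => (hasDerivAt_logRescaled' hp hm0 hf hs (hneg S hS)).sub
        (hasDerivAt_logProfile' two_pos (by norm_num) S))
      (fun S hS => by
        rw [← hL, hxe S hS, Real.exp_add, ← mul_neg, ← mul_neg, ← mul_sub, abs_mul,
          abs_of_pos (Real.exp_pos _), mul_comm]
        refine mul_le_mul_of_nonneg_right ?_ (Real.exp_pos _).le
        rw [neg_sub_neg, abs_sub_comm]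
        exact (abs_exp_sub_exp_le (hx0 S hS) (logProfile_two_nonpos S)).trans (hxd S hS))
      (by
        have := hYlim.sub (tendsto_logProfile'_atBot (a := 2) (b := 1 / 8) two_pos)
        simpa using this)
  have hZd : ∀ S ≤ 0, |logRescaled p h lam m W S - logProfile 2 (1 / 8) S|
      ≤ (d + κ) / 2 / 2 * Real.exp (2 * S) :=
    abs_le_exp_of_abs_deriv_le (D := fun S => logRescaled p h lam m W S - logProfile 2 (1 / 8) S)
      (fun S hS => (hasDerivAt_logRescaled hs (hneg S hS)).sub
        (hasDerivAt_logProfile (by norm_num) S)) hYd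
      (by simpa using hZlim.sub tendsto_logProfile_two)
  -- Contraction: the nonlinearities differ by at most `d + κ`, because `exp` is 1-Lipschitz on the
  -- nonpositive reals. Two integrations give `d ≤ (d + κ)/4`.
  have hdκ : d ≤ κ := by
    have : d ≤ (d + κ) / 2 / 2 := by
      refine csSup_le ⟨_, mem_image_of_mem _ (mem_Iic.2 (le_refl (0 : ℝ)))⟩ ?_
      rintro _ ⟨S, hS, rfl⟩
      refine (hZd S hS).trans ?_
      have := he1 S hS
      have h0 : 0 ≤ (d + κ) / 2 / 2 := by positivity
      nlinarith
    linarith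
  have hκη : κ ≤ η / 4 := min_le_left _ _
  have hκ4 : κ ≤ 1 / 4 := min_le_right _ _
  intro S hS
  have hE := Real.exp_pos (2 * S)
  have r1 : |logRescaled p h lam m W S - logProfile 2 (1 / 8) S| ≤ η * Real.exp (2 * S) :=
    (hZd S hS).trans (mul_le_mul_of_nonneg_right (by linarith) hE.le)
  have r2 : |logRescaled' p h lam m Q S - logProfile' 2 (1 / 8) S| ≤ η * Real.exp (2 * S) :=
    (hYd S hS).trans (mul_le_mul_of_nonneg_right (by linarith) hE.le)
  have r3 : η * Real.exp (2 * S) ≤ η := by nlinarith [he1 S hS]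
  refine ⟨⟨r1.trans r3, r2.trans r3, ?_, ?_⟩, r1, r2⟩
  · rw [← hL, hxe S hS, ← Real.exp_add, ← sub_eq_add_neg]
    have := hxd S hS
    exact (Real.abs_exp_sub_one_le (by linarith)).trans (by linarith)
  · exact (hex S hS).2.2.trans (by linarith)

end Rescaling

/-! ### Convergence of rescaled solutions along a sequence -/

/-- The solutions, rescaled at the heights `m n`, converge to the profile locally uniformly. -/
structure BubbleConv (p : ℝ) (h : ℝ → ℝ) (lam m : ℕ → ℝ) (W Q : ℕ → ℝ → ℝ) (a b : ℝ) : Prop where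
  height_atTop : Tendsto m atTop atTop
  close : ∀ M η : ℝ, 0 < η → ∀ᶠ n in atTop, Real.log (scale p h (lam n) (m n)) + M < 0 ∧
    ∀ S ∈ Icc (-M) M, WindowClose p h (lam n) (m n) (W n) (Q n) a b η S

section Sequences

variable {p : ℝ} {h : ℝ → ℝ} {lam mu : ℕ → ℝ} {W Q : ℕ → ℝ → ℝ}

/-- Asymptotic agreement of value and slope at one bounded time propagates to every fixed window by
continuous dependence. The time may vary with `n`, because the centre of a later bubble has its
limiting position only asymptotically. -/
theorem BubbleConv.of_base (hp : 0 < p) (hH0 : StandingH h) (hH1 : GrowthH p h)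
    (hs : ∀ n, LogSol p h (lam n) (mu n) (W n) (Q n)) {m : ℕ → ℝ} (hm : Tendsto m atTop atTop)
    {a b : ℝ} (ha : 0 < a) (hb : 0 < b) {S₀ : ℕ → ℝ} {M₀ : ℝ} (hM₀ : ∀ᶠ n in atTop, |S₀ n| ≤ M₀)
    (hneg : ∀ᶠ n in atTop, Real.log (scale p h (lam n) (m n)) + S₀ n < 0)
    (hZ : Tendsto (fun n => logRescaled p h (lam n) (m n) (W n) (S₀ n) - logProfile a b (S₀ n))
      atTop (𝓝 0))
    (hY : Tendsto (fun n => logRescaled' p h (lam n) (m n) (Q n) (S₀ n) - logProfile' a b (S₀ n))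
      atTop (𝓝 0)) : BubbleConv p h lam m W Q a b := by
  refine ⟨hm, fun M η hη => ?_⟩
  set M' := max M M₀ with hM'
  set K := |Real.log (2 * a ^ 2 * b)| + (|a - 2| + 2 * |a|) * |M'| + 2 * Real.log (1 + b) with hK
  have hK0 : 0 ≤ K := by
    have := Real.log_nonneg (show 1 ≤ 1 + b by linarith)
    positivity
  have hζ : ∀ S ∈ Icc (-M') M', |logProfile a b S| ≤ K := fun S hS => by
    refine (abs_logProfile_le hb S).trans ?_
    have : |S| ≤ |M'| := (abs_le.2 hS).trans (le_abs_self _)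
    rw [hK]
    gcongr
  set B := K + (2 + a) + 1 with hB
  obtain ⟨T1, hT1, h1⟩ := exists_log_scale_add_lt hp hH0 hH1 B M'
  obtain ⟨T2, κ, hT2, hκ, h2⟩ := exists_window_close hp hH0 hH1 B (-M') M' hη
  obtain ⟨T3, hT3, h3⟩ := exists_nonlin_le hp hH0 hH1
  filter_upwards [hM₀, hneg, hm.eventually_ge_atTop T1, hm.eventually_ge_atTop T2,
    hm.eventually_ge_atTop T3, Metric.tendsto_nhds.1 hZ (min κ 1) (by positivity),
    Metric.tendsto_nhds.1 hY (min κ 1) (by positivity)] with n c1 c2 c3 c4 c5 c6 c7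
  rw [Real.dist_eq, sub_zero, lt_min_iff] at c6 c7
  have hS₀ : S₀ n ∈ Icc (-M') M' := abs_le.1 (c1.trans (le_max_right _ _))
  have hm0 : 0 < m n := hT1.trans_le c3
  have hf := (h3 _ c5).1
  have hZB : |logRescaled p h (lam n) (m n) (W n) (S₀ n)| ≤ B := by
    have := abs_sub_abs_le_abs_sub (logRescaled p h (lam n) (m n) (W n) (S₀ n))
      (logProfile a b (S₀ n))
    linarith [hζ _ hS₀, c6.2]
  have hYB : |logRescaled' p h (lam n) (m n) (Q n) (S₀ n)| ≤ B := by
    have := abs_sub_abs_le_abs_sub (logRescaled' p h (lam n) (m n) (Q n) (S₀ n))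
      (logProfile' a b (S₀ n))
    linarith [logProfile'_mem ha hb (S₀ n), c7.2]
  have hroom := h1 (m n) c3 (lam n) (mu n) (W n) (Q n) (hs n) (S₀ n) hS₀.1 hS₀.2 c2 hZB hYB
  refine ⟨by linarith [le_max_left M M₀], fun S hS => ?_⟩
  have hS' : S ∈ Icc (-M') M' :=
    ⟨by linarith [hS.1, le_max_left M M₀], hS.2.trans (le_max_left _ _)⟩
  obtain ⟨d1, d2, d3, d4⟩ := h2 (m n) c4 _ _ (logProfile a b) (logProfile' a b)
    (rescaledSol hp hm0 hf (hs n) hroom) (fun x _ => hasDerivAt_logProfile hb x)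
    (fun x _ => hasDerivAt_logProfile' ha hb x) (fun x hx => (hζ x hx).trans (by linarith))
    (S₀ n) hS₀ hZB hYB c6.1.le c7.1.le S hS'
  rw [add_logRescaled_div hp hm0] at d3 d4
  exact ⟨d1, d2, d3, d4⟩

/-- The first bubble. -/
theorem firstBubble_conv (hp : 0 < p) (hH0 : StandingH h) (hH1 : GrowthH p h)
    (hs : ∀ n, LogSol p h (lam n) (mu n) (W n) (Q n)) (hmu : Tendsto mu atTop atTop) :
    BubbleConv p h lam mu W Q 2 (1 / 8) ∧ ∀ η : ℝ, 0 < η → ∀ᶠ n in atTop, ∀ S ≤ 0,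
      WindowClose p h (lam n) (mu n) (W n) (Q n) 2 (1 / 8) η S ∧
      |logRescaled p h (lam n) (mu n) (W n) S - logProfile 2 (1 / 8) S| ≤ η * Real.exp (2 * S) ∧
      |logRescaled' p h (lam n) (mu n) (Q n) S - logProfile' 2 (1 / 8) S|
        ≤ η * Real.exp (2 * S) := by
  have hin : ∀ η : ℝ, 0 < η → ∀ᶠ n in atTop, Real.log (scale p h (lam n) (mu n)) < 0 ∧ ∀ S ≤ 0,
      WindowClose p h (lam n) (mu n) (W n) (Q n) 2 (1 / 8) η S ∧
      |logRescaled p h (lam n) (mu n) (W n) S - logProfile 2 (1 / 8) S| ≤ η * Real.exp (2 * S) ∧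
      |logRescaled' p h (lam n) (mu n) (Q n) S - logProfile' 2 (1 / 8) S|
        ≤ η * Real.exp (2 * S) := fun η hη => by
    obtain ⟨T, hT, hb⟩ := exists_inner_close hp hH0 hH1 hη
    filter_upwards [hmu.eventually_ge_atTop T] with n hn using hb _ hn _ _ _ (hs n)
  refine ⟨BubbleConv.of_base hp hH0 hH1 hs hmu two_pos (by norm_num) (S₀ := fun _ => 0)
    (M₀ := 0) (by simp) ?_ ?_ ?_, fun η hη => (hin η hη).mono fun n hn => hn.2⟩
  · filter_upwards [hin 1 one_pos] with n hn
    simpa using hn.1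
  · rw [Metric.tendsto_nhds]
    intro ε hε
    filter_upwards [hin (ε / 2) (half_pos hε)] with n hn
    rw [Real.dist_eq, sub_zero]
    exact ((hn.2 0 le_rfl).1.Z).trans_lt (by linarith)
  · rw [Metric.tendsto_nhds]
    intro ε hε
    filter_upwards [hin (ε / 2) (half_pos hε)] with n hn
    rw [Real.dist_eq, sub_zero]
    exact ((hn.2 0 le_rfl).1.Y).trans_lt (by linarith)

/-! ### States between two bubbles -/

/-- Data of the solutions at the times `e n` at which a bubble has just been passed:
relative height `x` and slope parameter `A = p u^(p-1) · (flux)`. -/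
structure NeckState (p : ℝ) (h : ℝ → ℝ) (lam mu : ℕ → ℝ) (W Q : ℕ → ℝ → ℝ) (x A : ℝ)
    (e : ℕ → ℝ) : Prop where
  neg : ∀ n, e n < 0
  height : Tendsto (fun n => W n (e n) / mu n) atTop (𝓝 x)
  slope : Tendsto (fun n => p * mu n ^ (p - 1) * Q n (e n)) atTop (𝓝 (A / x ^ (p - 1)))
  dens_tendsto : Tendsto (fun n => mu n ^ (p - 1) * dens p h (lam n) (W n) (e n)) atTop (𝓝 0)
  log_lam : Tendsto (fun n => (Real.log (lam n) + 2 * e n) / mu n ^ p) atTop (𝓝 (-x ^ p))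

end Sequences

/-! ### Decay of the density and constancy of the flux along a neck -/

section Neck

variable {p : ℝ} {h : ℝ → ℝ} {lam mu : ℕ → ℝ} {W Q : ℕ → ℝ → ℝ}

theorem tendsto_height_atTop (hmu : Tendsto mu atTop atTop) {x : ℝ} (hx : 0 < x) {w : ℕ → ℝ}
    (hw : Tendsto (fun n => w n / mu n) atTop (𝓝 x)) : Tendsto w atTop atTop := by
  refine (hw.pos_mul_atTop hx hmu).congr' ?_
  filter_upwards [hmu.eventually_gt_atTop 0] with n hn
  field_simp

/-- Change of the height in the weight `u^(p-1)`. -/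
theorem tendsto_height_rpow_mul (hmu : Tendsto mu atTop atTop) {x : ℝ} (hx : 0 < x)
    {w q : ℕ → ℝ} (hw : Tendsto (fun n => w n / mu n) atTop (𝓝 x)) {B : ℝ} (r : ℝ)
    (hq : Tendsto (fun n => mu n ^ r * q n) atTop (𝓝 B)) :
    Tendsto (fun n => w n ^ r * q n) atTop (𝓝 (x ^ r * B)) := by
  have h1 : Tendsto (fun n => (w n / mu n) ^ r) atTop (𝓝 (x ^ r)) :=
    hw.rpow_const (Or.inl hx.ne')
  refine (h1.mul hq).congr' ?_
  filter_upwards [hmu.eventually_gt_atTop 0,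
    (tendsto_height_atTop hmu hx hw).eventually_gt_atTop 0] with n h2 h3
  rw [Real.div_rpow h3.le h2.le]
  have := Real.rpow_pos_of_pos h2 r
  field_simp

theorem NeckState.tendsto_slope (hmu : Tendsto mu atTop atTop) {x A : ℝ} (hx : 0 < x)
    {e : ℕ → ℝ} (he : NeckState p h lam mu W Q x A e) :
    Tendsto (fun n => p * W n (e n) ^ (p - 1) * Q n (e n)) atTop (𝓝 A) := by
  have h1 : Tendsto (fun n => mu n ^ (p - 1) * (p * Q n (e n))) atTop (𝓝 (A / x ^ (p - 1))) :=
    he.slope.congr fun n => by ring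
  have h2 := tendsto_height_rpow_mul hmu hx he.height (p - 1) h1
  rw [mul_div_cancel₀ _ (Real.rpow_pos_of_pos hx _).ne'] at h2
  exact h2.congr fun n => by ring

/-- Along the neck the density of the energy decays exponentially. The solution lies below its
tangent, for which the decay is explicit. -/
theorem NeckState.exists_dens_le (hp : 0 < p) (hH0 : StandingH h) (hH1 : GrowthH p h)
    (hs : ∀ n, LogSol p h (lam n) (mu n) (W n) (Q n)) (hmu : Tendsto mu atTop atTop)
    {x A c Y : ℝ} (hx : 0 < x) (hA : 0 < A) (hc : 0 < c)
    (hY : ∀ y, 0 ≤ y → y ≤ Y → (2 * p / A + c) * y ≤ 1 - (1 - y) ^ p)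
    {e : ℕ → ℝ} (he : NeckState p h lam mu W Q x A e) :
    ∃ T c₁ : ℝ, 0 < T ∧ 0 < c₁ ∧ ∀ᶠ n in atTop, ∀ t, e n ≤ t → t < 0 → T ≤ W n t →
      (1 - Y) * W n (e n) ≤ W n t →
      dens p h (lam n) (W n) t ≤ dens p h (lam n) (W n) (e n) * Real.exp (-c₁ * (t - e n)) := by
  -- `D = 2 + 4c₁` is the decay rate of `W^p` along the tangent predicted by `hY`. The factor `1 -
  -- ε` from `log f` reduces it to `2 + 3c₁`, and the error of the slope at finite `n` to `2 + c₁`.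
  -- Against the growth `exp(2t)` a decay rate `c₁` remains.
  set D := 2 + c * A / p with hD
  have hcA : 0 < c * A / p := by positivity
  have hD0 : 0 < D := by positivity
  set c₁ := c * A / (4 * p) with hc₁
  have hc₁0 : 0 < c₁ := by positivity
  have hc₁e : c * A / p = 4 * c₁ := by rw [hc₁]; field_simp
  set ε := c₁ / D with hε
  have hε0 : 0 < ε := by positivity
  have hε1 : (1 - ε) * D = 2 + 3 * c₁ := by
    rw [hε, sub_mul, div_mul_cancel₀ _ hD0.ne', hD, hc₁e]; ring
  have hε2 : 0 < 1 - ε := by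
    have : 0 < (1 - ε) * D := by rw [hε1]; positivity
    exact (pos_iff_pos_of_mul_pos this).2 hD0
  obtain ⟨T1, hT1, hlog⟩ := exists_log_nonlin_sub_bounds hp hH0 hH1 hε0
  obtain ⟨T2, hT2, hmon⟩ := exists_nonlin_le hp hH0 hH1
  have hsl := he.tendsto_slope hmu hx
  have hlim : Tendsto (fun n => (1 - ε) * (p * W n (e n) ^ (p - 1) * Q n (e n) / p *
      (2 * p / A + c))) atTop (𝓝 (2 + 3 * c₁)) := by
    have := ((hsl.div_const p).mul_const (2 * p / A + c)).const_mul (1 - ε)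
    have e1 : A / p * (2 * p / A + c) = D := by rw [hD]; field_simp
    rwa [e1, hε1] at this
  refine ⟨max T1 T2, c₁, lt_max_of_lt_left hT1, hc₁0, ?_⟩
  filter_upwards [hlim.eventually_const_lt (show 2 + c₁ < 2 + 3 * c₁ by linarith)] with n hn
  intro t het ht hTW hYW
  have hsn := hs n
  have hW := hsn.pos t ht
  have hWe : 0 < W n (e n) := hsn.pos _ (he.neg n)
  set ℓ := W n (e n) - Q n (e n) * (t - e n) with hℓ
  have hWℓ : W n t ≤ ℓ := by linarith [hsn.le_sub het ht]
  have hτ : 0 ≤ t - e n := by linarith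
  have hQτ : 0 ≤ Q n (e n) * (t - e n) := mul_nonneg (hsn.Q_nonneg _ (he.neg n)) hτ
  have hℓe : ℓ ≤ W n (e n) := by linarith
  have hℓ1 : T1 ≤ ℓ := ((le_max_left _ _).trans hTW).trans hWℓ
  have hℓ2 : T2 ≤ ℓ := ((le_max_right _ _).trans hTW).trans hWℓ
  have hf1 : nonlin p h (W n t) ≤ nonlin p h ℓ := (hmon ℓ hℓ2).2 _ hW.le hWℓ
  obtain ⟨hℓpos, hF, -⟩ := hlog ℓ _ hℓ1 hℓe
  have hepos := (hlog _ _ (hℓ1.trans hℓe) le_rfl).1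
  -- The relative drop of the tangent. It is at most `Y` because the tangent lies above the
  -- solution, whose relative drop is at most `Y`.
  set y := Q n (e n) * (t - e n) / W n (e n) with hy
  have hy0 : 0 ≤ y := by positivity
  have hyW : W n (e n) * y = Q n (e n) * (t - e n) := by rw [hy]; field_simp
  have hℓy : ℓ = W n (e n) * (1 - y) := by rw [mul_sub, hyW, mul_one]
  have hyY : y ≤ Y := by
    have : W n (e n) * (1 - Y) ≤ W n (e n) * (1 - y) := by rw [← hℓy]; linarith
    linarith [le_of_mul_le_mul_left this hWe]
  have h1y : 0 ≤ 1 - y := by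
    have : 0 < W n (e n) * (1 - y) := by rw [← hℓy]; exact hW.trans_le hWℓ
    exact ((pos_iff_pos_of_mul_pos this).1 hWe).le
  have hpow : W n (e n) ^ p - ℓ ^ p = W n (e n) ^ p * (1 - (1 - y) ^ p) := by
    rw [hℓy, Real.mul_rpow hWe.le h1y]; ring
  have hWp : W n (e n) ^ p = W n (e n) ^ (p - 1) * W n (e n) := by
    rw [← Real.rpow_add_one hWe.ne']; ring_nf
  have hlow : W n (e n) ^ (p - 1) * Q n (e n) * (2 * p / A + c) * (t - e n)
      ≤ W n (e n) ^ p - ℓ ^ p := by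
    rw [hpow]
    have := mul_le_mul_of_nonneg_left (hY y hy0 hyY) (Real.rpow_pos_of_pos hWe p).le
    refine le_trans (le_of_eq ?_) this
    rw [hWp]
    linear_combination (-(W n (e n) ^ (p - 1) * (2 * p / A + c))) * hyW
  have hfl : Real.log (nonlin p h ℓ) ≤ Real.log (nonlin p h (W n (e n))) - (2 + c₁) * (t - e n) := by
    have h5 : (2 + c₁) * (t - e n) ≤ (1 - ε) * (W n (e n) ^ p - ℓ ^ p) := by
      calc (2 + c₁) * (t - e n) ≤ (1 - ε) * (p * W n (e n) ^ (p - 1) * Q n (e n) / p *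
            (2 * p / A + c)) * (t - e n) := mul_le_mul_of_nonneg_right hn.le hτ
        _ = (1 - ε) * (W n (e n) ^ (p - 1) * Q n (e n) * (2 * p / A + c) * (t - e n)) := by
            field_simp
        _ ≤ _ := mul_le_mul_of_nonneg_left hlow hε2.le
    linarith
  have hfl2 : nonlin p h ℓ ≤ nonlin p h (W n (e n)) * Real.exp (-(2 + c₁) * (t - e n)) := by
    rw [← Real.log_le_log_iff hℓpos (by positivity), Real.log_mul hepos.ne' (Real.exp_pos _).ne',
      Real.log_exp]
    linarith
  have hl := hsn.lam_pos
  calc dens p h (lam n) (W n) t = lam n * Real.exp (2 * t) * nonlin p h (W n t) := rfl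
    _ ≤ lam n * Real.exp (2 * t) *
        (nonlin p h (W n (e n)) * Real.exp (-(2 + c₁) * (t - e n))) :=
        mul_le_mul_of_nonneg_left (hf1.trans hfl2) (by positivity)
    _ = lam n * nonlin p h (W n (e n)) *
        (Real.exp (2 * t) * Real.exp (-(2 + c₁) * (t - e n))) := by ring
    _ = lam n * nonlin p h (W n (e n)) *
        (Real.exp (2 * e n) * Real.exp (-c₁ * (t - e n))) := by
        rw [← Real.exp_add, ← Real.exp_add]; ring_nf
    _ = _ := by unfold dens; ring

/-- Along the neck the flux is asymptotically constant. -/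
theorem NeckState.exists_flux_le (hp : 0 < p) (hH0 : StandingH h) (hH1 : GrowthH p h)
    (hs : ∀ n, LogSol p h (lam n) (mu n) (W n) (Q n)) (hmu : Tendsto mu atTop atTop)
    {x A c Y : ℝ} (hx : 0 < x) (hA : 0 < A) (hc : 0 < c)
    (hY : ∀ y, 0 ≤ y → y ≤ Y → (2 * p / A + c) * y ≤ 1 - (1 - y) ^ p)
    {e : ℕ → ℝ} (he : NeckState p h lam mu W Q x A e) :
    ∃ T : ℝ, 0 < T ∧ ∀ η : ℝ, 0 < η → ∀ᶠ n in atTop, ∀ t, e n ≤ t → t < 0 → T ≤ W n t →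
      (1 - Y) * W n (e n) ≤ W n t →
      mu n ^ (p - 1) * dens p h (lam n) (W n) t ≤ η ∧
      |p * mu n ^ (p - 1) * Q n t - A / x ^ (p - 1)| ≤ η := by
  obtain ⟨T, c₁, hT, hc₁, hd⟩ := he.exists_dens_le hp hH0 hH1 hs hmu hx hA hc hY
  refine ⟨T, hT, fun η hη => ?_⟩
  filter_upwards [hd, Metric.tendsto_nhds.1 he.slope (η / 2) (half_pos hη),
    he.dens_tendsto.eventually_lt_const hη,
    he.dens_tendsto.eventually_lt_const (show 0 < η / 2 * c₁ / p by positivity),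
    hmu.eventually_gt_atTop 0] with n h1 h2 h3 h4 h5 t het ht hTW hYW
  have hpow := Real.rpow_pos_of_pos h5 (p - 1)
  have hde := (hs n).dens_nonneg hH0 (he.neg n)
  have hexp : Real.exp (-c₁ * (t - e n)) ≤ 1 := Real.exp_le_one_iff.2 (by nlinarith)
  constructor
  · have := h1 t het ht hTW hYW
    have h6 : dens p h (lam n) (W n) t ≤ dens p h (lam n) (W n) (e n) := by nlinarith
    exact (mul_le_mul_of_nonneg_left h6 hpow.le).trans h3.le
  · set d := dens p h (lam n) (W n) (e n) with hddef
    -- Integrating the exponential bound shows that the flux gained after `e n` is at most `d / c₁`,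
    -- and `mu^(p-1) d` tends to zero.
    have hder : ∀ s, HasDerivAt (fun s => -(d / c₁) * Real.exp (-c₁ * (s - e n)))
        (d * Real.exp (-c₁ * (s - e n))) s := fun s => by
      have : HasDerivAt (fun s => Real.exp (-c₁ * (s - e n)))
          (Real.exp (-c₁ * (s - e n)) * (-c₁)) s := by
        simpa using (((hasDerivAt_id s).sub_const (e n)).const_mul (-c₁)).exp
      refine (this.const_mul _).congr_deriv ?_
      field_simp
    have hQ := sub_le_sub_of_hasDerivAt_le het
      (fun s hs' => (hs n).hasDerivAt_Q (hs'.2.trans_lt ht)) (fun s _ => hder s)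
      (fun s hs' => h1 s hs'.1 (hs'.2.trans_lt ht) (hTW.trans ((hs n).W_anti hs'.2 ht))
        (hYW.trans ((hs n).W_anti hs'.2 ht)))
    simp only [sub_self, mul_zero, Real.exp_zero, mul_one] at hQ
    have hQ2 : Q n t - Q n (e n) ≤ d / c₁ := by
      have : 0 ≤ d / c₁ * Real.exp (-c₁ * (t - e n)) := by positivity
      linarith
    have hQ3 := (hs n).Q_mono _ _ het ht
    rw [Real.dist_eq, abs_lt] at h2
    have h6 : p * mu n ^ (p - 1) * (Q n t - Q n (e n)) ≤ η / 2 := by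
      calc p * mu n ^ (p - 1) * (Q n t - Q n (e n)) ≤ p * mu n ^ (p - 1) * (d / c₁) := by gcongr
        _ = p * (mu n ^ (p - 1) * d) / c₁ := by ring
        _ ≤ p * (η / 2 * c₁ / p) / c₁ := by gcongr
        _ = η / 2 := by field_simp
    have h7 : 0 ≤ p * mu n ^ (p - 1) * (Q n t - Q n (e n)) :=
      mul_nonneg (by positivity) (by linarith)
    rw [abs_le]
    constructor <;> linarith

end Neck

/-! ### Times and `log λ` in units of `μ^p` -/

section Logarithms

variable {p : ℝ} {h : ℝ → ℝ} {lam mu : ℕ → ℝ} {W Q : ℕ → ℝ → ℝ}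

theorem tendsto_rpow_of_atTop (hp : 0 < p) (hmu : Tendsto mu atTop atTop) :
    Tendsto (fun n => mu n ^ p) atTop atTop := (tendsto_rpow_atTop hp).comp hmu

theorem tendsto_div_rpow (hp : 0 < p) (hmu : Tendsto mu atTop atTop) (C : ℝ) :
    Tendsto (fun n => C / mu n ^ p) atTop (𝓝 0) :=
  tendsto_const_nhds.div_atTop (tendsto_rpow_of_atTop hp hmu)

theorem tendsto_height_rpow_div (hmu : Tendsto mu atTop atTop) {x : ℝ} (hx : 0 < x) {w : ℕ → ℝ}
    (hw : Tendsto (fun n => w n / mu n) atTop (𝓝 x)) :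
    Tendsto (fun n => w n ^ p / mu n ^ p) atTop (𝓝 (x ^ p)) := by
  refine (hw.rpow_const (p := p) (Or.inl hx.ne')).congr' ?_
  filter_upwards [hmu.eventually_gt_atTop 0,
    (tendsto_height_atTop hmu hx hw).eventually_gt_atTop 0] with n h2 h3
  rw [Real.div_rpow h3.le h2.le]

theorem tendsto_log_height_div (hp : 0 < p) (hmu : Tendsto mu atTop atTop) {x : ℝ} (hx : 0 < x)
    {w : ℕ → ℝ} (hw : Tendsto (fun n => w n / mu n) atTop (𝓝 x)) :
    Tendsto (fun n => Real.log (w n) / mu n ^ p) atTop (𝓝 0) := by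
  have h1 : Tendsto (fun t : ℝ => Real.log t / t ^ p) atTop (𝓝 0) :=
    (isLittleO_log_rpow_atTop hp).tendsto_div_nhds_zero
  have h2 := (h1.comp (tendsto_height_atTop hmu hx hw)).mul
    (tendsto_height_rpow_div (p := p) hmu hx hw)
  rw [zero_mul] at h2
  refine h2.congr' ?_
  filter_upwards [(tendsto_height_atTop hmu hx hw).eventually_gt_atTop 0] with n h3
  have := Real.rpow_pos_of_pos h3 p
  simp only [Function.comp]
  field_simp

theorem tendsto_log_nonlin_height_div (hp : 0 < p) (hH0 : StandingH h) (hH1 : GrowthH p h)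
    (hmu : Tendsto mu atTop atTop) {x : ℝ} (hx : 0 < x) {w : ℕ → ℝ}
    (hw : Tendsto (fun n => w n / mu n) atTop (𝓝 x)) :
    Tendsto (fun n => Real.log (nonlin p h (w n)) / mu n ^ p) atTop (𝓝 (x ^ p)) := by
  have h2 := ((tendsto_log_nonlin_div hp hH0 hH1).comp (tendsto_height_atTop hmu hx hw)).mul
    (tendsto_height_rpow_div (p := p) hmu hx hw)
  rw [one_mul] at h2
  refine h2.congr' ?_
  filter_upwards [(tendsto_height_atTop hmu hx hw).eventually_gt_atTop 0] with n h3
  have := Real.rpow_pos_of_pos h3 p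
  simp only [Function.comp]
  field_simp

theorem tendsto_mu_div_mu (hmu : Tendsto mu atTop atTop) :
    Tendsto (fun n => mu n / mu n) atTop (𝓝 1) := by
  refine tendsto_const_nhds.congr' ?_
  filter_upwards [hmu.eventually_gt_atTop 0] with n hn
  rw [div_self hn.ne']

/-- Passage of time along the neck. -/
theorem NeckState.tendsto_log_lam (hp : 0 < p)
    (hs : ∀ n, LogSol p h (lam n) (mu n) (W n) (Q n)) (hmu : Tendsto mu atTop atTop)
    {x A y : ℝ} (hx : 0 < x) (hA : 0 < A) {e t : ℕ → ℝ} (he : NeckState p h lam mu W Q x A e)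
    (ht : ∀ᶠ n in atTop, e n ≤ t n ∧ t n < 0)
    (hW : Tendsto (fun n => W n (t n) / mu n) atTop (𝓝 y))
    (hQ : Tendsto (fun n => p * mu n ^ (p - 1) * Q n (t n)) atTop (𝓝 (A / x ^ (p - 1)))) :
    Tendsto (fun n => (Real.log (lam n) + 2 * t n) / mu n ^ p) atTop
      (𝓝 (-x ^ p + 2 * (p * x ^ (p - 1) * (x - y) / A))) := by
  have hxp := Real.rpow_pos_of_pos hx (p - 1)
  have hP : 0 < A / x ^ (p - 1) := by positivity
  have hnum : Tendsto (fun n => p * (W n (e n) / mu n - W n (t n) / mu n)) atTop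
      (𝓝 (p * (x - y))) := (he.height.sub hW).const_mul p
  have hlo := hnum.div hQ hP.ne'
  have hup := hnum.div he.slope hP.ne'
  have hpowmu : ∀ᶠ n in atTop, mu n ^ p = mu n ^ (p - 1) * mu n := by
    filter_upwards [hmu.eventually_gt_atTop 0] with n hn
    rw [← Real.rpow_add_one hn.ne']; ring_nf
  -- The elapsed time lies between the drop of the height divided by the final flux and the same
  -- drop divided by the initial flux. Both normalized fluxes have the same limit.
  have hτ : Tendsto (fun n => (t n - e n) / mu n ^ p) atTop
      (𝓝 (p * (x - y) / (A / x ^ (p - 1)))) := by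
    refine tendsto_of_tendsto_of_tendsto_of_le_of_le' hlo hup ?_ ?_
    · filter_upwards [ht, hmu.eventually_gt_atTop 0, hQ.eventually_const_lt hP, hpowmu]
        with n h1 h2 h3 h4
      have h5 := (hs n).sub_le h1.1 h1.2
      have h6 := Real.rpow_pos_of_pos h2 (p - 1)
      rw [Pi.div_apply, div_le_div_iff₀ h3 (Real.rpow_pos_of_pos h2 p), h4]
      have : p * (W n (e n) / mu n - W n (t n) / mu n) * (mu n ^ (p - 1) * mu n)
          = p * mu n ^ (p - 1) * (W n (e n) - W n (t n)) := by field_simp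
      rw [this]
      have := mul_le_mul_of_nonneg_left h5 (show 0 ≤ p * mu n ^ (p - 1) by positivity)
      linarith
    · filter_upwards [ht, hmu.eventually_gt_atTop 0, he.slope.eventually_const_lt hP, hpowmu]
        with n h1 h2 h3 h4
      have h5 := (hs n).le_sub h1.1 h1.2
      have h6 := Real.rpow_pos_of_pos h2 (p - 1)
      rw [Pi.div_apply, div_le_div_iff₀ (Real.rpow_pos_of_pos h2 p) h3, h4]
      have : p * (W n (e n) / mu n - W n (t n) / mu n) * (mu n ^ (p - 1) * mu n)
          = p * mu n ^ (p - 1) * (W n (e n) - W n (t n)) := by field_simp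
      rw [this]
      have := mul_le_mul_of_nonneg_left h5 (show 0 ≤ p * mu n ^ (p - 1) by positivity)
      linarith
  have hfin := he.log_lam.add (hτ.const_mul 2)
  have e1 : p * (x - y) / (A / x ^ (p - 1)) = p * x ^ (p - 1) * (x - y) / A := by field_simp
  rw [e1] at hfin
  refine hfin.congr fun n => ?_
  ring

/-- Upper bound for the logarithm of `λ`. -/
theorem NeckState.log_lam_le (hp : 0 < p)
    (hs : ∀ n, LogSol p h (lam n) (mu n) (W n) (Q n)) (hmu : Tendsto mu atTop atTop)
    {x A : ℝ} (hx : 0 < x) (hA : 0 < A) {e : ℕ → ℝ} (he : NeckState p h lam mu W Q x A e)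
    {ε : ℝ} (hε : 0 < ε) :
    ∀ᶠ n in atTop, Real.log (lam n) / mu n ^ p ≤ x ^ p * (2 * p / A - 1) + ε := by
  have hxp := Real.rpow_pos_of_pos hx (p - 1)
  have hP : 0 < A / x ^ (p - 1) := by positivity
  have hlim := he.log_lam.add (((he.height.const_mul p).div he.slope hP.ne').const_mul 2)
  have e1 : -x ^ p + 2 * (p * x / (A / x ^ (p - 1))) = x ^ p * (2 * p / A - 1) := by
    have : x ^ p = x ^ (p - 1) * x := by rw [← Real.rpow_add_one hx.ne']; ring_nf
    rw [this]; field_simp; ring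
  rw [e1] at hlim
  filter_upwards [hlim.eventually_lt_const (lt_add_of_pos_right _ hε),
    hmu.eventually_gt_atTop 0, he.slope.eventually_const_lt hP] with n h1 h2 h3
  refine le_trans ?_ h1.le
  have h4 := (hs n).Q_mul_le (he.neg n)
  have h5 := Real.rpow_pos_of_pos h2 p
  have h6 := Real.rpow_pos_of_pos h2 (p - 1)
  have hmm : mu n ^ p = mu n ^ (p - 1) * mu n := by rw [← Real.rpow_add_one h2.ne']; ring_nf
  -- The solution has to reach height zero by time `0` while its flux never falls below `Q n (e n)`.
  -- This limits the time left and therefore `log λ` from above.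
  have h7 : -e n / mu n ^ p ≤ p * (W n (e n) / mu n) / (p * mu n ^ (p - 1) * Q n (e n)) := by
    rw [div_le_div_iff₀ h5 h3, hmm]
    have : p * (W n (e n) / mu n) * (mu n ^ (p - 1) * mu n)
        = p * mu n ^ (p - 1) * W n (e n) := by field_simp
    rw [this]
    have := mul_le_mul_of_nonneg_left h4 (show 0 ≤ p * mu n ^ (p - 1) by positivity)
    linarith
  have e2 : Real.log (lam n) / mu n ^ p =
      (Real.log (lam n) + 2 * e n) / mu n ^ p + 2 * (-e n / mu n ^ p) := by ring
  rw [e2]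
  simp only [Pi.div_apply]
  linarith

/-- Lower bound for the logarithm of `λ`. -/
theorem log_lam_ge (hmu : Tendsto mu atTop atTop) {v : ℝ} {t : ℕ → ℝ}
    (ht : ∀ᶠ n in atTop, t n < 0)
    (hl : Tendsto (fun n => (Real.log (lam n) + 2 * t n) / mu n ^ p) atTop (𝓝 v))
    {ε : ℝ} (hε : 0 < ε) : ∀ᶠ n in atTop, v - ε ≤ Real.log (lam n) / mu n ^ p := by
  filter_upwards [hl.eventually_const_lt (sub_lt_self v hε), ht, hmu.eventually_gt_atTop 0]
    with n h1 h2 h3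
  refine h1.le.trans ?_
  have := Real.rpow_pos_of_pos h3 p
  gcongr
  linarith

/-- The times, if `log λ` is negligible. -/
theorem tendsto_neg_div_of_log_lam {v : ℝ} {t : ℕ → ℝ}
    (hl : Tendsto (fun n => (Real.log (lam n) + 2 * t n) / mu n ^ p) atTop (𝓝 v))
    (h0 : Tendsto (fun n => Real.log (lam n) / mu n ^ p) atTop (𝓝 0)) :
    Tendsto (fun n => -t n / mu n ^ p) atTop (𝓝 (-v / 2)) := by
  have := ((hl.sub h0).neg).div_const 2
  rw [sub_zero] at this
  refine this.congr fun n => ?_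
  ring

/-- Both `w^p` and `log(1/s)` are of exact order `μ^p`, so the coefficient is the quotient of the
two limits. The error term is chosen to make the formula an identity. -/
theorem powLogAsymp_of_tendsto (hp : 0 < p) (hmu : Tendsto mu atTop atTop) {w s : ℕ → ℝ}
    {x y : ℝ} (hx : 0 < x) (hy : 0 < y) (hw : Tendsto (fun n => w n / mu n) atTop (𝓝 x))
    (hlog : Tendsto (fun n => Real.log (1 / s n) / mu n ^ p) atTop (𝓝 y)) :
    PowLogAsymp p w s (x ^ p / y) := by
  have hwp := tendsto_height_rpow_div (p := p) hmu hx hw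
  refine ⟨fun n => w n ^ p / Real.log (1 / s n) - x ^ p / y, ?_, ?_⟩
  · have h1 := (hwp.div hlog hy.ne').sub_const (x ^ p / y)
    rw [sub_self] at h1
    refine h1.congr' ?_
    filter_upwards [hmu.eventually_gt_atTop 0] with n hn
    have := Real.rpow_pos_of_pos hn p
    simp only [Pi.div_apply]
    field_simp
  · filter_upwards [(tendsto_height_atTop hmu hx hw).eventually_gt_atTop 0,
      hmu.eventually_gt_atTop 0, hlog.eventually_const_lt hy] with n h1 h2 h3
    have h4 : 0 < Real.log (1 / s n) := by
      have := Real.rpow_pos_of_pos h2 p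
      rw [lt_div_iff₀ this] at h3
      linarith
    have e : (x ^ p / y + (w n ^ p / Real.log (1 / s n) - x ^ p / y)) * Real.log (1 / s n)
        = w n ^ p := by
      rw [add_sub_cancel, div_mul_cancel₀ _ h4.ne']
    rw [e]
    refine ⟨(Real.rpow_pos_of_pos h1 p).le, ?_⟩
    rw [← Real.rpow_mul h1.le, mul_one_div_cancel hp.ne', Real.rpow_one]

end Logarithms

/-- Half lengths `N n` of windows on which the rescaled solutions are close to the profile,
growing so slowly that the closeness beats every power of the radii. -/
structure BubbleRadii (p : ℝ) (h : ℝ → ℝ) (lam mu m : ℕ → ℝ) (W Q : ℕ → ℝ → ℝ) (a b : ℝ)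
    (N : ℕ → ℕ) : Prop where
  height_atTop : Tendsto m atTop atTop
  N_atTop : Tendsto N atTop atTop
  room : ∀ᶠ n in atTop, Real.log (scale p h (lam n) (m n)) + (2 * (N n : ℝ) + 1) < 0
  close : ∀ᶠ n in atTop, ∀ S ∈ Icc (-(N n : ℝ)) (N n),
    WindowClose p h (lam n) (m n) (W n) (Q n) a b (Real.exp (-2 * N n) / (N n + 1)) S
  slow : ∀ᶠ n in atTop, ((N n : ℝ) + 1) ^ 2 ≤ mu n ^ p

/-! ### Bubbles on slowly growing windows -/

section Radii

variable {p : ℝ} {h : ℝ → ℝ} {lam mu m : ℕ → ℝ} {W Q : ℕ → ℝ → ℝ} {a b δ : ℝ} {N : ℕ → ℕ}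

/-- Every requirement holds eventually for a fixed half length `k`, and a diagonal choice makes `k`
grow with `n`. The extra property `P` carries the half line estimate of the first bubble along. -/
theorem BubbleConv.exists_radii (hp : 0 < p) (hmu : Tendsto mu atTop atTop)
    (hc : BubbleConv p h lam m W Q a b) {P : ℕ → ℕ → Prop} (hP : ∀ k, ∀ᶠ n in atTop, P k n) :
    ∃ N : ℕ → ℕ, BubbleRadii p h lam mu m W Q a b N ∧ ∀ᶠ n in atTop, P (N n) n := by
  have hall : ∀ k : ℕ, ∀ᶠ n in atTop,
      (Real.log (scale p h (lam n) (m n)) + (2 * (k : ℝ) + 1) < 0 ∧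
      (∀ S ∈ Icc (-(k : ℝ)) k,
        WindowClose p h (lam n) (m n) (W n) (Q n) a b (Real.exp (-2 * k) / (k + 1)) S) ∧
      ((k : ℝ) + 1) ^ 2 ≤ mu n ^ p) ∧ P k n := fun k => by
    -- The longer window `2k + 1` provides the room condition. It forces `log γ + N < -N - 1`, so
    -- that the outer radius of the bubble tends to zero.
    filter_upwards [hc.close (2 * k + 1) (Real.exp (-2 * k) / (k + 1)) (by positivity),
      (tendsto_rpow_of_atTop hp hmu).eventually_ge_atTop (((k : ℝ) + 1) ^ 2), hP k]
      with n h1 h2 h3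
    have hk : (0 : ℝ) ≤ k := Nat.cast_nonneg k
    exact ⟨⟨h1.1, fun S hS => h1.2 S ⟨by linarith [hS.1], by linarith [hS.2]⟩, h2⟩, h3⟩
  obtain ⟨N, hN, hgood⟩ := exists_tendsto_diagonal hall
  exact ⟨N, ⟨hc.height_atTop, hN, hgood.mono fun n hn => hn.1.1,
    hgood.mono fun n hn => hn.1.2.1, hgood.mono fun n hn => hn.1.2.2⟩,
    hgood.mono fun n hn => hn.2⟩

namespace BubbleRadii

theorem tendsto_N_div (hp : 0 < p) (hmu : Tendsto mu atTop atTop)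
    (hN : BubbleRadii p h lam mu m W Q a b N) :
    Tendsto (fun n => ((N n : ℝ) + 1) / mu n ^ p) atTop (𝓝 0) := by
  have h1 : Tendsto (fun n => ((N n : ℝ) + 1)⁻¹) atTop (𝓝 0) :=
    (tendsto_atTop_add_const_right _ _
      (tendsto_natCast_atTop_atTop.comp hN.N_atTop)).inv_tendsto_atTop
  refine squeeze_zero' ?_ ?_ h1
  · filter_upwards [(tendsto_rpow_of_atTop hp hmu).eventually_gt_atTop 0] with n hn
    positivity
  · filter_upwards [(tendsto_rpow_of_atTop hp hmu).eventually_gt_atTop 0, hN.slow] with n hn h2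
    rw [div_le_iff₀ hn, inv_mul_eq_div, le_div_iff₀ (by positivity)]
    linarith

theorem tendsto_tol (hN : BubbleRadii p h lam mu m W Q a b N) :
    Tendsto (fun n => Real.exp (-2 * N n) / ((N n : ℝ) + 1)) atTop (𝓝 0) := by
  have h1 : Tendsto (fun n => ((N n : ℝ) + 1)⁻¹) atTop (𝓝 0) :=
    (tendsto_atTop_add_const_right _ _
      (tendsto_natCast_atTop_atTop.comp hN.N_atTop)).inv_tendsto_atTop
  refine squeeze_zero (fun n => by positivity) (fun n => ?_) h1
  rw [div_eq_mul_inv]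
  have h2 : Real.exp (-2 * N n) ≤ 1 := Real.exp_le_one_iff.2 (by
    have : (0 : ℝ) ≤ N n := Nat.cast_nonneg _
    linarith)
  have : 0 ≤ ((N n : ℝ) + 1)⁻¹ := by positivity
  nlinarith

/-- The height is asymptotically constant on the windows. -/
theorem tendsto_height_div (hp : 0 < p) (hmu : Tendsto mu atTop atTop) (hδ : 0 < δ) (hb : 0 < b)
    (hm : Tendsto (fun n => m n / mu n) atTop (𝓝 δ))
    (hN : BubbleRadii p h lam mu m W Q a b N) {S : ℕ → ℝ}
    (hS : ∀ᶠ n in atTop, S n ∈ Icc (-(N n : ℝ)) (N n)) :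
    Tendsto (fun n => W n (Real.log (scale p h (lam n) (m n)) + S n) / m n) atTop (𝓝 1) := by
  set K := |Real.log (2 * a ^ 2 * b)| + (|a - 2| + 2 * |a|) + 2 * Real.log (1 + b) + 1 with hK
  have hlog := Real.log_nonneg (show 1 ≤ 1 + b by linarith)
  have hmp := tendsto_height_rpow_div (p := p) hmu hδ hm
  have hδp := Real.rpow_pos_of_pos hδ p
  have h1 : Tendsto (fun n => K / p * (((N n : ℝ) + 1) / mu n ^ p / (m n ^ p / mu n ^ p)))
      atTop (𝓝 (K / p * (0 / δ ^ p))) :=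
    ((hN.tendsto_N_div hp hmu).div hmp hδp.ne').const_mul _
  rw [zero_div, mul_zero] at h1
  rw [tendsto_iff_dist_tendsto_zero]
  refine squeeze_zero' (Eventually.of_forall fun n => dist_nonneg) ?_ h1
  filter_upwards [hS, hN.close, hN.height_atTop.eventually_gt_atTop 0,
    hmu.eventually_gt_atTop 0, hN.tendsto_tol.eventually_lt_const one_pos] with n c1 c2 c3 c4 c5
  have d1 := (c2 (S n) c1).Z
  have d2 := abs_logProfile_le (a := a) hb (S n)
  have d3 : |S n| ≤ N n := abs_le.2 c1
  have hpm := Real.rpow_pos_of_pos c3 p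
  have hpm1 := Real.rpow_pos_of_pos c3 (p - 1)
  have hpmu := Real.rpow_pos_of_pos c4 p
  have hZ : |logRescaled p h (lam n) (m n) (W n) (S n)| ≤ K * (N n + 1) := by
    have e1 := abs_sub_abs_le_abs_sub (logRescaled p h (lam n) (m n) (W n) (S n))
      (logProfile a b (S n))
    have e2 : (|a - 2| + 2 * |a|) * |S n| ≤ (|a - 2| + 2 * |a|) * N n := by gcongr
    have hNn : (0 : ℝ) ≤ N n := Nat.cast_nonneg _
    have e3 : 0 ≤ (|Real.log (2 * a ^ 2 * b)| + 2 * Real.log (1 + b) + 1) * (N n : ℝ) := by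
      positivity
    have e4 : 0 ≤ |a - 2| + 2 * |a| := by positivity
    rw [hK]
    nlinarith
  have e : W n (Real.log (scale p h (lam n) (m n)) + S n) / m n - 1
      = logRescaled p h (lam n) (m n) (W n) (S n) / (p * m n ^ p) := by
    rw [← mul_rpow_sub_one_mul c3]
    unfold logRescaled
    field_simp
  rw [Real.dist_eq, e, abs_div, abs_of_pos (show 0 < p * m n ^ p by positivity),
    div_le_iff₀ (by positivity)]
  refine hZ.trans (le_of_eq ?_)
  field_simp

theorem tendsto_height (hp : 0 < p) (hmu : Tendsto mu atTop atTop) (hδ : 0 < δ) (hb : 0 < b)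
    (hm : Tendsto (fun n => m n / mu n) atTop (𝓝 δ))
    (hN : BubbleRadii p h lam mu m W Q a b N) {S : ℕ → ℝ}
    (hS : ∀ᶠ n in atTop, S n ∈ Icc (-(N n : ℝ)) (N n)) :
    Tendsto (fun n => W n (Real.log (scale p h (lam n) (m n)) + S n) / mu n) atTop (𝓝 δ) := by
  have := (hN.tendsto_height_div hp hmu hδ hb hm hS).mul hm
  rw [one_mul] at this
  refine this.congr' ?_
  filter_upwards [hN.height_atTop.eventually_gt_atTop 0] with n hn
  field_simp

theorem tendsto_slope_sub (hN : BubbleRadii p h lam mu m W Q a b N) {S : ℕ → ℝ}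
    (hS : ∀ᶠ n in atTop, S n ∈ Icc (-(N n : ℝ)) (N n)) :
    Tendsto (fun n => logRescaled' p h (lam n) (m n) (Q n) (S n) - logProfile' a b (S n))
      atTop (𝓝 0) := by
  refine (tendsto_zero_iff_abs_tendsto_zero _).2 ?_
  refine squeeze_zero' (Eventually.of_forall fun n => abs_nonneg _) ?_ hN.tendsto_tol
  filter_upwards [hS, hN.close] with n c1 c2 using (c2 (S n) c1).Y

/-- The slope of the solution at points of the windows. -/
theorem tendsto_slope (hmu : Tendsto mu atTop atTop) (hδ : 0 < δ)
    (hm : Tendsto (fun n => m n / mu n) atTop (𝓝 δ))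
    (hN : BubbleRadii p h lam mu m W Q a b N) {S : ℕ → ℝ}
    (hS : ∀ᶠ n in atTop, S n ∈ Icc (-(N n : ℝ)) (N n)) {A : ℝ}
    (hA : Tendsto (fun n => logProfile' a b (S n)) atTop (𝓝 (-A))) :
    Tendsto (fun n => p * mu n ^ (p - 1) * Q n (Real.log (scale p h (lam n) (m n)) + S n)) atTop
      (𝓝 (A / δ ^ (p - 1))) := by
  have h1 := ((hN.tendsto_slope_sub hS).add hA).neg.div
    (tendsto_height_rpow_div (p := p - 1) hmu hδ hm) (Real.rpow_pos_of_pos hδ _).ne'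
  rw [zero_add, neg_neg] at h1
  refine h1.congr' ?_
  filter_upwards [hN.height_atTop.eventually_gt_atTop 0, hmu.eventually_gt_atTop 0] with n h2 h3
  have := Real.rpow_pos_of_pos h2 (p - 1)
  have := Real.rpow_pos_of_pos h3 (p - 1)
  simp only [Pi.div_apply, sub_add_cancel, logRescaled']
  field_simp

end BubbleRadii

/-- This is the normalization of the scale. At a time where the height equals `mm` the right side is
`exp(2S)`, so the density at the centre of a bubble tells its position relative to the scale. -/
theorem mul_dens_eq (hp : 0 < p) {l mm : ℝ} (hl : 0 < l) (hm : 0 < mm) (hf : 0 < nonlin p h mm)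
    (w : ℝ → ℝ) (S : ℝ) :
    p * mm ^ (p - 1) * dens p h l w (Real.log (scale p h l mm) + S) =
      Real.exp (2 * S) * (nonlin p h (w (Real.log (scale p h l mm) + S)) / nonlin p h mm) := by
  have hg := scale_pos hp hl hm hf
  have h2 := scale_sq hp hl hm hf
  have e : Real.exp (2 * (Real.log (scale p h l mm) + S)) =
      scale p h l mm ^ 2 * Real.exp (2 * S) := by
    rw [mul_add, Real.exp_add, two_mul, Real.exp_add, Real.exp_log hg, sq]
  have h3 : p * mm ^ (p - 1) * l * scale p h l mm ^ 2 = 1 / nonlin p h mm := by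
    rw [eq_div_iff hf.ne', h2]
  unfold dens
  rw [e]
  calc _ = (p * mm ^ (p - 1) * l * scale p h l mm ^ 2) * (Real.exp (2 * S) *
        nonlin p h (w (Real.log (scale p h l mm) + S))) := by ring
    _ = _ := by rw [h3]; ring

theorem phi_exp (v : ℝ → ℝ) (l t : ℝ) :
    phi p h l v (Real.exp t) = p * logHeight v t ^ (p - 1) * dens p h l (logHeight v) t := by
  have e : Real.exp (2 * t) = Real.exp t ^ 2 := by rw [two_mul, Real.exp_add, sq]
  unfold phi dens logHeight
  rw [e]; ring

/-- Relative error of the density at a point of a window. -/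
theorem dens_ratio (hp : 0 < p) {l mm : ℝ} (hl : 0 < l) (hm : 0 < mm) (hf : 0 < nonlin p h mm)
    (w : ℝ → ℝ) (S : ℝ) :
    p * mm ^ (p - 1) * dens p h l w (Real.log (scale p h l mm) + S)
      / Real.exp (2 * S + logProfile a b S) =
    nonlin p h (w (Real.log (scale p h l mm) + S)) / nonlin p h mm
      * Real.exp (-logProfile a b S) := by
  rw [mul_dens_eq hp hl hm hf, Real.exp_add, Real.exp_neg]
  field_simp

theorem phi_ratio (hp : 0 < p) {l mm : ℝ} (hl : 0 < l) (hm : 0 < mm) (hf : 0 < nonlin p h mm)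
    (v : ℝ → ℝ) (S : ℝ) (hv : 0 < logHeight v (Real.log (scale p h l mm) + S)) :
    phi p h l v (Real.exp (Real.log (scale p h l mm) + S))
      / Real.exp (2 * S + logProfile a b S) =
    (logHeight v (Real.log (scale p h l mm) + S) / mm) ^ (p - 1) *
    (nonlin p h (logHeight v (Real.log (scale p h l mm) + S)) / nonlin p h mm
      * Real.exp (-logProfile a b S)) := by
  have := Real.rpow_pos_of_pos hm (p - 1)
  rw [← dens_ratio hp hl hm hf (a := a) (b := b), phi_exp, Real.div_rpow hv.le hm.le]
  field_simp

namespace BubbleRadii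

theorem tendsto_dens_ratio (hp : 0 < p) (hH0 : StandingH h) (hH1 : GrowthH p h)
    (hs : ∀ n, LogSol p h (lam n) (mu n) (W n) (Q n))
    (hN : BubbleRadii p h lam mu m W Q a b N) {S : ℕ → ℝ}
    (hS : ∀ᶠ n in atTop, S n ∈ Icc (-(N n : ℝ)) (N n)) :
    Tendsto (fun n => p * m n ^ (p - 1) *
      dens p h (lam n) (W n) (Real.log (scale p h (lam n) (m n)) + S n)
      / Real.exp (2 * S n + logProfile a b (S n))) atTop (𝓝 1) := by
  obtain ⟨T, hT, hmon⟩ := exists_nonlin_le hp hH0 hH1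
  rw [tendsto_iff_dist_tendsto_zero]
  refine squeeze_zero' (Eventually.of_forall fun n => dist_nonneg) ?_ hN.tendsto_tol
  filter_upwards [hS, hN.close, hN.height_atTop.eventually_ge_atTop T] with n c1 c2 c3
  rw [Real.dist_eq, dens_ratio hp (hs n).lam_pos (hT.trans_le c3) (hmon _ c3).1]
  exact (c2 _ c1).ratio

theorem tendsto_phi_ratio (hp : 0 < p) (hH0 : StandingH h) (hH1 : GrowthH p h) {u : ℕ → ℝ → ℝ}
    (hs : ∀ n, LogSol p h (lam n) (mu n) (logHeight (u n)) (Q n))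
    (hN : BubbleRadii p h lam mu m (fun n => logHeight (u n)) Q a b N) {S : ℕ → ℝ}
    (hS : ∀ᶠ n in atTop, S n ∈ Icc (-(N n : ℝ)) (N n)) :
    Tendsto (fun n => phi p h (lam n) (u n) (Real.exp (Real.log (scale p h (lam n) (m n)) + S n))
      / Real.exp (2 * S n + logProfile a b (S n))) atTop (𝓝 1) := by
  obtain ⟨T, hT, hmon⟩ := exists_nonlin_le hp hH0 hH1
  have h1 : Tendsto (fun n => (logHeight (u n)
      (Real.log (scale p h (lam n) (m n)) + S n) / m n) ^ (p - 1)) atTop (𝓝 1) := by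
    rw [tendsto_iff_dist_tendsto_zero]
    refine squeeze_zero' (Eventually.of_forall fun n => dist_nonneg) ?_ hN.tendsto_tol
    filter_upwards [hS, hN.close] with n c1 c2 using (c2 _ c1).height
  have h2 := h1.mul (hN.tendsto_dens_ratio hp hH0 hH1 hs hS)
  rw [one_mul] at h2
  refine h2.congr' ?_
  filter_upwards [hS, hN.room, hN.height_atTop.eventually_ge_atTop T] with n c1 c2 c3
  have hNn : (0 : ℝ) ≤ N n := Nat.cast_nonneg _
  rw [dens_ratio hp (hs n).lam_pos (hT.trans_le c3) (hmon _ c3).1,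
    phi_ratio hp (hs n).lam_pos (hT.trans_le c3) (hmon _ c3).1]
  exact (hs n).pos _ (by linarith [c1.2])

/-- The logarithm of the equation defining the scale gives `log λ + 2 log γ = -log f(m)` up to `O(1
+ log m)`, and `log f(m)` is asymptotic to `m^p`. Shifts by at most `N` are negligible since `N =
o(μ^p)`. -/
theorem tendsto_log_lam (hp : 0 < p) (hH0 : StandingH h) (hH1 : GrowthH p h)
    (hs : ∀ n, LogSol p h (lam n) (mu n) (W n) (Q n)) (hmu : Tendsto mu atTop atTop)
    (hδ : 0 < δ) (hm : Tendsto (fun n => m n / mu n) atTop (𝓝 δ))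
    (hN : BubbleRadii p h lam mu m W Q a b N) {S : ℕ → ℝ}
    (hS : ∀ᶠ n in atTop, S n ∈ Icc (-(N n : ℝ)) (N n)) :
    Tendsto (fun n => (Real.log (lam n) + 2 * (Real.log (scale p h (lam n) (m n)) + S n))
      / mu n ^ p) atTop (𝓝 (-δ ^ p)) := by
  obtain ⟨T, hT, hmon⟩ := exists_nonlin_le hp hH0 hH1
  have hSz : Tendsto (fun n => S n / mu n ^ p) atTop (𝓝 0) := by
    refine (tendsto_zero_iff_abs_tendsto_zero _).2 ?_
    refine squeeze_zero' (Eventually.of_forall fun n => abs_nonneg _) ?_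
      (hN.tendsto_N_div hp hmu)
    filter_upwards [hS, (tendsto_rpow_of_atTop hp hmu).eventually_gt_atTop 0] with n c1 c2
    simp only [Function.comp]
    rw [abs_div, abs_of_pos c2]
    have : |S n| ≤ N n + 1 := (abs_le.2 c1).trans (by linarith)
    gcongr
  have h1 := ((((tendsto_div_rpow hp hmu (-Real.log p)).sub
    ((tendsto_log_height_div hp hmu hδ hm).const_mul (p - 1))).sub
    (tendsto_log_nonlin_height_div hp hH0 hH1 hmu hδ hm)).add (hSz.const_mul 2))
  simp only [mul_zero, sub_zero, zero_sub, add_zero] at h1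
  refine h1.congr' ?_
  filter_upwards [hN.height_atTop.eventually_ge_atTop T] with n h3
  have hm0 := hT.trans_le h3
  have hf := (hmon _ h3).1
  have hl := (hs n).lam_pos
  have hg := scale_pos hp hl hm0 hf
  have hmp := Real.rpow_pos_of_pos hm0 (p - 1)
  have e := congrArg Real.log (scale_sq hp hl hm0 hf)
  rw [Real.log_one, Real.log_mul (by positivity) hf.ne', Real.log_mul (by positivity)
    (by positivity), Real.log_mul (by positivity) hl.ne', Real.log_mul hp.ne' hmp.ne',
    Real.log_rpow hm0, Real.log_pow] at e
  push_cast at e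
  rw [show Real.log (lam n) + 2 * (Real.log (scale p h (lam n) (m n)) + S n) =
    -Real.log p - (p - 1) * Real.log (m n) - Real.log (nonlin p h (m n)) + 2 * S n by linarith]
  ring

/-- The state of the solutions after a bubble. -/
theorem neckState (hp : 0 < p) (hH0 : StandingH h) (hH1 : GrowthH p h)
    (hs : ∀ n, LogSol p h (lam n) (mu n) (W n) (Q n)) (hmu : Tendsto mu atTop atTop)
    (ha : 0 < a) (hb : 0 < b)
    (hδ : 0 < δ) (hm : Tendsto (fun n => m n / mu n) atTop (𝓝 δ))
    (hN : BubbleRadii p h lam mu m W Q a b N) {e : ℕ → ℝ} (hneg : ∀ n, e n < 0)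
    (he : ∀ᶠ n in atTop, Real.log (scale p h (lam n) (m n)) + N n = e n) :
    NeckState p h lam mu W Q δ (2 + a) e := by
  obtain ⟨T, hT, hmon⟩ := exists_nonlin_le hp hH0 hH1
  have hS : ∀ᶠ n in atTop, (N n : ℝ) ∈ Icc (-(N n : ℝ)) (N n) :=
    Eventually.of_forall fun n => ⟨by linarith [(Nat.cast_nonneg (N n) : (0 : ℝ) ≤ N n)], le_rfl⟩
  have htop : Tendsto (fun n => (N n : ℝ)) atTop atTop :=
    tendsto_natCast_atTop_atTop.comp hN.N_atTop
  have c1 := hN.tendsto_height hp hmu hδ hb hm hS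
  have c2 := hN.tendsto_slope hmu hδ hm hS ((tendsto_logProfile'_atTop ha hb).comp htop)
  have c3 := hN.tendsto_log_lam hp hH0 hH1 hs hmu hδ hm hS
  have c4 := (((hN.tendsto_dens_ratio hp hH0 hH1 hs hS).mul
    ((tendsto_exp_logProfile_atTop ha hb).comp htop)).div_const p).div
    (tendsto_height_rpow_div (p := p - 1) hmu hδ hm) (Real.rpow_pos_of_pos hδ _).ne'
  rw [mul_zero, zero_div, zero_div] at c4
  refine ⟨hneg, c1.congr' ?_, c2.congr' ?_, c4.congr' ?_, c3.congr' ?_⟩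
  · filter_upwards [he] with n hn; rw [hn]
  · filter_upwards [he] with n hn; rw [hn]
  · filter_upwards [he, hmu.eventually_gt_atTop 0, hN.height_atTop.eventually_gt_atTop 0]
      with n hn h1 h2
    have := Real.rpow_pos_of_pos h1 (p - 1)
    have := Real.rpow_pos_of_pos h2 (p - 1)
    have := Real.exp_pos (2 * N n + logProfile a b (N n))
    simp only [Pi.div_apply, Function.comp, hn]
    field_simp
  · filter_upwards [he] with n hn; rw [hn]

end BubbleRadii

end Radii

/-! ### The next bubble -/

section Identity

variable {p : ℝ} {h : ℝ → ℝ} {lam mu : ℝ} {W Q : ℝ → ℝ}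

/-- The logarithmic derivative of the density. -/
theorem LogSol.hasDerivAt_dens (hs : LogSol p h lam mu W Q) {T : ℝ} {d : ℝ → ℝ}
    (hd : ∀ t, T ≤ t → 0 < nonlin p h t ∧ HasDerivAt (fun t => Real.log (nonlin p h t)) (d t) t)
    {t : ℝ} (ht : t < 0) (hT : T < W t) :
    HasDerivAt (dens p h lam W) (dens p h lam W t * (2 - d (W t) * Q t)) t := by
  have hn : HasDerivAt (nonlin p h) (nonlin p h (W t) * d (W t)) (W t) := by
    obtain ⟨h1, h2⟩ := hd _ hT.le
    have h3 := h2.exp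
    rw [Real.exp_log h1] at h3
    refine h3.congr_of_eventuallyEq ?_
    filter_upwards [Ioi_mem_nhds hT] with z hz
    exact (Real.exp_log (hd z (le_of_lt hz)).1).symm
  have h1 : HasDerivAt (fun t => lam * Real.exp (2 * t)) (lam * (Real.exp (2 * t) * 2)) t := by
    have := (((hasDerivAt_id t).const_mul 2).exp).const_mul lam
    simpa using this
  refine (h1.mul (hn.comp t (hs.deriv_W t ht))).congr_deriv ?_
  simp only [dens, Function.comp_apply]
  ring

/-- One half of the approximate conservation law inside a bubble. -/
theorem LogSol.conservation_ge (hp : 1 ≤ p) (hH0 : StandingH h) (hs : LogSol p h lam mu W Q)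
    {T ε k : ℝ} (hε : 0 < ε) {d : ℝ → ℝ}
    (hd : ∀ t, T ≤ t → 0 < nonlin p h t ∧
      HasDerivAt (fun t => Real.log (nonlin p h t)) (d t) t ∧
      (1 - ε) * (p * t ^ (p - 1)) ≤ d t ∧ d t ≤ (1 + ε) * (p * t ^ (p - 1)))
    {s t : ℝ} (hst : s ≤ t) (ht : t < 0) (hT : T < W t)
    (hk : (1 + ε) * (p * W s ^ (p - 1)) ≤ k) :
    dens p h lam W s - 2 * Q s + k * Q s ^ 2 / 2 ≤ dens p h lam W t - 2 * Q t + k * Q t ^ 2 / 2 := by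
  -- The density has logarithmic derivative `2 - (log f)'(W) Q`. All terms cancel except `dens · Q ·
  -- (k - (log f)'(W))`, whose sign is that of the last factor. The height only decreases, so for `p
  -- ≥ 1` it suffices to compare `k` with its value at one end.
  have hder : ∀ z ∈ Icc s t, HasDerivAt
      (fun z => dens p h lam W z - 2 * Q z + k * Q z ^ 2 / 2)
      (dens p h lam W z * Q z * (k - d (W z))) z := fun z hz => by
    have hz0 := hz.2.trans_lt ht
    have h1 := hs.hasDerivAt_dens (fun t ht => ⟨(hd t ht).1, (hd t ht).2.1⟩) hz0
      (hT.trans_le (hs.W_anti hz.2 ht))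
    have h2 := hs.hasDerivAt_Q hz0
    refine ((h1.sub (h2.const_mul 2)).add (((h2.pow 2).const_mul k).div_const 2)).congr_deriv ?_
    norm_num
    ring
  have := sub_le_sub_of_hasDerivAt_le (f := fun _ => 0) (f' := fun _ => 0) hst
    (fun x _ => hasDerivAt_const x 0) hder (fun z hz => by
      have hz0 := hz.2.trans_lt ht
      have h1 := (hd _ (hT.le.trans (hs.W_anti hz.2 ht))).2.2.2
      have h2 : W z ^ (p - 1) ≤ W s ^ (p - 1) :=
        Real.rpow_le_rpow (hs.pos z hz0).le (hs.W_anti hz.1 hz0) (by linarith)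
      have h3 : (1 + ε) * (p * W z ^ (p - 1)) ≤ (1 + ε) * (p * W s ^ (p - 1)) := by gcongr
      exact mul_nonneg (mul_nonneg (hs.dens_nonneg hH0 hz0) (hs.Q_nonneg z hz0)) (by linarith))
  linarith

/-- The other half of the approximate conservation law inside a bubble. -/
theorem LogSol.conservation_le (hp : 1 ≤ p) (hH0 : StandingH h) (hs : LogSol p h lam mu W Q)
    {T ε k : ℝ} (hε : ε < 1) {d : ℝ → ℝ}
    (hd : ∀ t, T ≤ t → 0 < nonlin p h t ∧
      HasDerivAt (fun t => Real.log (nonlin p h t)) (d t) t ∧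
      (1 - ε) * (p * t ^ (p - 1)) ≤ d t ∧ d t ≤ (1 + ε) * (p * t ^ (p - 1)))
    {s t : ℝ} (hst : s ≤ t) (ht : t < 0) (hT : T < W t)
    (hk : k ≤ (1 - ε) * (p * W t ^ (p - 1))) :
    dens p h lam W t - 2 * Q t + k * Q t ^ 2 / 2 ≤ dens p h lam W s - 2 * Q s + k * Q s ^ 2 / 2 := by
  have hder : ∀ z ∈ Icc s t, HasDerivAt
      (fun z => dens p h lam W z - 2 * Q z + k * Q z ^ 2 / 2)
      (dens p h lam W z * Q z * (k - d (W z))) z := fun z hz => by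
    have hz0 := hz.2.trans_lt ht
    have h1 := hs.hasDerivAt_dens (fun t ht => ⟨(hd t ht).1, (hd t ht).2.1⟩) hz0
      (hT.trans_le (hs.W_anti hz.2 ht))
    have h2 := hs.hasDerivAt_Q hz0
    refine ((h1.sub (h2.const_mul 2)).add (((h2.pow 2).const_mul k).div_const 2)).congr_deriv ?_
    norm_num
    ring
  have := sub_le_sub_of_hasDerivAt_le (g := fun _ => 0) (g' := fun _ => 0) hst
    hder (fun x _ => hasDerivAt_const x 0) (fun z hz => by
      have hz0 := hz.2.trans_lt ht
      have h1 := (hd _ (hT.le.trans (hs.W_anti hz.2 ht))).2.2.1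
      have h2 : W t ^ (p - 1) ≤ W z ^ (p - 1) :=
        Real.rpow_le_rpow (hs.pos t ht).le (hs.W_anti hz.2 ht) (by linarith)
      have h3 : (1 - ε) * (p * W t ^ (p - 1)) ≤ (1 - ε) * (p * W z ^ (p - 1)) := by
        have : 0 ≤ 1 - ε := by linarith
        gcongr
      exact mul_nonpos_of_nonneg_of_nonpos
        (mul_nonneg (hs.dens_nonneg hH0 hz0) (hs.Q_nonneg z hz0)) (by linarith))
  linarith

/-- Growth of the density while the flux is small. -/
theorem LogSol.log_dens_ge (hp : 1 ≤ p) (hs : LogSol p h lam mu W Q) {T ε q k : ℝ} (hε : 0 < ε)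
    (hlog : ∀ s t, T ≤ s → s ≤ t → 0 < nonlin p h s ∧
      (1 - ε) * (t ^ p - s ^ p) ≤ Real.log (nonlin p h t) - Real.log (nonlin p h s) ∧
      Real.log (nonlin p h t) - Real.log (nonlin p h s) ≤ (1 + ε) * (t ^ p - s ^ p))
    {s t : ℝ} (hst : s ≤ t) (ht : t < 0) (hT : T ≤ W t) (hq : Q t ≤ q)
    (hk : p * W s ^ (p - 1) * q ≤ k) :
    0 < dens p h lam W t ∧ Real.log (dens p h lam W s) + (2 - (1 + ε) * k) * (t - s) ≤
      Real.log (dens p h lam W t) := by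
  have hs0 := hst.trans_lt ht
  have hWts := hs.W_anti hst ht
  obtain ⟨hft, -, hF⟩ := hlog _ _ hT hWts
  have hfs := (hlog _ _ (hT.trans hWts) le_rfl).1
  have hl := hs.lam_pos
  have hp0 : 0 < p := by linarith
  have hlogd : ∀ z, 0 < nonlin p h (W z) → Real.log (dens p h lam W z) =
      Real.log lam + 2 * z + Real.log (nonlin p h (W z)) := fun z hz => by
    unfold dens
    rw [Real.log_mul (by positivity) hz.ne', Real.log_mul hl.ne' (Real.exp_pos _).ne',
      Real.log_exp]
  -- While the flux is at most `q`, the power `W^p` falls at rate at most `k`; what remains of the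
  -- growth `2t` is growth of the density.
  have hpow := sub_le_sub_of_hasDerivAt_le (f := fun z => -k * z) (g := fun z => W z ^ p)
    (g' := fun z => p * W z ^ (p - 1) * (-Q z)) hst
    (fun v _ => by simpa using (hasDerivAt_id v).const_mul (-k))
    (fun v hv => (hasDerivAt_rpow_pos p (hs.pos v (hv.2.trans_lt ht))).comp v
      (hs.deriv_W v (hv.2.trans_lt ht)))
    (fun v hv => by
      have hv0 := hv.2.trans_lt ht
      have b1 : W v ^ (p - 1) ≤ W s ^ (p - 1) :=
        Real.rpow_le_rpow (hs.pos v hv0).le (hs.W_anti hv.1 hv0) (by linarith)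
      have b2 : Q v ≤ q := (hs.Q_mono _ _ hv.2 ht).trans hq
      have b3 : p * W v ^ (p - 1) * Q v ≤ p * W s ^ (p - 1) * q := by
        have := hs.Q_nonneg v hv0
        have := Real.rpow_nonneg (hs.pos s hs0).le (p - 1)
        gcongr
      linarith)
  have h6 : (1 + ε) * (W s ^ p - W t ^ p) ≤ (1 + ε) * (k * (t - s)) := by
    have : W s ^ p - W t ^ p ≤ k * (t - s) := by linarith
    gcongr
  refine ⟨by unfold dens; positivity, ?_⟩
  rw [hlogd s hfs, hlogd t hft]
  linarith

end Identity

/-- Convexity estimate behind the exponential decay along a neck that ends at relative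
height `θ`. -/
theorem exists_neck_gap {p A θ q : ℝ} (hp : 1 < p) (hθ : 0 < θ) (hθq : θ < q) (hq : q < 1)
    (hroot : 1 - θ ^ p = 2 * p / A * (1 - θ)) :
    ∃ c : ℝ, 0 < c ∧ ∀ y, 0 ≤ y → y ≤ 1 - q → (2 * p / A + c) * y ≤ 1 - (1 - y) ^ p := by
  have hsc := strictConvexOn_rpow hp
  have h1 := hsc.slope_strict_mono_adjacent (x := θ) (y := q) (z := 1)
    (mem_Ici.2 hθ.le) (mem_Ici.2 zero_le_one) hθq hq
  rw [Real.one_rpow, div_lt_div_iff₀ (by linarith) (by linarith)] at h1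
  have h2 : 2 * p / A * (1 - q) < 1 - q ^ p := by
    have h3 : 2 * p / A * (1 - q) * (1 - θ) < (1 - q ^ p) * (1 - θ) := by
      have : 2 * p / A * (1 - q) * (1 - θ) = (1 - θ ^ p) * (1 - q) := by rw [hroot]; ring
      rw [this]; nlinarith
    exact lt_of_mul_lt_mul_right h3 (by linarith)
  have hq1 : 0 < 1 - q := by linarith
  -- The slope of the chord of `t^p` over `[θ, 1]` is `2p/A`, and the chord over `[q, 1]` is
  -- strictly steeper. The excess is the gap, and convexity transfers it to all points between `q`
  -- and `1`.
  refine ⟨(1 - q ^ p) / (1 - q) - 2 * p / A, ?_, fun y hy0 hyq => ?_⟩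
  · rw [sub_pos, lt_div_iff₀ hq1]; exact h2
  · have ha : 0 ≤ y / (1 - q) := by positivity
    have hb : 0 ≤ 1 - y / (1 - q) := by rw [sub_nonneg, div_le_one hq1]; exact hyq
    have hconv := hsc.convexOn.2 (mem_Ici.2 (hθ.trans hθq).le) (mem_Ici.2 (zero_le_one' ℝ))
      ha hb (by ring)
    simp only [smul_eq_mul, Real.one_rpow, mul_one] at hconv
    have e : y / (1 - q) * q + (1 - y / (1 - q)) = 1 - y := by field_simp; ring
    rw [e] at hconv
    have e2 : (2 * p / A + ((1 - q ^ p) / (1 - q) - 2 * p / A)) * y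
        = 1 - (y / (1 - q) * q ^ p + (1 - y / (1 - q))) := by field_simp; ring
    rw [e2]; linarith

/-! ### Approaching the height of the next bubble -/

section Entrance

variable {p : ℝ} {h : ℝ → ℝ} {lam mu : ℕ → ℝ} {W Q : ℕ → ℝ → ℝ}

/-- The neck before the next bubble: the state at a height slightly above that of the bubble. -/
theorem NeckState.exists_time (hp : 1 < p) (hH0 : StandingH h) (hH1 : GrowthH p h)
    (hs : ∀ n, LogSol p h (lam n) (mu n) (W n) (Q n)) (hmu : Tendsto mu atTop atTop)
    {x A y κ : ℝ} (hA : 0 < A) (hy : 0 < y) (hκ : 0 < κ) (hκx : y + κ < x)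
    (hroot : 1 - (y / x) ^ p = 2 * p / A * (1 - y / x))
    {e : ℕ → ℝ} (he : NeckState p h lam mu W Q x A e) :
    ∃ t : ℕ → ℝ, (∀ᶠ n in atTop, e n ≤ t n ∧ t n < 0 ∧ W n (t n) = (y + κ) * mu n) ∧
      Tendsto (fun n => p * mu n ^ (p - 1) * Q n (t n)) atTop (𝓝 (A / x ^ (p - 1))) ∧
      Tendsto (fun n => mu n ^ (p - 1) * dens p h (lam n) (W n) (t n)) atTop (𝓝 0) ∧
      Tendsto (fun n => (Real.log (lam n) + 2 * t n) / mu n ^ p) atTop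
        (𝓝 (-x ^ p + 2 * (p * x ^ (p - 1) * (x - (y + κ)) / A))) := by
  have hp0 : 0 < p := by linarith
  have hx : 0 < x := by linarith
  have hex : ∀ᶠ n in atTop, ∃ t, e n ≤ t ∧ t < 0 ∧ W n t = (y + κ) * mu n := by
    filter_upwards [he.height.eventually_const_lt hκx, hmu.eventually_gt_atTop 0] with n h1 h2
    rw [lt_div_iff₀ h2] at h1
    exact (hs n).exists_W_eq (he.neg n) (by positivity) h1.le
  obtain ⟨t, ht⟩ := hex.choice
  -- The neck estimate is used down to relative height `(y + κ/2)/x`. The spare `κ/2` compensates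
  -- for the height at `e n` being `x μ` only asymptotically.
  have hyx : y / x < (y + κ / 2) / x := by gcongr; linarith
  have hq1 : (y + κ / 2) / x < 1 := by rw [div_lt_one hx]; linarith
  obtain ⟨c, hc, hY⟩ := exists_neck_gap hp (div_pos hy hx) hyx hq1 hroot
  obtain ⟨T, hT, hflux⟩ := he.exists_flux_le hp0 hH0 hH1 hs hmu hx hA hc hY
  have hW : Tendsto (fun n => W n (t n) / mu n) atTop (𝓝 (y + κ)) := by
    refine tendsto_const_nhds.congr' ?_
    filter_upwards [ht, hmu.eventually_gt_atTop 0] with n h1 h2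
    rw [h1.2.2]; field_simp
  have hgood : ∀ η : ℝ, 0 < η → ∀ᶠ n in atTop,
      mu n ^ (p - 1) * dens p h (lam n) (W n) (t n) ≤ η ∧
      |p * mu n ^ (p - 1) * Q n (t n) - A / x ^ (p - 1)| ≤ η := fun η hη => by
    have h5 : (y + κ / 2) / x * x < y + κ := by
      rw [div_mul_cancel₀ _ hx.ne']; linarith
    filter_upwards [hflux η hη, ht, (tendsto_height_atTop hmu (by linarith) hW).eventually_ge_atTop T,
      (he.height.const_mul ((y + κ / 2) / x)).eventually_lt_const h5, hmu.eventually_gt_atTop 0]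
      with n h1 h2 h3 h4 h6
    refine h1 (t n) h2.1 h2.2.1 h3 ?_
    rw [sub_sub_cancel, h2.2.2]
    have : (y + κ / 2) / x * (W n (e n) / mu n) * mu n = (y + κ / 2) / x * W n (e n) := by
      field_simp
    rw [← this]
    exact mul_le_mul_of_nonneg_right h4.le h6.le
  have hQ : Tendsto (fun n => p * mu n ^ (p - 1) * Q n (t n)) atTop (𝓝 (A / x ^ (p - 1))) := by
    rw [Metric.tendsto_nhds]
    intro η hη
    filter_upwards [hgood (η / 2) (half_pos hη)] with n hn
    rw [Real.dist_eq]; linarith [hn.2]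
  refine ⟨t, ht, hQ, ?_, he.tendsto_log_lam hp0 hs hmu hx hA (ht.mono fun n hn => ⟨hn.1, hn.2.1⟩)
    hW hQ⟩
  rw [Metric.tendsto_nhds]
  intro η hη
  filter_upwards [hgood (η / 2) (half_pos hη), ht, hmu.eventually_gt_atTop 0] with n hn h1 h2
  have := mul_nonneg (Real.rpow_pos_of_pos h2 (p - 1)).le ((hs n).dens_nonneg hH0 h1.2.1)
  rw [Real.dist_eq, sub_zero, abs_of_nonneg this]
  linarith [hn.1]

set_option maxHeartbeats 1000000 in
/-- Beyond the height `y` the flux exceeds every value below the one at the centre of the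
bubble. -/
theorem NeckState.flux_growth (hp : 1 < p) (hH0 : StandingH h) (hH1 : GrowthH p h)
    (hs : ∀ n, LogSol p h (lam n) (mu n) (W n) (Q n)) (hmu : Tendsto mu atTop atTop)
    {x A y a κ' : ℝ} (hA : 0 < A) (hy : 0 < y) (hyx : y < x) (ha : 0 < a) (ha2 : a < 2)
    (hroot : 1 - (y / x) ^ p = 2 * p / A * (1 - y / x))
    {e : ℕ → ℝ} (he : NeckState p h lam mu W Q x A e) (hκ' : 0 < κ') (hκy : κ' < y) :
    ∀ᶠ n in atTop, ∀ t < 0, W n t = (y - κ') * mu n →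
      2 - a / 2 ≤ p * (y * mu n) ^ (p - 1) * Q n t := by
  have hp0 : 0 < p := by linarith
  have hx : 0 < x := by linarith
  have hxp := Real.rpow_pos_of_pos hx (p - 1)
  have hyp := Real.rpow_pos_of_pos hy (p - 1)
  -- Any value of the normalized flux below `2` lets the density grow. Had the flux not reached `σ`
  -- at height `(y - κ') μ`, the density would have grown at rate at least `a/4` since height `(y +
  -- κ) μ`. For small `κ` it starts at no less than `exp(-C κ μ^p)`, while the time available is a
  -- multiple of `κ' μ^p`. Hence it would exceed `1` on the second half of that time and produce a
  -- flux of order `μ^p`.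
  set σ := 2 - a / 2 with hσ
  have hσ0 : 0 < σ := by linarith
  set C := 2 * (p * x ^ (p - 1) / A) + 1 with hC
  have hC0 : 0 < C := by positivity
  -- choice of the height above `y` at which the comparison starts
  obtain ⟨κ, hκ0, hκx, hκ1, hκ2⟩ : ∃ κ : ℝ, 0 < κ ∧ y + κ < x ∧
      (1 + κ) * (σ * ((y + κ) / y) ^ (p - 1)) < 2 - a / 4 ∧
      C * κ < a / 16 * (κ' * (p * y ^ (p - 1))) := by
    have c1 : Tendsto (fun κ : ℝ => y + κ) (𝓝[>] 0) (𝓝 y) := by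
      have : Tendsto (fun κ : ℝ => y + κ) (𝓝[>] 0) (𝓝 (y + 0)) :=
        (tendsto_nhdsWithin_of_tendsto_nhds tendsto_id).const_add y
      rwa [add_zero] at this
    have c2 : Tendsto (fun κ : ℝ => (1 + κ) * (σ * ((y + κ) / y) ^ (p - 1))) (𝓝[>] 0) (𝓝 σ) := by
      have h1 : Tendsto (fun κ : ℝ => 1 + κ) (𝓝[>] 0) (𝓝 (1 + 0)) :=
        (tendsto_nhdsWithin_of_tendsto_nhds tendsto_id).const_add 1
      have h2 := h1.mul (((c1.div_const y).rpow_const (p := p - 1)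
        (Or.inl (by rw [div_self hy.ne']; exact one_ne_zero))).const_mul σ)
      simpa [div_self hy.ne'] using h2
    have c3 : Tendsto (fun κ : ℝ => C * κ) (𝓝[>] 0) (𝓝 0) := by
      have : Tendsto (fun κ : ℝ => C * κ) (𝓝[>] 0) (𝓝 (C * 0)) :=
        (tendsto_nhdsWithin_of_tendsto_nhds tendsto_id).const_mul C
      rwa [mul_zero] at this
    obtain ⟨κ, h1, h2, h3, h4⟩ := (eventually_mem_nhdsWithin.and
      ((c1.eventually_lt_const hyx).and ((c2.eventually_lt_const
        (show σ < 2 - a / 4 by linarith)).and (c3.eventually_lt_const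
        (show 0 < a / 16 * (κ' * (p * y ^ (p - 1))) by positivity))))).exists
    exact ⟨κ, h1, h2, h3, h4⟩
  obtain ⟨s, hs1, -, -, hs4⟩ := he.exists_time hp hH0 hH1 hs hmu hA hy hκ0 hκx hroot
  obtain ⟨T, hT, hlog⟩ := exists_log_nonlin_sub_bounds hp0 hH0 hH1 hκ0
  have hWs : Tendsto (fun n => W n (s n) / mu n) atTop (𝓝 (y + κ)) := by
    refine tendsto_const_nhds.congr' ?_
    filter_upwards [hs1, hmu.eventually_gt_atTop 0] with n h1 h2
    rw [h1.2.2]; field_simp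
  -- lower bound for the density at the start
  have hyroot : -x ^ p + 2 * (p * x ^ (p - 1) * (x - y) / A) = -y ^ p := by
    rw [Real.div_rpow hy.le hx.le] at hroot
    have hxx : x ^ p = x ^ (p - 1) * x := by rw [← Real.rpow_add_one hx.ne']; ring_nf
    have hxp' := Real.rpow_pos_of_pos hx p
    have h1 : x ^ p * (1 - y ^ p / x ^ p) = x ^ p * (2 * p / A * (1 - y / x)) := by rw [hroot]
    have h2 : x ^ p * (1 - y ^ p / x ^ p) = x ^ p - y ^ p := by field_simp
    have h3 : x ^ p * (2 * p / A * (1 - y / x)) = 2 * (p * x ^ (p - 1) * (x - y) / A) := by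
      rw [hxx]; field_simp
    linarith
  have hdlim := hs4.add (tendsto_log_nonlin_height_div hp0 hH0 hH1 hmu (by positivity) hWs)
  -- By the root equation the exponent vanishes exactly at height `y`; starting higher by `κ` costs
  -- less than `C κ`.
  have hval : -(C * κ) < -x ^ p + 2 * (p * x ^ (p - 1) * (x - (y + κ)) / A) + (y + κ) ^ p := by
    have h1 : y ^ p ≤ (y + κ) ^ p := Real.rpow_le_rpow hy.le (by linarith) hp0.le
    have h2 : 2 * (p * x ^ (p - 1) * (x - (y + κ)) / A)
        = 2 * (p * x ^ (p - 1) * (x - y) / A) - (C - 1) * κ := by rw [hC]; ring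
    rw [h2]; nlinarith
  have hbig : Tendsto (fun n => p * (y * mu n) ^ (p - 1) * (κ' * (p * y ^ (p - 1)) / 4 * mu n ^ p))
      atTop atTop := by
    have h1 := (tendsto_rpow_atTop (show 0 < p - 1 by linarith)).comp
      (hmu.const_mul_atTop hy)
    exact (h1.const_mul_atTop hp0).atTop_mul_atTop₀
      ((tendsto_rpow_of_atTop hp0 hmu).const_mul_atTop (by positivity))
  filter_upwards [hs1, hdlim.eventually_const_lt hval, hmu.eventually_gt_atTop 0,
    (hmu.const_mul_atTop (show 0 < y - κ' by linarith)).eventually_ge_atTop T,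
    hbig.eventually_gt_atTop 2] with n hsn hdn hmu0 hTn hbign
  intro t ht hWt
  by_contra hcon
  push Not at hcon
  set c := p * (y * mu n) ^ (p - 1) with hc
  have hymu : 0 < y * mu n := by positivity
  have hc0 : 0 < c := mul_pos hp0 (Real.rpow_pos_of_pos hymu _)
  obtain ⟨-, hsneg, hWsn⟩ := hsn
  have hst : s n ≤ t := (hs n).le_of_W_lt hsneg (by rw [hWt, hWsn]; nlinarith)
  have hQt : Q n t ≤ σ / c := by rw [le_div_iff₀ hc0]; linarith
  have hmup := Real.rpow_pos_of_pos hmu0 p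
  have hcmu : mu n * c = p * y ^ (p - 1) * mu n ^ p := by
    rw [hc, Real.mul_rpow hy.le hmu0.le,
      show mu n ^ p = mu n ^ (p - 1) * mu n by rw [← Real.rpow_add_one hmu0.ne']; ring_nf]
    ring
  -- the time spent
  have htime : κ' * (p * y ^ (p - 1)) * mu n ^ p / 2 ≤ t - s n := by
    have h1 := (hs n).sub_le hst ht
    rw [hWt, hWsn] at h1
    have h2 : Q n t * (t - s n) ≤ σ / c * (t - s n) :=
      mul_le_mul_of_nonneg_right hQt (by linarith)
    have h3 : κ' * mu n ≤ σ / c * (t - s n) := by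
      have : 0 < κ * mu n := by positivity
      linarith
    have h4 : κ' * mu n * c ≤ σ * (t - s n) := by
      have := mul_le_mul_of_nonneg_right h3 hc0.le
      rwa [mul_right_comm (σ / c), div_mul_cancel₀ _ hc0.ne'] at this
    have h5 : σ * (t - s n) ≤ 2 * (t - s n) := mul_le_mul_of_nonneg_right (by linarith)
      (by linarith)
    rw [mul_assoc κ', hcmu] at h4
    linarith
  -- growth of the density
  have hTs : T ≤ W n (s n) := by rw [hWsn]; nlinarith
  have hfs := (hlog _ _ hTs le_rfl).1
  have hlam := (hs n).lam_pos
  have hd0 : -(C * κ) * mu n ^ p ≤ Real.log (dens p h (lam n) (W n) (s n)) := by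
    rw [← add_div, lt_div_iff₀ hmup] at hdn
    unfold dens
    rw [Real.log_mul (by positivity) hfs.ne', Real.log_mul hlam.ne' (Real.exp_pos _).ne',
      Real.log_exp]
    exact hdn.le
  have hk : p * W n (s n) ^ (p - 1) * (σ / c) ≤ σ * ((y + κ) / y) ^ (p - 1) := by
    have hr : ((y + κ) * mu n) ^ (p - 1) = ((y + κ) / y) ^ (p - 1) * (y * mu n) ^ (p - 1) := by
      rw [← Real.mul_rpow (by positivity) hymu.le]
      congr 1; field_simp
    rw [hWsn, hr, hc]
    have := Real.rpow_pos_of_pos hymu (p - 1)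
    apply le_of_eq
    field_simp
  have hgrow : ∀ z ∈ Icc (s n) t, 0 < dens p h (lam n) (W n) z ∧
      a / 4 * (z - s n) - C * κ * mu n ^ p ≤ Real.log (dens p h (lam n) (W n) z) := fun z hz => by
    have hz0 := hz.2.trans_lt ht
    have hTz : T ≤ W n z := by
      have := (hs n).W_anti hz.2 ht
      rw [hWt] at this; linarith
    obtain ⟨hpos, hlow⟩ := (hs n).log_dens_ge hp.le hκ0 hlog hz.1 hz0 hTz
      (((hs n).Q_mono _ _ hz.2 ht).trans hQt) hk
    refine ⟨hpos, ?_⟩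
    have h7 : a / 4 * (z - s n) ≤ (2 - (1 + κ) * (σ * ((y + κ) / y) ^ (p - 1))) * (z - s n) :=
      mul_le_mul_of_nonneg_right (by linarith) (by linarith [hz.1])
    linarith
  -- contradiction with the size of the flux
  set mid := (s n + t) / 2 with hmid
  have hm1 : s n ≤ mid := by rw [hmid]; linarith
  have hm2 : mid ≤ t := by rw [hmid]; linarith
  have hQmid := sub_le_sub_of_hasDerivAt_le (f := fun z => z) (f' := fun _ => 1) hm2
    (fun z _ => hasDerivAt_id z) (fun z hz => (hs n).hasDerivAt_Q (hz.2.trans_lt ht))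
    (fun z hz => by
      have h1 := hgrow z ⟨hm1.trans hz.1, hz.2⟩
      have h2 : (t - s n) / 2 ≤ z - s n := by
        have := hz.1; rw [hmid] at this; linarith
      have h3 : C * κ * mu n ^ p ≤ a / 16 * (κ' * (p * y ^ (p - 1))) * mu n ^ p :=
        mul_le_mul_of_nonneg_right hκ2.le hmup.le
      have h4 : a / 4 * ((t - s n) / 2) ≤ a / 4 * (z - s n) := by gcongr
      have h5 : a / 4 * (κ' * (p * y ^ (p - 1)) * mu n ^ p / 2 / 2) ≤ a / 4 * ((t - s n) / 2) := by
        gcongr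
      by_contra h6
      push Not at h6
      have h7 := Real.log_neg h1.1 h6
      linarith [h1.2])
  have hQ0 := (hs n).Q_nonneg mid (hm2.trans_lt ht)
  have hQt2 : κ' * (p * y ^ (p - 1)) / 4 * mu n ^ p ≤ Q n t := by
    rw [hmid] at hQmid; linarith
  have := mul_le_mul_of_nonneg_left hQt2 hc0.le
  linarith

end Entrance

/-! ### Conservation law and the centre of the next bubble -/

section Center

variable {p : ℝ} {h : ℝ → ℝ} {lam mu : ℕ → ℝ} {W Q : ℕ → ℝ → ℝ}

/-- Two-sided approximate conservation law starting from the neck, in normalized quantities. -/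
theorem NeckState.exists_conservation (hp : 1 < p) (hH0 : StandingH h) (hH1 : GrowthH p h)
    (hs : ∀ n, LogSol p h (lam n) (mu n) (W n) (Q n)) (hmu : Tendsto mu atTop atTop)
    {x A y a κ : ℝ} (hA : 0 < A) (hy : 0 < y) (hAa : A / x ^ (p - 1) * y ^ (p - 1) = 2 - a)
    (hroot : 1 - (y / x) ^ p = 2 * p / A * (1 - y / x))
    {e : ℕ → ℝ} (he : NeckState p h lam mu W Q x A e) (hκ : 0 < κ) (hκx : y + κ < x)
    (hκy : κ < y) (hκ1 : κ < 1) :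
    ∃ s B d : ℕ → ℝ, (∀ᶠ n in atTop, e n ≤ s n ∧ s n < 0 ∧ W n (s n) = (y + κ) * mu n ∧
        p * (y * mu n) ^ (p - 1) * Q n (s n) = B n) ∧
      Tendsto B atTop (𝓝 (2 - a)) ∧ Tendsto d atTop (𝓝 0) ∧
      (∀ κ' < y, ∀ᶠ n in atTop, ∀ t, s n ≤ t → t < 0 → (y - κ') * mu n ≤ W n t →
        d n + 2 * (p * (y * mu n) ^ (p - 1) * Q n t - B n)
          - (1 + κ) * ((y + κ) / y) ^ (p - 1) / 2 *
            ((p * (y * mu n) ^ (p - 1) * Q n t) ^ 2 - B n ^ 2)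
          ≤ p * (y * mu n) ^ (p - 1) * dens p h (lam n) (W n) t) ∧
      (∀ᶠ n in atTop, ∀ t, s n ≤ t → t < 0 → (y - κ) * mu n ≤ W n t →
        p * (y * mu n) ^ (p - 1) * dens p h (lam n) (W n) t ≤
        d n + 2 * (p * (y * mu n) ^ (p - 1) * Q n t - B n)
          - (1 - κ) * ((y - κ) / y) ^ (p - 1) / 2 *
            ((p * (y * mu n) ^ (p - 1) * Q n t) ^ 2 - B n ^ 2)) := by
  have hp0 : 0 < p := by linarith
  obtain ⟨s, hs1, hs2, hs3, -⟩ := he.exists_time hp hH0 hH1 hs hmu hA hy hκ hκx hroot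
  obtain ⟨T, hT, D, hD⟩ := exists_hasDerivAt_log_nonlin hp0 hH0 hH1 hκ
  have hcmu : ∀ᶠ n in atTop, ∀ z : ℝ, p * (y * mu n) ^ (p - 1) * z =
      y ^ (p - 1) * (p * mu n ^ (p - 1) * z) := by
    filter_upwards [hmu.eventually_gt_atTop 0] with n hn z
    rw [Real.mul_rpow hy.le hn.le]; ring
  have hscale : ∀ᶠ n in atTop, ∀ r : ℝ, 0 < r →
      (r * mu n) ^ (p - 1) = (r / y) ^ (p - 1) * (y * mu n) ^ (p - 1) := by
    filter_upwards [hmu.eventually_gt_atTop 0] with n hn r hr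
    rw [← Real.mul_rpow (by positivity) (by positivity)]
    congr 1; field_simp
  refine ⟨s, fun n => p * (y * mu n) ^ (p - 1) * Q n (s n),
    fun n => p * (y * mu n) ^ (p - 1) * dens p h (lam n) (W n) (s n),
    hs1.mono fun n hn => ⟨hn.1, hn.2.1, hn.2.2, rfl⟩, ?_, ?_, fun κ' hκ' => ?_, ?_⟩
  · have := hs2.const_mul (y ^ (p - 1))
    rw [mul_comm, hAa] at this
    refine this.congr' ?_
    filter_upwards [hcmu] with n hn using (hn _).symm
  · have := hs3.const_mul (y ^ (p - 1) * p)
    rw [mul_zero] at this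
    refine this.congr' ?_
    filter_upwards [hcmu] with n hn
    rw [hn]; ring
  -- The lower bound compares the constant with the height at the start, so the solution may descend
  -- to any `(y - κ') μ`. The upper bound compares it with the height at the end, hence the floor `y
  -- - κ` there.
  · filter_upwards [hs1, (hmu.const_mul_atTop (show 0 < y - κ' by linarith)).eventually_gt_atTop T,
      hmu.eventually_gt_atTop 0, hscale] with n h1 h2 h3 h4 t hst ht hW
    have hc : 0 < p * (y * mu n) ^ (p - 1) := by positivity
    have hcons := (hs n).conservation_ge hp.le hH0 hκ hD hst ht (h2.trans_le hW)
      (k := (1 + κ) * ((y + κ) / y) ^ (p - 1) * (p * (y * mu n) ^ (p - 1)))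
      (by rw [h1.2.2, h4 _ (by positivity)]; apply le_of_eq; ring)
    have := mul_le_mul_of_nonneg_left hcons hc.le
    linarith
  · filter_upwards [hs1, (hmu.const_mul_atTop (show 0 < y - κ by linarith)).eventually_gt_atTop T,
      hmu.eventually_gt_atTop 0, hscale] with n h1 h2 h3 h4 t hst ht hW
    have hc : 0 < p * (y * mu n) ^ (p - 1) := by positivity
    have hyκ : 0 < y - κ := by linarith
    have hcons := (hs n).conservation_le hp.le hH0 hκ1 hD hst ht (h2.trans_le hW)
      (k := (1 - κ) * ((y - κ) / y) ^ (p - 1) * (p * (y * mu n) ^ (p - 1)))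
      (by
        have h5 : ((y - κ) * mu n) ^ (p - 1) ≤ W n t ^ (p - 1) :=
          Real.rpow_le_rpow (by positivity) hW (by linarith)
        rw [h4 _ hyκ] at h5
        have h6 : 0 ≤ 1 - κ := by linarith
        calc (1 - κ) * ((y - κ) / y) ^ (p - 1) * (p * (y * mu n) ^ (p - 1))
            = (1 - κ) * (p * (((y - κ) / y) ^ (p - 1) * (y * mu n) ^ (p - 1))) := by ring
          _ ≤ _ := by gcongr)
    have := mul_le_mul_of_nonneg_left hcons hc.le
    linarith

/-- The signs `σ = 1` and `σ = -1` cover the constants of the lower and the upper conservation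
inequality at once. -/
theorem tendsto_conservation_factor {y r : ℝ} (hy : 0 < y) (σ : ℝ) :
    Tendsto (fun κ : ℝ => (1 + σ * κ) * ((y + σ * κ) / y) ^ r) (𝓝[>] 0) (𝓝 1) := by
  have h0 : Tendsto (fun κ : ℝ => σ * κ) (𝓝[>] 0) (𝓝 (σ * 0)) :=
    (tendsto_nhdsWithin_of_tendsto_nhds tendsto_id).const_mul σ
  rw [mul_zero] at h0
  have h1 := (h0.const_add 1).mul (((h0.const_add y).div_const y).rpow_const (p := r)
    (Or.inl (by simp [hy.ne'])))
  simpa [hy.ne'] using h1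

/-- The flux passes the value that marks the centre of the next bubble. -/
theorem NeckState.flux_passes (hp : 1 < p) (hH0 : StandingH h) (hH1 : GrowthH p h)
    (hs : ∀ n, LogSol p h (lam n) (mu n) (W n) (Q n)) (hmu : Tendsto mu atTop atTop)
    {x A y a κ' : ℝ} (hA : 0 < A) (hy : 0 < y) (hyx : y < x) (ha : 0 < a) (ha2 : a < 2)
    (hAa : A / x ^ (p - 1) * y ^ (p - 1) = 2 - a)
    (hroot : 1 - (y / x) ^ p = 2 * p / A * (1 - y / x))
    {e : ℕ → ℝ} (he : NeckState p h lam mu W Q x A e) (hκ' : 0 < κ') (hκy : κ' < y) :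
    ∀ᶠ n in atTop, ∀ t < 0, W n t = (y - κ') * mu n →
      2 < p * (y * mu n) ^ (p - 1) * Q n t := by
  have hp0 : 0 < p := by linarith
  have hyp := Real.rpow_pos_of_pos hy (p - 1)
  obtain ⟨κ, hκ0, hκx, hκy', hκ1, hK⟩ : ∃ κ : ℝ, 0 < κ ∧ κ < x - y ∧ κ < y ∧ κ < 1 ∧
      (1 + 1 * κ) * ((y + 1 * κ) / y) ^ (p - 1) < 1 + a ^ 2 / 32 := by
    have c1 : Tendsto (fun κ : ℝ => κ) (𝓝[>] 0) (𝓝 0) :=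
      tendsto_nhdsWithin_of_tendsto_nhds tendsto_id
    obtain ⟨κ, h1, h2, h3, h4, h5⟩ := (eventually_mem_nhdsWithin.and
      ((c1.eventually_lt_const (sub_pos.2 hyx)).and ((c1.eventually_lt_const hy).and
      ((c1.eventually_lt_const one_pos).and
      ((tendsto_conservation_factor (r := p - 1) hy 1).eventually_lt_const
        (show (1 : ℝ) < 1 + a ^ 2 / 32 by have := sq_pos_of_pos ha; linarith)))))).exists
    exact ⟨κ, h1, h2, h3, h4, h5⟩
  rw [one_mul] at hK
  obtain ⟨s, B, d, hs1, hB, hd, hlow, -⟩ := he.exists_conservation hp hH0 hH1 hs hmu hA hy hAa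
    hroot hκ0 (by linarith) hκy' hκ1
  have hgrow := he.flux_growth hp hH0 hH1 hs hmu hA hy hyx ha ha2 hroot (half_pos hκ')
    (by linarith)
  have hbig : Tendsto (fun n => a ^ 2 / 16 * κ' * (p * y ^ (p - 1)) * mu n ^ p) atTop atTop :=
    (tendsto_rpow_of_atTop hp0 hmu).const_mul_atTop (by positivity)
  set K := (1 + κ) * ((y + κ) / y) ^ (p - 1) with hKdef
  have hK0 : 0 < K := by positivity
  have hlim : Tendsto (fun n => d n - 2 * B n + K / 2 * B n ^ 2) atTop
      (𝓝 (0 - 2 * (2 - a) + K / 2 * (2 - a) ^ 2)) :=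
    (hd.sub (hB.const_mul 2)).add ((hB.pow 2).const_mul (K / 2))
  -- lower bound for the density once the flux is not small
  have hval : ∀ X : ℝ, 2 - a / 2 ≤ X → X ≤ 2 →
      a ^ 2 / 4 < 0 - 2 * (2 - a) + K / 2 * (2 - a) ^ 2 - a ^ 2 / 32 + 2 * X - K / 2 * X ^ 2 := by
    -- For `K = 1` the expression without the margin `a²/32` equals `(a² - (2 - X)²)/2`, which is at
    -- least `3a²/8` for `X` in `[2 - a/2, 2]`. The deviation of `K` from `1` and the margin cost at
    -- most `3a²/32`.
    intro X h1 h2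
    have h3 : (2 - X) ^ 2 ≤ a ^ 2 / 4 := by nlinarith
    have h4 : X ^ 2 - (2 - a) ^ 2 ≤ 4 := by nlinarith
    have h5 : 0 ≤ X ^ 2 - (2 - a) ^ 2 := by nlinarith
    have h6 : (K - 1) * (X ^ 2 - (2 - a) ^ 2) ≤ a ^ 2 / 32 * 4 := by
      rcases le_total 0 (K - 1) with h7 | h7
      · exact mul_le_mul (by linarith) h4 h5 (by positivity)
      · exact (mul_nonpos_of_nonpos_of_nonneg h7 h5).trans (by positivity)
    have := sq_pos_of_pos ha
    nlinarith
  filter_upwards [hs1, hlow κ' hκy, hgrow, hmu.eventually_gt_atTop 0,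
    hbig.eventually_gt_atTop 2, hlim.eventually_const_lt
      (show 0 - 2 * (2 - a) + K / 2 * (2 - a) ^ 2 - a ^ 2 / 32 <
        0 - 2 * (2 - a) + K / 2 * (2 - a) ^ 2 by have := sq_pos_of_pos ha; linarith)]
    with n hsn hlown hgrown hmu0 hbign hlimn
  intro t ht hWt
  by_contra hcon
  push Not at hcon
  set c := p * (y * mu n) ^ (p - 1) with hc
  have hc0 : 0 < c := by positivity
  have hyκ : 0 < y - κ' := by linarith
  -- From half the descent on, the flux is at least `2 - a/2`, so the density is at least `a²/(4c)`.
  -- The remaining descent `κ' μ/2` takes so long that the normalized flux would gain more than `2`.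
  obtain ⟨t₁, ht1, ht1n, hWt1⟩ := (hs n).exists_W_eq (e := s n) hsn.2.1
    (show 0 < (y - κ' / 2) * mu n from mul_pos (by linarith) hmu0)
    (by rw [hsn.2.2.1]; nlinarith)
  have ht1t : t₁ ≤ t := (hs n).le_of_W_lt ht1n (by rw [hWt, hWt1]; nlinarith)
  have hQ1 := hgrown t₁ ht1n hWt1
  have hdens : ∀ z ∈ Icc t₁ t, a ^ 2 / 4 / c ≤ dens p h (lam n) (W n) z := fun z hz => by
    have hz0 := hz.2.trans_lt ht
    have h1 := hlown z (ht1.trans hz.1) hz0 (hWt ▸ (hs n).W_anti hz.2 ht)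
    have h2 : 2 - a / 2 ≤ c * Q n z :=
      hQ1.trans (mul_le_mul_of_nonneg_left ((hs n).Q_mono _ _ hz.1 hz0) hc0.le)
    have h3 : c * Q n z ≤ 2 :=
      (mul_le_mul_of_nonneg_left ((hs n).Q_mono _ _ hz.2 ht) hc0.le).trans hcon
    have h4 := hval _ h2 h3
    rw [div_le_iff₀ hc0]
    linarith
  have hQ2 := sub_le_sub_of_hasDerivAt_le (f := fun z => a ^ 2 / 4 / c * z) ht1t
    (fun z _ => by simpa using (hasDerivAt_id z).const_mul (a ^ 2 / 4 / c))
    (fun z hz => (hs n).hasDerivAt_Q (hz.2.trans_lt ht)) hdens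
  have htime : κ' / 2 * mu n * c ≤ 2 * (t - t₁) := by
    have h1 := (hs n).sub_le ht1t ht
    rw [hWt, hWt1] at h1
    have h2 : κ' / 2 * mu n ≤ Q n t * (t - t₁) := by linarith
    have h3 := mul_le_mul_of_nonneg_right h2 hc0.le
    have h4 : c * Q n t * (t - t₁) ≤ 2 * (t - t₁) :=
      mul_le_mul_of_nonneg_right hcon (by linarith)
    linarith
  have hcmu : mu n * c = p * y ^ (p - 1) * mu n ^ p := by
    rw [hc, Real.mul_rpow hy.le hmu0.le,
      show mu n ^ p = mu n ^ (p - 1) * mu n by rw [← Real.rpow_add_one hmu0.ne']; ring_nf]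
    ring
  have h5 : a ^ 2 / 4 * (t - t₁) ≤ c * (Q n t - Q n t₁) := by
    have : a ^ 2 / 4 / c * (t - t₁) ≤ Q n t - Q n t₁ := by linarith
    have := mul_le_mul_of_nonneg_left this hc0.le
    refine le_trans (le_of_eq ?_) this
    field_simp
  have h6 : 0 ≤ c * Q n t₁ := mul_nonneg hc0.le ((hs n).Q_nonneg _ ht1n)
  have h7 : a ^ 2 / 4 * (κ' / 2 * mu n * c / 2) ≤ a ^ 2 / 4 * (t - t₁) := by
    have : κ' / 2 * mu n * c / 2 ≤ t - t₁ := by linarith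
    gcongr
  have h8 : a ^ 2 / 4 * (κ' / 2 * mu n * c / 2) = a ^ 2 / 16 * κ' * (p * y ^ (p - 1)) * mu n ^ p := by
    linear_combination (a ^ 2 / 16 * κ') * hcmu
  linarith

/-- The centres of the next bubble. -/
theorem NeckState.exists_center (hp : 1 < p) (hH0 : StandingH h) (hH1 : GrowthH p h)
    (hs : ∀ n, LogSol p h (lam n) (mu n) (W n) (Q n)) (hmu : Tendsto mu atTop atTop)
    {x A y a : ℝ} (hA : 0 < A) (hy : 0 < y) (hyx : y < x) (ha : 0 < a) (ha2 : a < 2)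
    (hAa : A / x ^ (p - 1) * y ^ (p - 1) = 2 - a)
    (hroot : 1 - (y / x) ^ p = 2 * p / A * (1 - y / x))
    {e : ℕ → ℝ} (he : NeckState p h lam mu W Q x A e) :
    ∃ j : ℕ → ℝ, (∀ n, j n < 0) ∧ (∀ᶠ n in atTop, e n ≤ j n) ∧
      Tendsto (fun n => W n (j n) / mu n) atTop (𝓝 y) ∧
      Tendsto (fun n => p * W n (j n) ^ (p - 1) * Q n (j n)) atTop (𝓝 2) ∧
      Tendsto (fun n => p * W n (j n) ^ (p - 1) * dens p h (lam n) (W n) (j n)) atTop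
        (𝓝 (a ^ 2 / 2)) := by
  have hp0 : 0 < p := by linarith
  have hyp := Real.rpow_pos_of_pos hy (p - 1)
  have hpass : ∀ κ' : ℝ, 0 < κ' → κ' < y → ∀ᶠ n in atTop, ∀ t < 0, W n t = (y - κ') * mu n →
      2 < p * (y * mu n) ^ (p - 1) * Q n t := fun κ' h1 h2 =>
    he.flux_passes hp hH0 hH1 hs hmu hA hy hyx ha ha2 hAa hroot h1 h2
  -- The centre is the time at which the normalized flux equals `2`, the slope of every profile at
  -- its centre. The default `-1` keeps `j n` negative for the finitely many `n` without such a
  -- time.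
  have hchoice : ∀ n, ∃ j, j < 0 ∧ ((∃ i < 0, p * (y * mu n) ^ (p - 1) * Q n i = 2) →
      p * (y * mu n) ^ (p - 1) * Q n j = 2) := fun n => by
    by_cases hi : ∃ i < 0, p * (y * mu n) ^ (p - 1) * Q n i = 2
    · obtain ⟨i, h1, h2⟩ := hi
      exact ⟨i, h1, fun _ => h2⟩
    · exact ⟨-1, by norm_num, fun h => absurd h hi⟩
  choose j hj0 hjc using hchoice
  have hexists : ∀ κ' : ℝ, 0 < κ' → κ' < y → ∀ᶠ n in atTop, ∃ t, e n ≤ t ∧ t < 0 ∧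
      W n t = (y - κ') * mu n := fun κ' h1 h2 => by
    filter_upwards [hmu.eventually_gt_atTop 0,
      he.height.eventually_const_lt (show y - κ' < x by linarith)] with n h3 h4
    rw [lt_div_iff₀ h3] at h4
    exact (hs n).exists_W_eq (he.neg n) (mul_pos (by linarith) h3) h4.le
  have hjQ : ∀ᶠ n in atTop, p * (y * mu n) ^ (p - 1) * Q n (j n) = 2 := by
    filter_upwards [hexists (y / 2) (half_pos hy) (half_lt_self hy),
      hpass (y / 2) (half_pos hy) (half_lt_self hy), hmu.eventually_gt_atTop 0] with n h1 h2 h3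
    obtain ⟨t, -, ht, hW⟩ := h1
    have h4 := h2 t ht hW
    have hc : 0 < p * (y * mu n) ^ (p - 1) := by positivity
    obtain ⟨i, hit, hi⟩ := (hs n).exists_Q_eq ht (y := 2 / (p * (y * mu n) ^ (p - 1)))
      (by positivity) (by rw [div_le_iff₀ hc]; linarith)
    exact hjc n ⟨i, hit.trans_lt ht, by rw [hi]; field_simp⟩
  have hlow : ∀ κ' : ℝ, 0 < κ' → κ' < y → ∀ᶠ n in atTop, (y - κ') * mu n ≤ W n (j n) :=
    fun κ' h1 h2 => by
    filter_upwards [hexists κ' h1 h2, hpass κ' h1 h2, hjQ, hmu.eventually_gt_atTop 0]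
      with n h3 h4 h5 h6
    obtain ⟨t, -, ht, hW⟩ := h3
    have hc : 0 < p * (y * mu n) ^ (p - 1) := by positivity
    have h7 := h4 t ht hW
    have h8 : Q n (j n) < Q n t := by
      rw [← h5] at h7
      exact lt_of_mul_lt_mul_left h7 hc.le
    rw [← hW]
    exact (hs n).W_anti ((hs n).le_of_Q_lt (hj0 n) h8) ht
  have hcons : ∀ κ : ℝ, 0 < κ → κ < x - y → κ < y → κ < 1 → ∃ B d : ℕ → ℝ,
      Tendsto B atTop (𝓝 (2 - a)) ∧ Tendsto d atTop (𝓝 0) ∧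
      ∀ᶠ n in atTop, e n ≤ j n ∧ W n (j n) ≤ (y + κ) * mu n ∧
        d n + 2 * (2 - B n) - (1 + κ) * ((y + κ) / y) ^ (p - 1) / 2 * (2 ^ 2 - B n ^ 2)
          ≤ p * (y * mu n) ^ (p - 1) * dens p h (lam n) (W n) (j n) ∧
        p * (y * mu n) ^ (p - 1) * dens p h (lam n) (W n) (j n) ≤
          d n + 2 * (2 - B n) - (1 - κ) * ((y - κ) / y) ^ (p - 1) / 2 * (2 ^ 2 - B n ^ 2) := by
    intro κ hκ0 hκx hκy hκ1
    obtain ⟨s, B, d, hs1, hB, hd, hl, hu⟩ := he.exists_conservation hp hH0 hH1 hs hmu hA hy hAa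
      hroot hκ0 (by linarith) hκy hκ1
    refine ⟨B, d, hB, hd, ?_⟩
    filter_upwards [hs1, hl κ hκy, hu, hjQ, hlow κ hκ0 hκy,
      hB.eventually_lt_const (show 2 - a < 2 by linarith), hmu.eventually_gt_atTop 0]
      with n h1 h2 h3 h4 h5 h6 h7
    have hc : 0 < p * (y * mu n) ^ (p - 1) := by positivity
    have hsj : s n ≤ j n := by
      refine (hs n).le_of_Q_lt h1.2.1 ?_
      rw [← h1.2.2.2, ← h4] at h6
      exact lt_of_mul_lt_mul_left h6 hc.le
    have h8 := h2 (j n) hsj (hj0 n) h5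
    have h9 := h3 (j n) hsj (hj0 n) h5
    rw [h4] at h8 h9
    refine ⟨h1.1.trans hsj, ?_, h8, h9⟩
    rw [← h1.2.2.1]
    exact (hs n).W_anti hsj (hj0 n)
  have c1 : Tendsto (fun κ : ℝ => κ) (𝓝[>] 0) (𝓝 0) :=
    tendsto_nhdsWithin_of_tendsto_nhds tendsto_id
  have hsmall : ∀ᶠ κ : ℝ in 𝓝[>] 0, 0 < κ ∧ κ < x - y ∧ κ < y ∧ κ < 1 :=
    eventually_mem_nhdsWithin.and
      ((c1.eventually_lt_const (sub_pos.2 hyx)).and ((c1.eventually_lt_const hy).and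
      (c1.eventually_lt_const one_pos)))
  have hheight : Tendsto (fun n => W n (j n) / mu n) atTop (𝓝 y) := by
    -- The height at the centre is enclosed from both sides: the flux has exceeded `2` by height `(y
    -- - κ) μ`, and at height `(y + κ) μ` it is still close to `2 - a < 2`.
    rw [Metric.tendsto_nhds]
    intro ε hε
    obtain ⟨κ, ⟨k0, k1, k2, k3⟩, k4⟩ := (hsmall.and (c1.eventually_lt_const hε)).exists
    obtain ⟨B, d, -, -, hev⟩ := hcons κ k0 k1 k2 k3
    filter_upwards [hev, hlow κ k0 k2, hmu.eventually_gt_atTop 0] with n h1 h2 h3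
    have h4 : y - κ ≤ W n (j n) / mu n := by rwa [le_div_iff₀ h3]
    have h5 : W n (j n) / mu n ≤ y + κ := by rw [div_le_iff₀ h3]; exact h1.2.1
    rw [Real.dist_eq, abs_lt]
    constructor <;> linarith
  have hdens : Tendsto (fun n => p * (y * mu n) ^ (p - 1) * dens p h (lam n) (W n) (j n)) atTop
      (𝓝 (a ^ 2 / 2)) := by
    rw [Metric.tendsto_nhds]
    intro ε hε
    -- At flux `2` the conservation law gives the density `2a - (4 - (2 - a)²)/2 = a²/2`. For fixed
    -- `κ` it holds with factors off `1`, so `n → ∞` is taken before `κ → 0`.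
    have hval : ∀ σ : ℝ, Tendsto (fun κ : ℝ => 0 + 2 * (2 - (2 - a)) -
        (1 + σ * κ) * ((y + σ * κ) / y) ^ (p - 1) / 2 * (2 ^ 2 - (2 - a) ^ 2)) (𝓝[>] 0)
        (𝓝 (a ^ 2 / 2)) := fun σ => by
      have := (((tendsto_conservation_factor (r := p - 1) hy σ).div_const 2).mul_const
        ((2 : ℝ) ^ 2 - (2 - a) ^ 2)).const_sub (0 + 2 * (2 - (2 - a)))
      refine this.trans ?_
      have e : 0 + 2 * (2 - (2 - a)) - 1 / 2 * ((2 : ℝ) ^ 2 - (2 - a) ^ 2) = a ^ 2 / 2 := by ring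
      rw [e]
    obtain ⟨κ, ⟨k0, k1, k2, k3⟩, k4, k5⟩ := (hsmall.and
      (((hval 1).eventually_const_lt (show a ^ 2 / 2 - ε < a ^ 2 / 2 by linarith)).and
      ((hval (-1)).eventually_lt_const (show a ^ 2 / 2 < a ^ 2 / 2 + ε by linarith)))).exists
    simp only [one_mul, neg_mul, ← sub_eq_add_neg] at k4 k5
    obtain ⟨B, d, hB, hd, hev⟩ := hcons κ k0 k1 k2 k3
    have hlimit : ∀ K : ℝ, Tendsto (fun n => d n + 2 * (2 - B n) - K / 2 * (2 ^ 2 - B n ^ 2)) atTop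
        (𝓝 (0 + 2 * (2 - (2 - a)) - K / 2 * (2 ^ 2 - (2 - a) ^ 2))) := fun K =>
      (hd.add ((hB.const_sub 2).const_mul 2)).sub (((hB.pow 2).const_sub _).const_mul _)
    filter_upwards [hev, (hlimit _).eventually_const_lt k4, (hlimit _).eventually_lt_const k5]
      with n h1 h2 h3
    rw [Real.dist_eq, abs_lt]
    constructor <;> linarith [h1.2.2.1, h1.2.2.2]
  obtain ⟨κ, k0, k1, k2, k3⟩ := hsmall.exists
  obtain ⟨B, d, -, -, hev⟩ := hcons κ k0 k1 k2 k3
  have hconv : ∀ q : ℕ → ℝ, ∀ L : ℝ,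
      Tendsto (fun n => p * (y * mu n) ^ (p - 1) * q n) atTop (𝓝 L) →
      Tendsto (fun n => p * W n (j n) ^ (p - 1) * q n) atTop (𝓝 L) := fun q L hq => by
    have h1 : Tendsto (fun n => mu n ^ (p - 1) * (p * q n)) atTop (𝓝 (L / y ^ (p - 1))) := by
      refine (hq.div_const (y ^ (p - 1))).congr' ?_
      filter_upwards [hmu.eventually_gt_atTop 0] with n hn
      rw [Real.mul_rpow hy.le hn.le]
      field_simp
    have h2 := tendsto_height_rpow_mul hmu hy hheight (p - 1) h1
    rw [mul_div_cancel₀ _ hyp.ne'] at h2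
    exact h2.congr fun n => by ring
  exact ⟨j, hj0, hev.mono fun n hn => hn.1, hheight,
    hconv _ _ (tendsto_const_nhds.congr' (hjQ.mono fun n hn => hn.symm)), hconv _ _ hdens⟩

end Center

/-! ### Later bubbles -/

/-- The constant `b` is such that `b exp(a S) = 1` at `S = log(a/√2)`. There the profile vanishes
with slope `-2`, like a solution rescaled at its centre, where the normalized flux is `2`. -/
theorem logProfile_center {a : ℝ} (ha : 0 < a) :
    logProfile a ((√2 / a) ^ a) (Real.log (a / √2)) = 0 ∧
    logProfile' a ((√2 / a) ^ a) (Real.log (a / √2)) = -2 := by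
  have h2 : (0 : ℝ) < √2 := by positivity
  have hb : 0 < (√2 / a) ^ a := by positivity
  have he : (√2 / a) ^ a * Real.exp (a * Real.log (a / √2)) = 1 := by
    rw [mul_comm a, ← Real.rpow_def_of_pos (by positivity), ← Real.mul_rpow (by positivity)
      (by positivity), show √2 / a * (a / √2) = 1 by field_simp, Real.one_rpow]
  constructor
  · have h1 := exp_logProfile ha hb (Real.log (a / √2))
    rw [mul_assoc (2 * a ^ 2), he, Real.exp_add, two_mul, Real.exp_add,
      Real.exp_log (by positivity)] at h1
    have h3 : a / √2 * (a / √2) = a ^ 2 / 2 := by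
      rw [div_mul_div_comm, Real.mul_self_sqrt (by norm_num)]; ring
    rw [h3] at h1
    have h4 : Real.exp (logProfile a ((√2 / a) ^ a) (Real.log (a / √2))) = 1 := by
      have : (0 : ℝ) < a ^ 2 / 2 := by positivity
      apply mul_left_cancel₀ this.ne'
      rw [h1]; ring
    exact (Real.exp_eq_one_iff _).1 h4
  · have : logProfile' a ((√2 / a) ^ a) (Real.log (a / √2)) =
      (a - 2) - 2 * a * ((√2 / a) ^ a * Real.exp (a * Real.log (a / √2))) /
        (1 + (√2 / a) ^ a * Real.exp (a * Real.log (a / √2))) := by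
      unfold logProfile'; ring
    rw [this, he]; ring

/-- The data of a bubble centred at the times `j`, with end times `ebar` and `e`. -/
structure BubbleData (p : ℝ) (h : ℝ → ℝ) (lam mu : ℕ → ℝ) (W Q : ℕ → ℝ → ℝ) (δ a b : ℝ)
    (j e ebar : ℕ → ℝ) (N : ℕ → ℕ) : Prop where
  center_neg : ∀ n, j n < 0
  end_neg : ∀ n, e n < 0
  start_neg : ∀ n, ebar n < 0
  height_center : Tendsto (fun n => W n (j n) / mu n) atTop (𝓝 δ)
  dens_center : Tendsto (fun n => p * W n (j n) ^ (p - 1) * dens p h (lam n) (W n) (j n)) atTop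
    (𝓝 (a ^ 2 / 2))
  center : Tendsto (fun n => j n - Real.log (scale p h (lam n) (W n (j n)))) atTop
    (𝓝 (Real.log (a / √2)))
  radii : BubbleRadii p h lam mu (fun n => W n (j n)) W Q a b N
  end_eq : ∀ᶠ n in atTop, Real.log (scale p h (lam n) (W n (j n))) + N n = e n
  start_eq : ∀ᶠ n in atTop, Real.log (scale p h (lam n) (W n (j n))) + -N n = ebar n

section Sequences

variable {p : ℝ} {h : ℝ → ℝ} {lam mu : ℕ → ℝ} {W Q : ℕ → ℝ → ℝ}

/-- The three limits at the centre are the data of the profile: the density fixes the position of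
the centre relative to the scale, the rescaled value is zero by definition, and the flux gives the
slope. -/
theorem exists_bubbleData (hp : 0 < p) (hH0 : StandingH h) (hH1 : GrowthH p h)
    (hs : ∀ n, LogSol p h (lam n) (mu n) (W n) (Q n)) (hmu : Tendsto mu atTop atTop)
    {y a : ℝ} (hy : 0 < y) (ha : 0 < a) {j : ℕ → ℝ} (hj : ∀ n, j n < 0)
    (hW : Tendsto (fun n => W n (j n) / mu n) atTop (𝓝 y))
    (hQ : Tendsto (fun n => p * W n (j n) ^ (p - 1) * Q n (j n)) atTop (𝓝 2))
    (hD : Tendsto (fun n => p * W n (j n) ^ (p - 1) * dens p h (lam n) (W n) (j n)) atTop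
        (𝓝 (a ^ 2 / 2))) :
    ∃ (e ebar : ℕ → ℝ) (N : ℕ → ℕ),
      BubbleData p h lam mu W Q y a ((√2 / a) ^ a) j e ebar N := by
  have h2 : (0 : ℝ) < √2 := by positivity
  have hb : 0 < (√2 / a) ^ a := by positivity
  have hm := tendsto_height_atTop hmu hy hW
  obtain ⟨T, hT, hf⟩ := exists_nonlin_le hp hH0 hH1
  set g : ℕ → ℝ := fun n => Real.log (scale p h (lam n) (W n (j n))) with hg
  have hS : Tendsto (fun n => j n - g n) atTop (𝓝 (Real.log (a / √2))) := by
    have h1 : Tendsto (fun n => Real.log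
        (p * W n (j n) ^ (p - 1) * dens p h (lam n) (W n) (j n)) / 2) atTop
        (𝓝 (Real.log (a ^ 2 / 2) / 2)) :=
      ((Real.continuousAt_log (by positivity)).tendsto.comp hD).div_const 2
    have h3 : Real.log (a ^ 2 / 2) / 2 = Real.log (a / √2) := by
      rw [Real.log_div (by positivity) (by norm_num), Real.log_div ha.ne' h2.ne',
        Real.log_pow, Real.log_sqrt (by norm_num)]
      push_cast; ring
    rw [h3] at h1
    refine h1.congr' ?_
    filter_upwards [hm.eventually_ge_atTop T] with n hn
    have hfn := (hf _ hn).1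
    have := mul_dens_eq hp (hs n).lam_pos (hT.trans_le hn) hfn (W n) (j n - g n)
    simp only [hg, add_sub_cancel] at this
    rw [div_self hfn.ne', mul_one] at this
    rw [this, Real.log_exp]; simp only [hg]; ring
  obtain ⟨hZc, hYc⟩ := logProfile_center ha
  have hcont := (hasDerivAt_logProfile (a := a) hb (Real.log (a / √2))).continuousAt.tendsto.comp hS
  have hcont' := (hasDerivAt_logProfile' ha hb (Real.log (a / √2))).continuousAt.tendsto.comp hS
  rw [hZc] at hcont
  rw [hYc] at hcont'
  have hconv : BubbleConv p h lam (fun n => W n (j n)) W Q a ((√2 / a) ^ a) := by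
    refine BubbleConv.of_base hp hH0 hH1 hs hm ha hb (S₀ := fun n => j n - g n)
      (M₀ := |Real.log (a / √2)| + 1) ?_ ?_ ?_ ?_
    · filter_upwards [hS.abs.eventually_lt_const (lt_add_one |Real.log (a / √2)|)] with n hn
      exact hn.le
    · exact Eventually.of_forall fun n => by simpa [hg] using hj n
    · have : Tendsto (fun n => (0 : ℝ) - logProfile a ((√2 / a) ^ a) (j n - g n)) atTop
          (𝓝 (0 - 0)) := hcont.const_sub 0
      rw [sub_zero] at this
      refine this.congr fun n => ?_
      simp [logRescaled, hg]
    · have : Tendsto (fun n => -(p * W n (j n) ^ (p - 1) * Q n (j n)) -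
          logProfile' a ((√2 / a) ^ a) (j n - g n)) atTop (𝓝 (-2 - -2)) := hQ.neg.sub hcont'
      rw [sub_self] at this
      refine this.congr fun n => ?_
      simp [logRescaled', hg]
  obtain ⟨N, hN, -⟩ := hconv.exists_radii hp hmu (P := fun _ _ => True)
    (fun _ => Eventually.of_forall fun _ => trivial)
  -- The minimum with `-1` makes the end times negative for every `n`; for large `n` it is inactive
  -- by the room condition.
  refine ⟨fun n => min (g n + N n) (-1), fun n => min (g n + -N n) (-1), N, hj, ?_, ?_, hW, hD, hS,
    hN, ?_, ?_⟩
  · exact fun n => (min_le_right _ _).trans_lt (by norm_num)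
  · exact fun n => (min_le_right _ _).trans_lt (by norm_num)
  · filter_upwards [hN.room] with n hn
    have : (0 : ℝ) ≤ N n := Nat.cast_nonneg _
    exact (min_eq_left (by linarith)).symm
  · filter_upwards [hN.room] with n hn
    have : (0 : ℝ) ≤ N n := Nat.cast_nonneg _
    exact (min_eq_left (by linarith)).symm

namespace BubbleData

variable {δ a b : ℝ} {j e ebar : ℕ → ℝ} {N : ℕ → ℕ}

theorem height_end (hp : 0 < p) (hmu : Tendsto mu atTop atTop) (hδ : 0 < δ) (hb : 0 < b)
    (hB : BubbleData p h lam mu W Q δ a b j e ebar N) :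
    Tendsto (fun n => W n (e n) / mu n) atTop (𝓝 δ) := by
  refine (hB.radii.tendsto_height hp hmu hδ hb hB.height_center (S := fun n => (N n : ℝ))
    (Eventually.of_forall fun n => ⟨by linarith [(N n).cast_nonneg (α := ℝ)], le_rfl⟩)).congr' ?_
  filter_upwards [hB.end_eq] with n hn
  rw [hn]

theorem height_start (hp : 0 < p) (hmu : Tendsto mu atTop atTop) (hδ : 0 < δ) (hb : 0 < b)
    (hB : BubbleData p h lam mu W Q δ a b j e ebar N) :
    Tendsto (fun n => W n (ebar n) / mu n) atTop (𝓝 δ) := by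
  refine (hB.radii.tendsto_height hp hmu hδ hb hB.height_center (S := fun n => -(N n : ℝ))
    (Eventually.of_forall fun n => ⟨le_rfl, by linarith [(N n).cast_nonneg (α := ℝ)]⟩)).congr' ?_
  filter_upwards [hB.start_eq] with n hn
  rw [hn]

theorem slope_end (hmu : Tendsto mu atTop atTop) (ha : 0 < a) (hδ : 0 < δ) (hb : 0 < b)
    (hB : BubbleData p h lam mu W Q δ a b j e ebar N) :
    Tendsto (fun n => p * mu n ^ (p - 1) * Q n (e n)) atTop (𝓝 ((2 + a) / δ ^ (p - 1))) := by
  refine (hB.radii.tendsto_slope hmu hδ hB.height_center (S := fun n => (N n : ℝ))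
    (Eventually.of_forall fun n => ⟨by linarith [(N n).cast_nonneg (α := ℝ)], le_rfl⟩)
    ((tendsto_logProfile'_atTop ha hb).comp
      (tendsto_natCast_atTop_atTop.comp hB.radii.N_atTop))).congr' ?_
  filter_upwards [hB.end_eq] with n hn
  rw [hn]

theorem slope_start (hmu : Tendsto mu atTop atTop) (ha : 0 < a) (hδ : 0 < δ)
    (hB : BubbleData p h lam mu W Q δ a b j e ebar N) :
    Tendsto (fun n => p * mu n ^ (p - 1) * Q n (ebar n)) atTop
      (𝓝 ((2 - a) / δ ^ (p - 1))) := by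
  refine (hB.radii.tendsto_slope hmu hδ hB.height_center (S := fun n => -(N n : ℝ))
    (Eventually.of_forall fun n => ⟨le_rfl, by linarith [(N n).cast_nonneg (α := ℝ)]⟩)
    (A := 2 - a) (by
      have := (tendsto_logProfile'_atBot (a := a) (b := b) ha).comp (tendsto_neg_atTop_atBot.comp
        (tendsto_natCast_atTop_atTop.comp hB.radii.N_atTop))
      rw [neg_sub]
      exact this)).congr' ?_
  filter_upwards [hB.start_eq] with n hn
  rw [hn]

theorem neckState (hp : 0 < p) (hH0 : StandingH h) (hH1 : GrowthH p h)
    (hs : ∀ n, LogSol p h (lam n) (mu n) (W n) (Q n)) (hmu : Tendsto mu atTop atTop)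
    (ha : 0 < a) (hb : 0 < b) (hδ : 0 < δ)
    (hB : BubbleData p h lam mu W Q δ a b j e ebar N) : NeckState p h lam mu W Q δ (2 + a) e :=
  hB.radii.neckState hp hH0 hH1 hs hmu ha hb hδ hB.height_center hB.end_neg hB.end_eq

theorem end_sub_center (hB : BubbleData p h lam mu W Q δ a b j e ebar N) :
    Tendsto (fun n => e n - j n) atTop atTop := by
  refine ((tendsto_natCast_atTop_atTop.comp hB.radii.N_atTop).atTop_add hB.center.neg).congr' ?_
  filter_upwards [hB.end_eq] with n hn
  rw [← hn]; simp; ring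

theorem center_sub_start (hB : BubbleData p h lam mu W Q δ a b j e ebar N) :
    Tendsto (fun n => j n - ebar n) atTop atTop := by
  refine ((tendsto_natCast_atTop_atTop.comp hB.radii.N_atTop).atTop_add hB.center).congr' ?_
  filter_upwards [hB.start_eq] with n hn
  rw [← hn]; simp; ring

theorem log_scale_atBot (hB : BubbleData p h lam mu W Q δ a b j e ebar N) :
    Tendsto (fun n => Real.log (scale p h (lam n) (W n (j n)))) atTop atBot := by
  refine tendsto_atBot_mono' _ ?_ (tendsto_neg_atTop_atBot.comp
    ((tendsto_natCast_atTop_atTop (R := ℝ)).comp hB.radii.N_atTop))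
  filter_upwards [hB.radii.room] with n hn
  have : (0 : ℝ) ≤ N n := Nat.cast_nonneg _
  simp only [Function.comp]
  linarith

/-- A bubble starts long after the preceding neck is entered at a larger height. -/
theorem start_sub_prev (hp : 0 < p)
    (hs : ∀ n, LogSol p h (lam n) (mu n) (W n) (Q n)) (hmu : Tendsto mu atTop atTop)
    (ha : 0 < a) (hδ : 0 < δ) (hb : 0 < b)
    (hB : BubbleData p h lam mu W Q δ a b j e ebar N) {x A : ℝ} (hx : δ < x) {e' : ℕ → ℝ}
    (he : NeckState p h lam mu W Q x A e') :
    Tendsto (fun n => ebar n - e' n) atTop atTop := by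
  have h1 := hB.height_start hp hmu hδ hb
  have h2 := hB.slope_start hmu ha hδ
  obtain ⟨C, hC⟩ : ∃ C : ℝ, (2 - a) / δ ^ (p - 1) < C ∧ 0 < C :=
    ⟨max ((2 - a) / δ ^ (p - 1)) 0 + 1, by linarith [le_max_left ((2 - a) / δ ^ (p - 1)) 0],
      by linarith [le_max_right ((2 - a) / δ ^ (p - 1)) 0]⟩
  -- A drop of the height of order `μ` with a flux of order `μ^(1-p)` takes a time of order `μ^p`,
  -- which tends to infinity.
  have hc : 0 < p * ((x - δ) / 2) / C := by
    have : 0 < x - δ := by linarith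
    have := hC.2
    positivity
  refine tendsto_atTop_mono' _ ?_ ((tendsto_rpow_of_atTop hp hmu).const_mul_atTop hc)
  have h3 : Tendsto (fun n => W n (e' n) / mu n - W n (ebar n) / mu n) atTop (𝓝 (x - δ)) :=
    he.height.sub h1
  filter_upwards [h3.eventually_const_lt (show (x - δ) / 2 < x - δ by linarith),
    h2.eventually_lt_const hC.1, hmu.eventually_gt_atTop 0] with n c1 c2 c3
  have hW : (x - δ) / 2 * mu n < W n (e' n) - W n (ebar n) := by
    rw [← sub_div, lt_div_iff₀ c3] at c1; exact c1
  have hlt : W n (ebar n) < W n (e' n) := by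
    have : 0 < (x - δ) / 2 * mu n := by
      have : 0 < x - δ := by linarith
      positivity
    linarith
  have hle := (hs n).le_of_W_lt (he.neg n) hlt
  have h4 := (hs n).sub_le hle (hB.start_neg n)
  have h5 : p * mu n ^ (p - 1) * ((x - δ) / 2 * mu n) ≤ C * (ebar n - e' n) := by
    calc p * mu n ^ (p - 1) * ((x - δ) / 2 * mu n)
        ≤ p * mu n ^ (p - 1) * (Q n (ebar n) * (ebar n - e' n)) := by
          apply mul_le_mul_of_nonneg_left (hW.le.trans h4); positivity
      _ = p * mu n ^ (p - 1) * Q n (ebar n) * (ebar n - e' n) := by ring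
      _ ≤ C * (ebar n - e' n) := mul_le_mul_of_nonneg_right c2.le (by linarith)
  have h6 : mu n ^ p = mu n ^ (p - 1) * mu n := by
    rw [← Real.rpow_add_one c3.ne']; congr 1; ring
  rw [h6, div_mul_eq_mul_div, div_le_iff₀ hC.2]
  linarith

end BubbleData

end Sequences

/-! ### Convergence in `C^k` of the rescaled functions -/

theorem iteratedDerivWithin_one_eq {A B : ℝ} (hAB : A < B) {f f₁ : ℝ → ℝ}
    (hf : ∀ r ∈ Icc A B, HasDerivWithinAt f (f₁ r) (Icc A B) r) {r : ℝ} (hr : r ∈ Icc A B) :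
    iteratedDerivWithin 1 f (Icc A B) r = f₁ r := by
  rw [iteratedDerivWithin_one]
  exact (hf r hr).derivWithin (uniqueDiffOn_Icc hAB r hr)

theorem iteratedDerivWithin_two_eq {A B : ℝ} (hAB : A < B) {f f₁ f₂ : ℝ → ℝ}
    (hf : ∀ r ∈ Icc A B, HasDerivWithinAt f (f₁ r) (Icc A B) r)
    (hf₁ : ∀ r ∈ Icc A B, HasDerivWithinAt f₁ (f₂ r) (Icc A B) r) {r : ℝ} (hr : r ∈ Icc A B) :
    iteratedDerivWithin 2 f (Icc A B) r = f₂ r := by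
  rw [iteratedDerivWithin_succ, derivWithin_congr
    (fun x hx => iteratedDerivWithin_one_eq hAB hf hx) (iteratedDerivWithin_one_eq hAB hf hr)]
  exact (hf₁ r hr).derivWithin (uniqueDiffOn_Icc hAB r hr)

theorem rescaled_eq_logRescaled {p : ℝ} {h : ℝ → ℝ} {l m R : ℝ} (hγ : 0 < scale p h l m)
    (hR : 0 < R) (v : ℝ → ℝ) :
    rescaled p h l v m R = logRescaled p h l m (logHeight v) (Real.log R) := by
  rw [rescaled, logRescaled, logHeight, Real.exp_add, Real.exp_log hγ, Real.exp_log hR]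

theorem hasDerivAt_comp_log {Z : ℝ → ℝ} {Y R : ℝ} (hR : 0 < R)
    (hZ : HasDerivAt Z Y (Real.log R)) : HasDerivAt (fun r => Z (Real.log r)) (Y / R) R := by
  have := hZ.comp R (Real.hasDerivAt_log hR.ne')
  rwa [← div_eq_mul_inv] at this

theorem hasDerivAt_comp_log_div {Y : ℝ → ℝ} {Y' R : ℝ} (hR : 0 < R)
    (hY : HasDerivAt Y Y' (Real.log R)) :
    HasDerivAt (fun r => Y (Real.log r) / r) ((Y' - Y (Real.log R)) / R ^ 2) R := by
  refine ((hasDerivAt_comp_log hR hY).div (hasDerivAt_id R) hR.ne').congr_deriv ?_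
  simp only [id]
  field_simp

theorem exp_logProfile_le {a b : ℝ} (ha : 0 < a) (hb : 0 < b) (S : ℝ) :
    Real.exp (2 * S + logProfile a b S) ≤ a ^ 2 / 2 := by
  rw [exp_logProfile ha hb]
  have := Real.exp_pos (a * S)
  rw [div_le_iff₀ (by positivity)]
  have h1 : 0 ≤ (1 - b * Real.exp (a * S)) ^ 2 := sq_nonneg _
  have h2 := mul_nonneg (sq_nonneg a) h1
  nlinarith

theorem log_profile_eq {a b R : ℝ} (ha : 0 < a) (hb : 0 < b) (hR : 0 < R) :
    Real.log (2 * a ^ 2 * b / (R ^ (2 - a) * (1 + b * R ^ a) ^ 2)) =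
      logProfile a b (Real.log R) := by
  have h1 : 0 < R ^ a := Real.rpow_pos_of_pos hR _
  rw [Real.log_div (by positivity) (by positivity),
    Real.log_mul (x := R ^ (2 - a)) (by positivity) (by positivity), Real.log_rpow hR, Real.log_pow, logProfile, ← mul_comm (Real.log R) a,
    ← Real.rpow_def_of_pos hR]
  push_cast; ring

section Sequences

variable {p : ℝ} {h : ℝ → ℝ} {lam mu m : ℕ → ℝ} {u : ℕ → ℝ → ℝ} {a b : ℝ} {N : ℕ → ℕ}

theorem BubbleRadii.eventually_height (hp : 0 < p) (hH0 : StandingH h) (hH1 : GrowthH p h)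
    {W Q : ℕ → ℝ → ℝ}
    (hs : ∀ n, LogSol p h (lam n) (mu n) (W n) (Q n))
    (hN : BubbleRadii p h lam mu m W Q a b N) :
    ∀ᶠ n in atTop, 0 < m n ∧ 0 < nonlin p h (m n) ∧ 0 < scale p h (lam n) (m n) := by
  obtain ⟨T, hT, hf⟩ := exists_nonlin_le hp hH0 hH1
  filter_upwards [hN.height_atTop.eventually_ge_atTop T] with n hn
  have h1 := (hf _ hn).1
  exact ⟨hT.trans_le hn, h1, scale_pos hp (hs n).lam_pos (hT.trans_le hn) h1⟩

theorem BubbleRadii.tendsto_one_div (hN : BubbleRadii p h lam mu m W Q a b N) (C : ℝ) :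
    Tendsto (fun n => C / ((N n : ℝ) + 1)) atTop (𝓝 0) :=
  (tendsto_const_nhds.div_atTop
    (tendsto_atTop_add_const_right _ 1 (tendsto_natCast_atTop_atTop.comp hN.N_atTop)))

/-- Passing from `log r` to `r` divides derivatives by `r` and `r²`. On `r ≥ exp(-N)` this costs at
most `exp(2N)`, which the tolerance `exp(-2N)/(N+1)` was designed to absorb. -/
theorem BubbleRadii.ckTendsto_two (hp : 0 < p) (hH0 : StandingH h) (hH1 : GrowthH p h)
    (hs : ∀ n, LogSol p h (lam n) (mu n) (logHeight (u n)) (logFlux (u n)))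
    (ha : 0 < a) (hb : 0 < b)
    (hN : BubbleRadii p h lam mu m (fun n => logHeight (u n)) (fun n => logFlux (u n)) a b N)
    {A B : ℕ → ℝ} (hA : ∀ᶠ n in atTop, A n = Real.exp (-N n))
    (hB : ∀ᶠ n in atTop, B n = Real.exp (N n)) :
    CkTendsto 2 (fun n => rescaled p h (lam n) (u n) (m n))
      (fun R => Real.log (2 * a ^ 2 * b / (R ^ (2 - a) * (1 + b * R ^ a) ^ 2))) A B := by
  have key : ∀ᶠ n in atTop, ∀ i ≤ 2, ∀ r ∈ Icc (A n) (B n),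
      |iteratedDerivWithin i (rescaled p h (lam n) (u n) (m n)) (Icc (A n) (B n)) r
      - iteratedDerivWithin i
        (fun R => Real.log (2 * a ^ 2 * b / (R ^ (2 - a) * (1 + b * R ^ a) ^ 2)))
        (Icc (A n) (B n)) r| ≤ (a ^ 2 / 2 + 1) / ((N n : ℝ) + 1) := by
    filter_upwards [hA, hB, hN.close, hN.room, hN.eventually_height hp hH0 hH1 hs,
      hN.N_atTop.eventually_gt_atTop 0] with n hA hB hcl hroom hpos hN0
    obtain ⟨hm, hf, hγ⟩ := hpos
    have hN0' : (0 : ℝ) < N n := by exact_mod_cast hN0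
    have hAB : A n < B n := by
      rw [hA, hB]; exact Real.exp_lt_exp.2 (by linarith)
    have hA0 : 0 < A n := by rw [hA]; exact Real.exp_pos _
    set I := Icc (A n) (B n) with hI
    have hlog : ∀ r ∈ I, 0 < r ∧ Real.log r ∈ Icc (-(N n : ℝ)) (N n) := fun r hr => by
      have hr0 := hA0.trans_le hr.1
      refine ⟨hr0, ?_, ?_⟩
      · have := hr.1; rw [hA] at this; exact (Real.le_log_iff_exp_le hr0).2 this
      · have := hr.2; rw [hB] at this; exact (Real.log_le_iff_le_exp hr0).2 this
    have hneg : ∀ r ∈ I, Real.log (scale p h (lam n) (m n)) + Real.log r < 0 := fun r hr => by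
      linarith [(hlog r hr).2.2]
    set Z := logRescaled p h (lam n) (m n) (logHeight (u n)) with hZ
    set Y := logRescaled' p h (lam n) (m n) (logFlux (u n)) with hY
    set V : ℝ → ℝ := fun S => nonlin p h (logHeight (u n)
      (Real.log (scale p h (lam n) (m n)) + S)) / nonlin p h (m n) with hV
    have hz : ∀ r ∈ I, HasDerivWithinAt (rescaled p h (lam n) (u n) (m n))
        (Y (Real.log r) / r) I r := fun r hr => by
      have hd := hasDerivAt_comp_log (hlog r hr).1 (hasDerivAt_logRescaled (m := m n) (hs n)
        (hneg r hr))
      exact hd.hasDerivWithinAt.congr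
        (fun x hx => rescaled_eq_logRescaled hγ (hlog x hx).1 _)
        (rescaled_eq_logRescaled hγ (hlog r hr).1 _)
    have hz1 : ∀ r ∈ I, HasDerivWithinAt (fun r => Y (Real.log r) / r)
        ((-(Real.exp (2 * Real.log r) * V (Real.log r)) - Y (Real.log r)) / r ^ 2) I r :=
      fun r hr => (hasDerivAt_comp_log_div (hlog r hr).1 (hasDerivAt_logRescaled' hp hm hf (hs n)
        (hneg r hr))).hasDerivWithinAt
    have hw : ∀ r ∈ I, HasDerivWithinAt
        (fun R => Real.log (2 * a ^ 2 * b / (R ^ (2 - a) * (1 + b * R ^ a) ^ 2)))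
        (logProfile' a b (Real.log r) / r) I r := fun r hr =>
      (hasDerivAt_comp_log (hlog r hr).1 (hasDerivAt_logProfile hb _)).hasDerivWithinAt.congr
        (fun x hx => log_profile_eq ha hb (hlog x hx).1)
        (log_profile_eq ha hb (hlog r hr).1)
    have hw1 : ∀ r ∈ I, HasDerivWithinAt (fun r => logProfile' a b (Real.log r) / r)
        ((-Real.exp (2 * Real.log r + logProfile a b (Real.log r)) -
          logProfile' a b (Real.log r)) / r ^ 2) I r := fun r hr =>
      (hasDerivAt_comp_log_div (hlog r hr).1 (hasDerivAt_logProfile' ha hb _)).hasDerivWithinAt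
    intro i hi r hr
    obtain ⟨hr0, hS⟩ := hlog r hr
    set S := Real.log r with hSdef
    have hrS : r = Real.exp S := (Real.exp_log hr0).symm
    obtain ⟨hc1, hc2, hc3, -⟩ := hcl S hS
    set τ := Real.exp (-2 * N n) / ((N n : ℝ) + 1) with hτ
    have hN1 : (0 : ℝ) < (N n : ℝ) + 1 := by linarith
    have hτ0 : 0 ≤ τ := by positivity
    have hτN : τ * Real.exp (2 * N n) = 1 / ((N n : ℝ) + 1) := by
      rw [hτ, div_mul_eq_mul_div, ← Real.exp_add]; norm_num
    have hτ1 : τ ≤ 1 / ((N n : ℝ) + 1) := by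
      rw [← hτN]; exact le_mul_of_one_le_right hτ0 (Real.one_le_exp (by linarith))
    have hinv2 : 1 / r ^ 2 ≤ Real.exp (2 * N n) := by
      rw [hrS, ← Real.exp_nat_mul, one_div, ← Real.exp_neg]
      exact Real.exp_le_exp.2 (by push_cast; linarith [hS.1])
    have hinv1 : 1 / r ≤ Real.exp (2 * N n) := by
      rw [hrS, one_div, ← Real.exp_neg]
      exact Real.exp_le_exp.2 (by linarith [hS.1])
    have hfin : 1 / ((N n : ℝ) + 1) ≤ (a ^ 2 / 2 + 1) / ((N n : ℝ) + 1) := by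
      gcongr; nlinarith [sq_nonneg a]
    interval_cases i
    · rw [iteratedDerivWithin_zero, iteratedDerivWithin_zero, rescaled_eq_logRescaled hγ hr0,
        log_profile_eq ha hb hr0]
      exact (hc1.trans hτ1).trans hfin
    · rw [iteratedDerivWithin_one_eq hAB hz hr, iteratedDerivWithin_one_eq hAB hw hr, ← sub_div,
        abs_div, abs_of_pos hr0, div_eq_mul_one_div]
      refine (mul_le_mul hc2 hinv1 (by positivity) hτ0).trans ?_
      rw [hτN]; exact hfin
    · rw [iteratedDerivWithin_two_eq hAB hz hz1 hr, iteratedDerivWithin_two_eq hAB hw hw1 hr,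
        ← sub_div, abs_div, abs_of_pos (by positivity : 0 < r ^ 2), div_eq_mul_one_div]
      have he : |-(Real.exp (2 * S) * V S) - Y S - (-Real.exp (2 * S + logProfile a b S) -
          logProfile' a b S)| ≤ (a ^ 2 / 2 + 1) * τ := by
        have e1 : -(Real.exp (2 * S) * V S) - Y S - (-Real.exp (2 * S + logProfile a b S) -
          logProfile' a b S) = -(Real.exp (2 * S + logProfile a b S) *
            (V S * Real.exp (-logProfile a b S) - 1)) - (Y S - logProfile' a b S) := by
          have : Real.exp (2 * S + logProfile a b S) * Real.exp (-logProfile a b S) =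
              Real.exp (2 * S) := by rw [← Real.exp_add]; ring_nf
          linear_combination V S * this
        rw [e1]
        refine (abs_sub _ _).trans ?_
        rw [abs_neg, abs_mul, abs_of_pos (Real.exp_pos _), add_mul, one_mul]
        exact add_le_add (mul_le_mul (exp_logProfile_le ha hb S) hc3 (abs_nonneg _)
          (by positivity)) hc2
      refine (mul_le_mul he hinv2 (by positivity) (by positivity)).trans ?_
      rw [mul_assoc, hτN, mul_one_div]
  intro i hi ε hε
  filter_upwards [key, (hN.tendsto_one_div (a ^ 2 / 2 + 1)).eventually_lt_const hε] with n h1 h2 r hr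
  exact (h1 i hi r hr).trans h2.le

end Sequences

/-! ### The first bubble -/

/-- The data of the first bubble, with end times `e`. -/
structure FirstBubbleData (p : ℝ) (h : ℝ → ℝ) (lam mu : ℕ → ℝ) (W Q : ℕ → ℝ → ℝ)
    (e : ℕ → ℝ) (N : ℕ → ℕ) : Prop where
  radii : BubbleRadii p h lam mu mu W Q 2 (1 / 8) N
  end_neg : ∀ n, e n < 0
  end_eq : ∀ᶠ n in atTop, Real.log (scale p h (lam n) (mu n)) + N n = e n
  inner : ∀ᶠ n in atTop, ∀ S ≤ 0,
    WindowClose p h (lam n) (mu n) (W n) (Q n) 2 (1 / 8) (Real.exp (-2 * N n) / (N n + 1)) S ∧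
    |logRescaled p h (lam n) (mu n) (W n) S - logProfile 2 (1 / 8) S| ≤
      Real.exp (-2 * N n) / (N n + 1) * Real.exp (2 * S) ∧
    |logRescaled' p h (lam n) (mu n) (Q n) S - logProfile' 2 (1 / 8) S| ≤
      Real.exp (-2 * N n) / (N n + 1) * Real.exp (2 * S)

theorem profileZero_eq (r : ℝ) : profileZero r = Real.log 64 - 2 * Real.log (8 + r ^ 2) := by
  rw [profileZero, Real.log_div (by norm_num) (by positivity), Real.log_pow]
  push_cast; ring

theorem hasDerivAt_profileZero (r : ℝ) : HasDerivAt profileZero (-4 * r / (8 + r ^ 2)) r := by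
  have h1 : HasDerivAt (fun r : ℝ => 8 + r ^ 2) (2 * r) r := by
    simpa using (hasDerivAt_pow 2 r).const_add 8
  have h2 := ((h1.log (by positivity)).const_mul 2).const_sub (Real.log 64)
  rw [show profileZero = fun r => Real.log 64 - 2 * Real.log (8 + r ^ 2) from
    funext profileZero_eq]
  exact h2.congr_deriv (by ring)

theorem exp_two_mul_log {r : ℝ} (hr : 0 < r) : Real.exp (2 * Real.log r) = r ^ 2 := by
  rw [two_mul, Real.exp_add, Real.exp_log hr, sq]

theorem profileZero_eq_logProfile {r : ℝ} (hr : 0 < r) :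
    profileZero r = logProfile 2 (1 / 8) (Real.log r) := by
  rw [logProfile_two, exp_two_mul_log hr, profileZero_eq,
    show 8 + r ^ 2 = 8 * (1 + 1 / 8 * r ^ 2) by ring, Real.log_mul (by norm_num) (by positivity),
    show (64 : ℝ) = 8 ^ 2 by norm_num, Real.log_pow]
  push_cast; ring

theorem logProfile'_two_div {r : ℝ} (hr : 0 < r) :
    logProfile' 2 (1 / 8) (Real.log r) / r = -4 * r / (8 + r ^ 2) := by
  rw [logProfile', exp_two_mul_log hr]
  field_simp
  ring

section Sequences

variable {p : ℝ} {h : ℝ → ℝ} {lam mu : ℕ → ℝ} {W Q : ℕ → ℝ → ℝ} {e : ℕ → ℝ} {N : ℕ → ℕ}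

theorem exists_firstBubbleData (hp : 0 < p) (hH0 : StandingH h) (hH1 : GrowthH p h)
    (hs : ∀ n, LogSol p h (lam n) (mu n) (W n) (Q n)) (hmu : Tendsto mu atTop atTop) :
    ∃ (e : ℕ → ℝ) (N : ℕ → ℕ), FirstBubbleData p h lam mu W Q e N := by
  obtain ⟨hc, hi⟩ := firstBubble_conv hp hH0 hH1 hs hmu
  obtain ⟨N, hN, hP⟩ := hc.exists_radii hp hmu
    (fun k => hi (Real.exp (-2 * k) / (k + 1)) (by positivity))
  refine ⟨fun n => min (Real.log (scale p h (lam n) (mu n)) + N n) (-1), N, hN,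
    fun n => (min_le_right _ _).trans_lt (by norm_num), ?_, hP⟩
  filter_upwards [hN.room] with n hn
  have : (0 : ℝ) ≤ N n := Nat.cast_nonneg _
  exact (min_eq_left (by linarith)).symm

namespace FirstBubbleData

theorem close (hF : FirstBubbleData p h lam mu W Q e N) :
    ∀ᶠ n in atTop, ∀ S ≤ (N n : ℝ), WindowClose p h (lam n) (mu n) (W n) (Q n) 2 (1 / 8)
      (Real.exp (-2 * N n) / (N n + 1)) S := by
  filter_upwards [hF.inner, hF.radii.close] with n h1 h2 S hS
  rcases le_total S 0 with h | h
  · exact (h1 S h).1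
  · exact h2 S ⟨by linarith [(N n).cast_nonneg (α := ℝ)], hS⟩

/-- Near `r = 0` the division by `r` is compensated by the factor `exp(2S) = r²` in the half line
estimate. At `r = 0` itself both derivatives vanish, that of the solution by `u_n'(0) = 0`. -/
theorem ckTendsto_one {u : ℕ → ℝ → ℝ} (hp : 0 < p) (hH0 : StandingH h) (hH1 : GrowthH p h)
    (hsol : ∀ n, IsRadialSolution p h (lam n) (mu n) (u n))
    (hF : FirstBubbleData p h lam mu (fun n => logHeight (u n)) (fun n => logFlux (u n)) e N)
    {B : ℕ → ℝ} (hB : ∀ᶠ n in atTop, B n = Real.exp (N n)) :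
    CkTendsto 1 (fun n => rescaled p h (lam n) (u n) (mu n)) profileZero (fun _ => 0) B := by
  have hs := fun n => (hsol n).logSol hH0
  have key : ∀ᶠ n in atTop, ∀ i ≤ 1, ∀ r ∈ Icc 0 (B n),
      |iteratedDerivWithin i (rescaled p h (lam n) (u n) (mu n)) (Icc 0 (B n)) r
      - iteratedDerivWithin i profileZero (Icc 0 (B n)) r| ≤ 1 / ((N n : ℝ) + 1) := by
    filter_upwards [hB, hF.close, hF.inner, hF.radii.room,
      hF.radii.eventually_height hp hH0 hH1 hs] with n hB hcl hin hroom hpos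
    obtain ⟨hm, hf, hγ⟩ := hpos
    have hN0 : (0 : ℝ) ≤ N n := Nat.cast_nonneg _
    have hB0 : 0 < B n := by rw [hB]; exact Real.exp_pos _
    set I := Icc 0 (B n) with hI
    set Z := logRescaled p h (lam n) (mu n) (logHeight (u n)) with hZ
    set Y := logRescaled' p h (lam n) (mu n) (logFlux (u n)) with hY
    have hlog : ∀ r ∈ I, 0 < r → Real.log r ≤ N n := fun r hr hr0 => by
      have := hr.2; rw [hB] at this; exact (Real.log_le_iff_le_exp hr0).2 this
    have hzero : rescaled p h (lam n) (u n) (mu n) 0 = 0 := by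
      rw [rescaled, mul_zero, (hsol n).at_zero, sub_self, mul_zero]
    have hz : ∀ r ∈ I, HasDerivWithinAt (rescaled p h (lam n) (u n) (mu n))
        (if r = 0 then 0 else Y (Real.log r) / r) I r := fun r hr => by
      rcases hr.1.eq_or_lt with h0 | h0
      · subst h0
        rw [if_pos rfl]
        have h1 : HasDerivWithinAt (fun r : ℝ => scale p h (lam n) (mu n) * r)
            (scale p h (lam n) (mu n)) I 0 := by
          simpa using ((hasDerivAt_id (0 : ℝ)).const_mul
            (scale p h (lam n) (mu n))).hasDerivWithinAt
        have h2 : HasDerivWithinAt (u n) 0 (Ici 0) (scale p h (lam n) (mu n) * 0) := by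
          rw [mul_zero]; exact (hsol n).deriv_zero
        have h3 := (((h2.comp 0 h1 fun x hx => mul_nonneg hγ.le hx.1)).sub_const (mu n)).const_mul
          (p * mu n ^ (p - 1))
        exact h3.congr_deriv (by ring)
      · rw [if_neg h0.ne']
        have hd := hasDerivAt_comp_log h0 (hasDerivAt_logRescaled (m := mu n) (hs n)
          (S := Real.log r) (by linarith [hlog r hr h0]))
        refine (hd.congr_of_eventuallyEq ?_).hasDerivWithinAt
        filter_upwards [lt_mem_nhds h0] with x hx
        exact rescaled_eq_logRescaled hγ hx _
    have hw : ∀ r ∈ I, HasDerivWithinAt profileZero (-4 * r / (8 + r ^ 2)) I r := fun r _ =>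
      (hasDerivAt_profileZero r).hasDerivWithinAt
    set τ := Real.exp (-2 * N n) / ((N n : ℝ) + 1) with hτ
    have hτ0 : 0 ≤ τ := by positivity
    have hτ1 : τ ≤ 1 / ((N n : ℝ) + 1) := by
      rw [hτ]; gcongr; exact Real.exp_le_one_iff.2 (by linarith)
    intro i hi r hr
    rcases hr.1.eq_or_lt with h0 | h0
    · subst h0
      have : (0 : ℝ) ≤ 1 / ((N n : ℝ) + 1) := by positivity
      interval_cases i
      · rw [iteratedDerivWithin_zero, iteratedDerivWithin_zero, hzero, profileZero]
        norm_num
        positivity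
      · rw [iteratedDerivWithin_one_eq hB0 hz hr, iteratedDerivWithin_one_eq hB0 hw hr]
        simpa using this
    · have hS := hlog r hr h0
      have hc := hcl _ hS
      interval_cases i
      · rw [iteratedDerivWithin_zero, iteratedDerivWithin_zero, rescaled_eq_logRescaled hγ h0,
          profileZero_eq_logProfile h0]
        exact hc.Z.trans hτ1
      · rw [iteratedDerivWithin_one_eq hB0 hz hr, iteratedDerivWithin_one_eq hB0 hw hr,
          if_neg h0.ne', ← logProfile'_two_div h0, ← sub_div, abs_div, abs_of_pos h0]
        rw [div_le_iff₀ h0]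
        rcases le_total 1 r with h1 | h1
        · exact (hc.Y.trans hτ1).trans (le_mul_of_one_le_right (by positivity) h1)
        · refine (hin _ (Real.log_nonpos h0.le h1)).2.2.trans ?_
          rw [exp_two_mul_log h0]
          refine mul_le_mul hτ1 ?_ (by positivity) (by positivity)
          nlinarith
  intro i hi ε hε
  filter_upwards [key, (hF.radii.tendsto_one_div 1).eventually_lt_const hε] with n h1 h2 r hr
  exact (h1 i hi r hr).trans h2.le

end FirstBubbleData

end Sequences

/-! ### Energies -/

section Energy

variable {p : ℝ} {h : ℝ → ℝ} {lam mu : ℝ} {v : ℝ → ℝ}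

/-- Divergence form of the equation: `(-r v')' = λ f(v) r`. Hence energies are differences of
fluxes. -/
theorem IsRadialSolution.hasDerivAt_flux_log (hH0 : StandingH h)
    (hs : IsRadialSolution p h lam mu v) {r : ℝ} (hr : r ∈ Ioo (0 : ℝ) 1) :
    HasDerivAt (fun r => logFlux v (Real.log r)) (lam * nonlin p h (v r) * r) r := by
  have h1 := hasDerivAt_comp_log hr.1 ((hs.logSol hH0).deriv_Q _ (Real.log_neg hr.1 hr.2))
  refine h1.congr_deriv ?_
  rw [exp_two_mul_log hr.1, logHeight, Real.exp_log hr.1]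
  field_simp

theorem IsRadialSolution.continuousOn_nonlin (hp : 0 < p) (hH0 : StandingH h)
    (hs : IsRadialSolution p h lam mu v) (hmu : 0 < mu) :
    ContinuousOn (fun r => nonlin p h (v r)) (Icc 0 1) := by
  refine (nonlin_continuousOn hp hH0).comp hs.continuousOn fun r hr => ?_
  rcases hr.1.eq_or_lt with h0 | h0
  · rw [← h0, hs.at_zero]; exact hmu.le
  rcases hr.2.eq_or_lt with h1 | h1
  · rw [h1, hs.at_one]; exact self_mem_Ici
  · exact (hs.pos r ⟨h0, h1⟩).le

theorem uIcc_exp_subset {s t : ℝ} (hst : s ≤ t) (ht : t < 0) :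
    uIcc (Real.exp s) (Real.exp t) ⊆ Ioo 0 1 := by
  rw [uIcc_of_le (Real.exp_le_exp.2 hst)]
  exact fun r hr => ⟨(Real.exp_pos s).trans_le hr.1, hr.2.trans_lt (exp_mem_Ioo ht).2⟩

theorem IsRadialSolution.integral_eq_flux_sub (hp : 0 < p) (hH0 : StandingH h)
    (hs : IsRadialSolution p h lam mu v) {s t : ℝ} (hst : s ≤ t) (ht : t < 0) :
    ∫ r in Real.exp s..Real.exp t, lam * nonlin p h (v r) * r = logFlux v t - logFlux v s := by
  have hsub := uIcc_exp_subset hst ht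
  rw [intervalIntegral.integral_eq_sub_of_hasDerivAt
    (fun r hr => hs.hasDerivAt_flux_log hH0 (hsub hr)), Real.log_exp, Real.log_exp]
  apply ContinuousOn.intervalIntegrable
  exact (continuousOn_const.mul ((hs.continuousOn_nonlin hp hH0 (hs.logSol hH0).mu_pos).mono
    (hsub.trans Ioo_subset_Icc_self))).mul continuousOn_id

theorem IsRadialSolution.integral_eq_flux (hp : 0 < p) (hH0 : StandingH h)
    (hs : IsRadialSolution p h lam mu v) {t : ℝ} (ht : t < 0) :
    ∫ r in (0 : ℝ)..Real.exp t, lam * nonlin p h (v r) * r = logFlux v t := by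
  have hl := hs.logSol hH0
  have h1 : HasDerivAt (fun r => logFlux v (Real.log r)) _ (Real.exp t) :=
    hs.hasDerivAt_flux_log hH0 (exp_mem_Ioo ht)
  have h2 := h1.continuousAt.tendsto
  rw [Real.log_exp] at h2
  rw [intervalIntegral.integral_eq_sub_of_hasDerivAt_of_tendsto (Real.exp_pos t)
    (fun r hr => hs.hasDerivAt_flux_log hH0 ⟨hr.1, hr.2.trans (exp_mem_Ioo ht).2⟩) ?_
    (hl.lim_Q.comp Real.tendsto_log_nhdsGT_zero) (h2.mono_left nhdsWithin_le_nhds), sub_zero]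
  apply ContinuousOn.intervalIntegrable
  rw [uIcc_of_le (Real.exp_pos t).le]
  exact (continuousOn_const.mul ((hs.continuousOn_nonlin hp hH0 hl.mu_pos).mono
    (Icc_subset_Icc_right (exp_mem_Ioo ht).2.le))).mul continuousOn_id

/-- The solution decreases, so for `p > 1` the weight `v^(p-1)` lies between its values at the two
ends. -/
theorem IsRadialSolution.weighted_integral_mem (hp : 1 < p) (hH0 : StandingH h)
    (hs : IsRadialSolution p h lam mu v) {s t : ℝ} (hst : s ≤ t) (ht : t < 0) :
    ∫ r in Real.exp s..Real.exp t, lam * v r ^ (p - 1) * nonlin p h (v r) * r ∈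
      Icc (logHeight v t ^ (p - 1) * (logFlux v t - logFlux v s))
        (logHeight v s ^ (p - 1) * (logFlux v t - logFlux v s)) := by
  have hp0 : 0 < p := by linarith
  have hl := hs.logSol hH0
  have hsub := uIcc_exp_subset hst ht
  have hcv := hs.continuousOn.mono (hsub.trans Ioo_subset_Icc_self)
  have hcf := (hs.continuousOn_nonlin hp0 hH0 hl.mu_pos).mono (hsub.trans Ioo_subset_Icc_self)
  have hci : IntervalIntegrable (fun r => lam * v r ^ (p - 1) * nonlin p h (v r) * r)
      MeasureTheory.volume (Real.exp s) (Real.exp t) :=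
    ((((continuousOn_const.mul (hcv.rpow_const fun r hr => Or.inl
      (hs.pos r (hsub hr)).ne')).mul hcf).mul continuousOn_id)).intervalIntegrable
  have hcc : ∀ c : ℝ, IntervalIntegrable (fun r => c * (lam * nonlin p h (v r) * r))
      MeasureTheory.volume (Real.exp s) (Real.exp t) := fun c =>
    (continuousOn_const.mul ((continuousOn_const.mul hcf).mul continuousOn_id)).intervalIntegrable
  have hle := Real.exp_le_exp.2 hst
  rw [← hs.integral_eq_flux_sub hp0 hH0 hst ht, ← intervalIntegral.integral_const_mul,
    ← intervalIntegral.integral_const_mul]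
  have hb : ∀ r ∈ Icc (Real.exp s) (Real.exp t), 0 ≤ lam * nonlin p h (v r) * r ∧
      logHeight v t ≤ v r ∧ 0 < v r ∧ v r ≤ logHeight v s := fun r hr => by
    have hr0 := hsub (by rwa [uIcc_of_le hle] : r ∈ uIcc (Real.exp s) (Real.exp t))
    have hlr : Real.log r < 0 := Real.log_neg hr0.1 hr0.2
    have hv : logHeight v (Real.log r) = v r := by rw [logHeight, Real.exp_log hr0.1]
    have hvp := hs.pos r hr0
    refine ⟨mul_nonneg (mul_nonneg hs.lam_pos.le (nonlin_nonneg hH0 hvp.le)) hr0.1.le, ?_, hvp, ?_⟩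
    · rw [← hv]; exact hl.W_anti ((Real.log_le_iff_le_exp hr0.1).2 hr.2) ht
    · rw [← hv]; exact hl.W_anti ((Real.le_log_iff_exp_le hr0.1).2 hr.1) hlr
  constructor
  · refine intervalIntegral.integral_mono_on hle (hcc _) hci fun r hr => ?_
    obtain ⟨h1, h2, h3, -⟩ := hb r hr
    have := Real.rpow_le_rpow (hl.pos t ht).le h2 (by linarith : 0 ≤ p - 1)
    linarith [mul_le_mul_of_nonneg_right this h1]
  · refine intervalIntegral.integral_mono_on hle hci (hcc _) fun r hr => ?_
    obtain ⟨h1, h2, h3, h4⟩ := hb r hr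
    have := Real.rpow_le_rpow h3.le h4 (by linarith : 0 ≤ p - 1)
    linarith [mul_le_mul_of_nonneg_right this h1]

end Energy

section Sequences

variable {p : ℝ} {h : ℝ → ℝ} {lam mu : ℕ → ℝ} {u : ℕ → ℝ → ℝ}

theorem tendsto_energy (hp : 0 < p) (hH0 : StandingH h)
    (hsol : ∀ n, IsRadialSolution p h (lam n) (mu n) (u n)) {s t : ℕ → ℝ}
    (hst : ∀ᶠ n in atTop, s n ≤ t n ∧ t n < 0) {K L : ℝ}
    (hK : Tendsto (fun n => p * mu n ^ (p - 1) * logFlux (u n) (s n)) atTop (𝓝 K))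
    (hL : Tendsto (fun n => p * mu n ^ (p - 1) * logFlux (u n) (t n)) atTop (𝓝 L)) :
    Tendsto (fun n => energy p h (lam n) (mu n) (u n) (Real.exp (s n)) (Real.exp (t n))) atTop
      (𝓝 (L - K)) := by
  refine (hL.sub hK).congr' ?_
  filter_upwards [hst] with n hn
  rw [energy, (hsol n).integral_eq_flux_sub hp hH0 hn.1 hn.2, mul_sub]

/-- The two conditions on `M` hold in both uses: inside a bubble the heights at the ends have the
same limit, and on a neck the energy limit `L` is zero. -/
theorem tendsto_energy' (hp : 1 < p) (hH0 : StandingH h)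
    (hsol : ∀ n, IsRadialSolution p h (lam n) (mu n) (u n)) (hmu : Tendsto mu atTop atTop)
    {s t : ℕ → ℝ} (hst : ∀ᶠ n in atTop, s n ≤ t n ∧ t n < 0) {x y L M : ℝ}
    (hx : Tendsto (fun n => logHeight (u n) (s n) / mu n) atTop (𝓝 x))
    (hy : Tendsto (fun n => logHeight (u n) (t n) / mu n) atTop (𝓝 y))
    (hL : Tendsto (fun n => energy p h (lam n) (mu n) (u n) (Real.exp (s n)) (Real.exp (t n)))
      atTop (𝓝 L)) (hxM : x ^ (p - 1) * L = M) (hyM : y ^ (p - 1) * L = M) :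
    Tendsto (fun n => energy' p h (lam n) (u n) (Real.exp (s n)) (Real.exp (t n))) atTop
      (𝓝 M) := by
  have hp1 : 0 ≤ p - 1 := by linarith
  have h1 := (hx.rpow_const (Or.inr hp1)).mul hL
  have h2 := (hy.rpow_const (Or.inr hp1)).mul hL
  rw [hxM] at h1
  rw [hyM] at h2
  have hsq : ∀ᶠ n in atTop, energy' p h (lam n) (u n) (Real.exp (s n)) (Real.exp (t n)) ∈
      Icc ((logHeight (u n) (t n) / mu n) ^ (p - 1) *
        energy p h (lam n) (mu n) (u n) (Real.exp (s n)) (Real.exp (t n)))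
      ((logHeight (u n) (s n) / mu n) ^ (p - 1) *
        energy p h (lam n) (mu n) (u n) (Real.exp (s n)) (Real.exp (t n))) := by
    filter_upwards [hst, hmu.eventually_gt_atTop 0] with n hn hm
    have hl := (hsol n).logSol hH0
    have hm1 : 0 < mu n ^ (p - 1) := Real.rpow_pos_of_pos hm _
    have hp0 : 0 ≤ p := by linarith
    obtain ⟨c1, c2⟩ := (hsol n).weighted_integral_mem hp hH0 hn.1 hn.2
    have e1 : ∀ w : ℝ, 0 ≤ w → (w / mu n) ^ (p - 1) *
        (p * mu n ^ (p - 1) * (logFlux (u n) (t n) - logFlux (u n) (s n))) =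
        p * (w ^ (p - 1) * (logFlux (u n) (t n) - logFlux (u n) (s n))) := fun w hw => by
      rw [Real.div_rpow hw hm.le]
      field_simp
    rw [energy, energy', (hsol n).integral_eq_flux_sub (by linarith) hH0 hn.1 hn.2,
      e1 _ (hl.pos _ hn.2).le, e1 _ (hl.pos _ (hn.1.trans_lt hn.2)).le]
    exact ⟨mul_le_mul_of_nonneg_left c1 hp0, mul_le_mul_of_nonneg_left c2 hp0⟩
  exact tendsto_of_tendsto_of_tendsto_of_le_of_le' h2 h1 (hsq.mono fun n hn => hn.1)
    (hsq.mono fun n hn => hn.2)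

theorem tendsto_exp_div_exp {s t : ℕ → ℝ} (hst : Tendsto (fun n => t n - s n) atTop atTop) :
    Tendsto (fun n => Real.exp (s n) / Real.exp (t n)) atTop (𝓝 0) := by
  refine (Real.tendsto_exp_atBot.comp (tendsto_neg_atTop_atBot.comp hst)).congr fun n => ?_
  simp only [Function.comp, neg_sub, Real.exp_sub]

theorem exp_div_scale {l m t S : ℝ} (hγ : 0 < scale p h l m)
    (ht : Real.log (scale p h l m) + S = t) : Real.exp t / scale p h l m = Real.exp S := by
  rw [← ht, Real.exp_add, Real.exp_log hγ, mul_div_cancel_left₀ _ hγ.ne']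

theorem BubbleData.isLaterBubble (hp : 2 < p) (hH0 : StandingH h) (hH1 : GrowthH p h)
    (hsol : ∀ n, IsRadialSolution p h (lam n) (mu n) (u n)) (hmu : Tendsto mu atTop atTop)
    {k : ℕ} {j e ebar e' : ℕ → ℝ} {N : ℕ → ℕ}
    (hB : BubbleData p h lam mu (fun n => logHeight (u n)) (fun n => logFlux (u n))
      (bubbleDelta p (k + 1)) (bubbleA p (k + 1)) (bubbleB p (k + 1)) j e ebar N)
    (he : NeckState p h lam mu (fun n => logHeight (u n)) (fun n => logFlux (u n))
      (bubbleDelta p k) (2 + bubbleA p k) e') :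
    IsLaterBubble p h lam mu u (k + 1) (fun n => Real.exp (e' n)) (fun n => Real.exp (j n))
      (fun n => Real.exp (e n)) (fun n => Real.exp (ebar n)) := by
  have hp0 : 0 < p := by linarith
  obtain ⟨⟨hδ, hδ'⟩, ⟨ha, ha2⟩, -, hrec, -⟩ := bubble_spec hp k
  have hδk := (bubble_range hp k).2.2
  set a := bubbleA p (k + 1) with hadef
  set δ := bubbleDelta p (k + 1) with hδdef
  have hb : 0 < bubbleB p (k + 1) := by
    rw [bubbleB, ← hadef]; positivity
  have hs := fun n => (hsol n).logSol hH0
  have hpos := hB.radii.eventually_height hp0 hH0 hH1 hs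
  have hh1 := hB.height_start hp0 hmu hδ hb
  have hh2 := hB.height_end hp0 hmu hδ hb
  have hs1 := hB.slope_start hmu ha hδ
  have hs2 := hB.slope_end hmu ha hδ hb
  have hd1 := hB.start_sub_prev hp0 hs hmu ha hδ hb hδ' he
  have hd2 := hB.center_sub_start
  have hd3 := hB.end_sub_center
  have ho1 : ∀ᶠ n in atTop, e' n ≤ ebar n ∧ ebar n < 0 := by
    filter_upwards [hd1.eventually_ge_atTop 0] with n hn
    exact ⟨by linarith, hB.start_neg n⟩
  have ho2 : ∀ᶠ n in atTop, ebar n ≤ e n ∧ e n < 0 := by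
    filter_upwards [hd2.eventually_ge_atTop 0, hd3.eventually_ge_atTop 0] with n h1 h2
    exact ⟨by linarith, hB.end_neg n⟩
  have hE1 : Tendsto (fun n => energy p h (lam n) (mu n) (u n) (Real.exp (e' n))
      (Real.exp (ebar n))) atTop (𝓝 0) := by
    have h1 := tendsto_energy hp0 hH0 hsol ho1 he.slope hs1
    have hP := Real.rpow_pos_of_pos hδ (p - 1)
    have hP' := Real.rpow_pos_of_pos hδk (p - 1)
    -- The recurrence for `a_{k+1}` says that the flux entering a bubble equals the flux leaving the
    -- preceding one, so the neck carries no energy.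
    have h2 : (2 - a) / δ ^ (p - 1) - (2 + bubbleA p k) / bubbleDelta p k ^ (p - 1) = 0 := by
      rw [hrec, Real.div_rpow hδ.le hδk.le]
      field_simp
      ring
    rwa [h2] at h1
  have hE2 : Tendsto (fun n => energy p h (lam n) (mu n) (u n) (Real.exp (ebar n))
      (Real.exp (e n))) atTop (𝓝 (2 * a / δ ^ (p - 1))) := by
    have h1 := tendsto_energy hp0 hH0 hsol ho2 hs1 hs2
    rwa [← sub_div, show 2 + a - (2 - a) = 2 * a by ring] at h1
  exact {
    r_mem := fun n => exp_mem_Ioo (hB.center_neg n)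
    rho_mem := fun n => exp_mem_Ioo (hB.end_neg n)
    rhobar_mem := fun n => exp_mem_Ioo (hB.start_neg n)
    height_r := hB.height_center
    phi_r := by
      simp only [phi_exp]
      exact hB.dens_center
    height_rho := hh2
    height_rhobar := hh1
    rhoprev_div_rhobar := tendsto_exp_div_exp hd1
    rhobar_div_r := tendsto_exp_div_exp hd2
    r_div_rho := tendsto_exp_div_exp hd3
    scale_tendsto := by
      refine (Real.tendsto_exp_atBot.comp hB.log_scale_atBot).congr' ?_
      filter_upwards [hpos] with n hn
      exact Real.exp_log hn.2.2
    profile_tendsto := by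
      refine hB.radii.ckTendsto_two hp0 hH0 hH1 hs ha hb ?_ ?_
      · filter_upwards [hpos, hB.start_eq] with n h1 h2
        exact exp_div_scale h1.2.2 h2
      · filter_upwards [hpos, hB.end_eq] with n h1 h2
        exact exp_div_scale h1.2.2 h2
    energy_neck := hE1
    energy_bubble := hE2
    energy'_neck := tendsto_energy' (by linarith) hH0 hsol hmu ho1 he.height hh1 hE1
      (mul_zero _) (mul_zero _)
    energy'_bubble := by
      have : δ ^ (p - 1) * (2 * a / δ ^ (p - 1)) = 2 * a :=
        mul_div_cancel₀ _ (Real.rpow_pos_of_pos hδ _).ne'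
      exact tendsto_energy' (by linarith) hH0 hsol hmu ho2 hh1 hh2 hE2 this this }

end Sequences

/-! ### The sequence of bubbles -/

section Parameters

variable {p : ℝ}

theorem mul_one_sub_le_one_sub_rpow (hp : 2 < p) {x : ℝ} (hx : x ∈ Ioo (0 : ℝ) 1) :
    p / 2 * (1 - x) ^ 2 ≤ p * (1 - x) - 1 + x ^ p := by
  have h := sub_le_sub_of_hasDerivAt_le (a := x) (b := 1)
    (f := fun t => p * (1 - t) - 1 + t ^ p) (g := fun t => p / 2 * (1 - t) ^ 2)
    (f' := fun t => p * -1 + p * t ^ (p - 1))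
    (g' := fun t => p / 2 * (2 * (1 - t) * -1)) hx.2.le
    (fun t ht => by
      have h1 : HasDerivAt (fun t : ℝ => 1 - t) (-1) t := (hasDerivAt_id t).const_sub 1
      exact ((h1.const_mul p).sub_const 1).add (hasDerivAt_rpow_pos p (hx.1.trans_le ht.1)))
    (fun t ht => by
      have h1 : HasDerivAt (fun t : ℝ => 1 - t) (-1) t := (hasDerivAt_id t).const_sub 1
      simpa using (h1.pow 2).const_mul (p / 2))
    (fun t ht => by
      have ht0 := hx.1.trans_le ht.1
      have h1 : t ^ (p - 1) ≤ t ^ (1 : ℝ) :=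
        Real.rpow_le_rpow_of_exponent_ge ht0 ht.2 (by linarith)
      rw [Real.rpow_one] at h1
      nlinarith)
  simp at h
  linarith

/-- Up to a factor `4` the right side is the error of the trapezoidal rule for `p t^(p-1)` on `[x,
1]`, which is cubic in `1 - x`. Both sides vanish at `x = 1`, so derivatives are compared. -/
theorem trapezoid_rpow_le (hp : 2 < p) {x : ℝ} (hx : x ∈ Ioo (0 : ℝ) 1) :
    -(p * (p - 1) * p * (1 - x) ^ 3) ≤
      4 * (1 - x ^ p) - 2 * p * ((1 - x) * (1 + x ^ (p - 1))) := by
  have h := sub_le_sub_of_hasDerivAt_le (a := x) (b := 1)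
    (f := fun t => 4 * (1 - t ^ p) - 2 * p * ((1 - t) * (1 + t ^ (p - 1))))
    (g := fun t => -(p * (p - 1) * p * (1 - t) ^ 3))
    (f' := fun t => 4 * (-(p * t ^ (p - 1))) - 2 * p * (-1 * (1 + t ^ (p - 1)) +
      (1 - t) * ((p - 1) * t ^ (p - 1 - 1))))
    (g' := fun t => -(p * (p - 1) * p * (3 * (1 - t) ^ 2 * -1))) hx.2.le
    (fun t ht => by
      have ht0 := hx.1.trans_le ht.1
      have h1 : HasDerivAt (fun t : ℝ => 1 - t) (-1) t := (hasDerivAt_id t).const_sub 1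
      exact (((hasDerivAt_rpow_pos p ht0).const_sub 1).const_mul 4).sub
        ((h1.mul ((hasDerivAt_rpow_pos (p - 1) ht0).const_add 1)).const_mul (2 * p)))
    (fun t ht => by
      have h1 : HasDerivAt (fun t : ℝ => 1 - t) (-1) t := (hasDerivAt_id t).const_sub 1
      exact ((h1.pow 3).const_mul (p * (p - 1) * p)).neg.congr_deriv (by push_cast; ring))
    (fun t ht => by
      have ht0 := hx.1.trans_le ht.1
      have hd : 0 ≤ 1 - t := by linarith [ht.2]
      have h1 : 1 + (p - 1) * (t - 1) ≤ t ^ (p - 1) := by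
        have := one_add_mul_self_le_rpow_one_add (s := t - 1) (by linarith) (p := p - 1)
          (by linarith)
        rwa [add_sub_cancel] at this
      have h2 : 1 - t ^ (p - 1 - 1) ≤ p * (1 - t) := by
        rcases le_total 1 (p - 1 - 1) with hq | hq
        · have := one_add_mul_self_le_rpow_one_add (s := t - 1) (by linarith) hq
          rw [add_sub_cancel] at this
          nlinarith
        · have := Real.rpow_le_rpow_of_exponent_ge ht0 ht.2 hq
          rw [Real.rpow_one] at this
          nlinarith
      have h3 : (p - 1) * (1 - t) * (1 - t ^ (p - 1 - 1)) ≤ (p - 1) * (1 - t) * (p * (1 - t)) :=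
        mul_le_mul_of_nonneg_left h2 (mul_nonneg (by linarith) hd)
      have h4 : 1 - t ^ (p - 1) - (p - 1) * (1 - t) * t ^ (p - 1 - 1) ≤
          (p - 1) * p * (1 - t) ^ 2 := by nlinarith
      have h5 := mul_le_mul_of_nonneg_left h4 (by linarith : 0 ≤ 2 * p)
      have h6 : 0 ≤ p * (p - 1) * p * (1 - t) ^ 2 := by
        have : 0 ≤ p - 1 := by linarith
        positivity
      linarith)
  simp at h
  linarith

/-- By the root equation the change of `a`, times `1 - x^p`, is the trapezoidal error, so `a` loses
only `O((1 - x)²)`. Since also `1 - x ≤ a`, the relative loss is `O(1 - x)`, comparable with the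
relative drop of `δ`. -/
theorem bubbleA_succ_ge (hp : 2 < p) (k : ℕ) :
    bubbleA p k * (1 - p * (p - 1) * p * (1 - bubbleRatio p (bubbleA p k))) ≤
      bubbleA p (k + 1) := by
  obtain ⟨ha, ha2, -⟩ := bubble_range hp k
  obtain ⟨hx, hroot, -, -⟩ := bubbleRatio_spec hp ha ha2
  simp only [bubbleA]
  set a := bubbleA p k
  set x := bubbleRatio p a
  have h1 := mul_one_sub_le_one_sub_rpow hp hx
  have h2 := trapezoid_rpow_le hp hx
  have hε : 0 < 1 - x := by linarith [hx.2]
  have hxp : 1 - x ≤ 1 - x ^ p := by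
    have := Real.rpow_le_rpow_of_exponent_ge hx.1 hx.2.le (by linarith : (1 : ℝ) ≤ p)
    rw [Real.rpow_one] at this
    linarith
  have hxp' : 1 - x ^ p ≤ p * (1 - x) := by
    have := one_add_mul_self_le_rpow_one_add (s := x - 1) (by linarith [hx.1]) (p := p)
      (by linarith)
    rw [add_sub_cancel] at this
    linarith
  have hr : 2 * p * (1 - x) = (2 + a) * (1 - x ^ p) := by
    have h2a : (2 + a) ≠ 0 := by positivity
    field_simp at hroot
    linarith
  have hlow : 1 - x ≤ a := by
    have h3 : (1 - x) * (p * (1 - x)) ≤ a * (1 - x ^ p) := by nlinarith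
    have h4 : a * (1 - x ^ p) ≤ a * (p * (1 - x)) := mul_le_mul_of_nonneg_left hxp' ha.le
    exact le_of_mul_le_mul_right (h3.trans h4) (by positivity)
  have hC : 0 < p * (p - 1) * p := by
    have : 0 < p - 1 := by linarith
    positivity
  have h5 : -(p * (p - 1) * p * (1 - x) ^ 2) ≤ 2 - x ^ (p - 1) * (2 + a) - a := by
    have h6 : (2 - x ^ (p - 1) * (2 + a) - a) * (1 - x ^ p) =
        4 * (1 - x ^ p) - 2 * p * ((1 - x) * (1 + x ^ (p - 1))) := by
      linear_combination (1 + x ^ (p - 1)) * hr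
    have h7 : -(p * (p - 1) * p * (1 - x) ^ 2) * (1 - x ^ p) ≤
        -(p * (p - 1) * p * (1 - x) ^ 3) := by
      have := mul_le_mul_of_nonneg_left hxp (by positivity : 0 ≤ p * (p - 1) * p * (1 - x) ^ 2)
      linarith
    rw [← h6] at h2
    exact le_of_mul_le_mul_right (h7.trans h2) (hε.trans_le hxp)
  have h8 := mul_le_mul_of_nonneg_left hlow (by positivity : 0 ≤ p * (p - 1) * p * (1 - x))
  linarith

/-- A positive limit `d` would make the relative drops `1 - x_k` summable. The relative losses of
`a_k` would then be summable too, so `a_k` would stay bounded below. But `x_k → 1`, and `x_k^(p-1)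
(2 + a_k) < 2` excludes this. -/
theorem tendsto_bubbleDelta (hp : 2 < p) : Tendsto (bubbleDelta p) atTop (𝓝 0) := by
  have hpos := fun k => (bubble_range hp k).2.2
  have hanti : Antitone (bubbleDelta p) :=
    antitone_nat_of_succ_le fun k => (bubble_spec hp k).1.2.le
  have hbdd : BddBelow (range (bubbleDelta p)) := ⟨0, by rintro _ ⟨k, rfl⟩; exact (hpos k).le⟩
  have hlim := tendsto_atTop_ciInf hanti hbdd
  set d := ⨅ k, bubbleDelta p k with hd
  have hd0 : 0 ≤ d := le_ciInf fun k => (hpos k).le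
  rcases hd0.eq_or_lt with h0 | h0
  · rwa [← h0] at hlim
  exfalso
  have hdk : ∀ k, d ≤ bubbleDelta p k := fun k => ciInf_le hbdd k
  set C := p * (p - 1) * p / d with hC
  have hC0 : 0 < C := by
    have : 0 < p - 1 := by linarith
    positivity
  have hspec := fun k => bubbleRatio_spec hp (bubble_range hp k).1 (bubble_range hp k).2.1
  have hstep : ∀ k, bubbleA p k * (1 - C * (bubbleDelta p k - bubbleDelta p (k + 1))) ≤
      bubbleA p (k + 1) := fun k => by
    refine le_trans ?_ (bubbleA_succ_ge hp k)
    apply mul_le_mul_of_nonneg_left _ (bubble_range hp k).1.le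
    have h1 : d * (1 - bubbleRatio p (bubbleA p k)) ≤
        bubbleDelta p k - bubbleDelta p (k + 1) := by
      simp only [bubbleDelta]
      have := mul_le_mul_of_nonneg_right (hdk k)
        (by linarith [(hspec k).1.2] : 0 ≤ 1 - bubbleRatio p (bubbleA p k))
      linarith
    have h2 := mul_le_mul_of_nonneg_left h1 hC0.le
    have h3 : C * (d * (1 - bubbleRatio p (bubbleA p k))) =
        p * (p - 1) * p * (1 - bubbleRatio p (bubbleA p k)) := by
      rw [hC]; field_simp
    linarith
  obtain ⟨K, hK⟩ := (hlim.eventually_lt_const (show d < d + 1 / (2 * C) by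
    have : 0 < 1 / (2 * C) := by positivity
    linarith)).exists
  have hCK : ∀ i, C * (bubbleDelta p K - bubbleDelta p i) ≤ 1 / 2 := fun i => by
    have h1 := hdk i
    have h2 : C * (bubbleDelta p K - bubbleDelta p i) ≤ C * (1 / (2 * C)) :=
      mul_le_mul_of_nonneg_left (by linarith) hC0.le
    have h3 : C * (1 / (2 * C)) = 1 / 2 := by field_simp
    linarith
  have haK := (bubble_range hp K).1
  -- A product of factors `1 - c_i` is at least `1` minus the sum of the `c_i`, and here the sum
  -- telescopes. Past `K` it is at most `1/2`.
  have hind : ∀ i, bubbleA p K * (1 - C * (bubbleDelta p K - bubbleDelta p (K + i))) ≤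
      bubbleA p (K + i) := fun i => by
    induction i with
    | zero => simp
    | succ i ih =>
      refine le_trans ?_ (hstep (K + i))
      have e1 := hCK (K + i + 1)
      have e2 := hanti (Nat.le_add_right K i)
      have e3 := hanti (Nat.le_succ (K + i))
      have e4 : 0 ≤ 1 - C * (bubbleDelta p (K + i) - bubbleDelta p (K + i + 1)) := by
        have := mul_le_mul_of_nonneg_left e2 hC0.le
        nlinarith
      refine le_trans ?_ (mul_le_mul_of_nonneg_right ih e4)
      have e5 : 0 ≤ (C * (bubbleDelta p K - bubbleDelta p (K + i))) *
          (C * (bubbleDelta p (K + i) - bubbleDelta p (K + i + 1))) :=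
        mul_nonneg (mul_nonneg hC0.le (by linarith)) (mul_nonneg hC0.le (sub_nonneg.2 e3))
      have e6 := mul_nonneg haK.le e5
      rw [mul_assoc (bubbleA p K)]
      apply mul_le_mul_of_nonneg_left _ haK.le
      rw [← Nat.add_assoc] at *
      linarith
  have hhalf : ∀ i, bubbleA p K / 2 ≤ bubbleA p (K + i) := fun i => by
    refine le_trans ?_ (hind i)
    nlinarith [hCK (K + i)]
  have hratio : Tendsto (fun k => bubbleRatio p (bubbleA p k)) atTop (𝓝 1) := by
    have h1 := ((tendsto_add_atTop_iff_nat 1).2 hlim).div hlim h0.ne'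
    rw [div_self h0.ne'] at h1
    refine h1.congr fun k => ?_
    simp only [Pi.div_apply, bubbleDelta]
    exact mul_div_cancel_right₀ _ (hpos k).ne'
  have h1 := ((hratio.rpow_const (p := p - 1) (Or.inl one_ne_zero)).mul_const (2 + bubbleA p K / 2))
  rw [Real.one_rpow, one_mul] at h1
  have h2 : 2 + bubbleA p K / 2 ≤ 2 := by
    refine le_of_tendsto h1 ?_
    filter_upwards [eventually_ge_atTop K] with k hk
    obtain ⟨i, rfl⟩ := Nat.exists_eq_add_of_le hk
    refine le_trans ?_ (hspec (K + i)).2.2.2.le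
    apply mul_le_mul_of_nonneg_left (by linarith [hhalf i])
    exact Real.rpow_nonneg (hspec (K + i)).1.1.le _
  linarith

end Parameters

section Sequences

variable {p : ℝ} {h : ℝ → ℝ} {lam mu : ℕ → ℝ}

theorem exists_bubble_sequence (hp : 2 < p) (hH0 : StandingH h) (hH1 : GrowthH p h)
    {W Q : ℕ → ℝ → ℝ} (hs : ∀ n, LogSol p h (lam n) (mu n) (W n) (Q n))
    (hmu : Tendsto mu atTop atTop) {e₀ : ℕ → ℝ} (he₀ : NeckState p h lam mu W Q 1 4 e₀) :
    ∃ (j e ebar : ℕ → ℕ → ℝ) (N : ℕ → ℕ → ℕ), e 0 = e₀ ∧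
      (∀ k, NeckState p h lam mu W Q (bubbleDelta p k) (2 + bubbleA p k) (e k)) ∧
      ∀ k, BubbleData p h lam mu W Q (bubbleDelta p (k + 1)) (bubbleA p (k + 1))
        (bubbleB p (k + 1)) (j (k + 1)) (e (k + 1)) (ebar (k + 1)) (N (k + 1)) := by
  have hp0 : 0 < p := by linarith
  have step : ∀ (k : ℕ) (e' : ℕ → ℝ),
      NeckState p h lam mu W Q (bubbleDelta p k) (2 + bubbleA p k) e' →
      ∃ (j e ebar : ℕ → ℝ) (N : ℕ → ℕ), BubbleData p h lam mu W Q (bubbleDelta p (k + 1))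
        (bubbleA p (k + 1)) (bubbleB p (k + 1)) j e ebar N := fun k e' he' => by
    obtain ⟨⟨hδ, hδ'⟩, ⟨ha, ha2⟩, hroot, hrec, -⟩ := bubble_spec hp k
    obtain ⟨hak, -, hδk⟩ := bubble_range hp k
    have hP := Real.rpow_pos_of_pos hδk (p - 1)
    obtain ⟨j, hj, -, hW, hQ, hD⟩ := he'.exists_center (a := bubbleA p (k + 1)) (by linarith)
      hH0 hH1 hs hmu (by linarith) hδ hδ' ha ha2
      (by rw [hrec, Real.div_rpow hδ.le hδk.le]; field_simp; ring) (by linarith)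
    obtain ⟨e, ebar, N, hB⟩ := exists_bubbleData hp0 hH0 hH1 hs hmu hδ ha hj hW hQ hD
    exact ⟨j, e, ebar, N, hB⟩
  choose! J E Eb M hstep using step
  -- Only the end times enter the next step, so they alone are built recursively; the other
  -- sequences are recovered from them with the index shifted by one.
  let e : ℕ → ℕ → ℝ := fun k => Nat.rec e₀ (fun k e' => E k e') k
  have hneck : ∀ k, NeckState p h lam mu W Q (bubbleDelta p k) (2 + bubbleA p k) (e k) := by
    intro k
    induction k with
    | zero =>
      have : (2 : ℝ) + bubbleA p 0 = 4 := by norm_num [bubbleA]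
      rw [this]; exact he₀
    | succ k ih =>
      have hB := hstep k (e k) ih
      have ha := (bubble_range hp (k + 1)).1
      refine hB.neckState hp0 hH0 hH1 hs hmu ha ?_ (bubble_range hp (k + 1)).2.2
      rw [bubbleB]; positivity
  refine ⟨fun k => J (k - 1) (e (k - 1)), e, fun k => Eb (k - 1) (e (k - 1)),
    fun k => M (k - 1) (e (k - 1)), rfl, hneck, fun k => ?_⟩
  exact hstep k (e k) (hneck k)

namespace FirstBubbleData

variable {e : ℕ → ℝ} {N : ℕ → ℕ}

theorem neckState (hp : 0 < p) (hH0 : StandingH h) (hH1 : GrowthH p h) {W Q : ℕ → ℝ → ℝ}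
    (hs : ∀ n, LogSol p h (lam n) (mu n) (W n) (Q n)) (hmu : Tendsto mu atTop atTop)
    (hF : FirstBubbleData p h lam mu W Q e N) : NeckState p h lam mu W Q 1 4 e := by
  have := hF.radii.neckState hp hH0 hH1 hs hmu two_pos (by norm_num) one_pos
    (tendsto_mu_div_mu hmu) hF.end_neg hF.end_eq
  norm_num at this
  exact this

theorem isFirstBubble {u : ℕ → ℝ → ℝ} (hp : 0 < p) (hH0 : StandingH h) (hH1 : GrowthH p h)
    (hsol : ∀ n, IsRadialSolution p h (lam n) (mu n) (u n)) (hmu : Tendsto mu atTop atTop)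
    (hF : FirstBubbleData p h lam mu (fun n => logHeight (u n)) (fun n => logFlux (u n)) e N) :
    IsFirstBubble p h lam mu u
      (fun n => Real.exp (min (Real.log (scale p h (lam n) (mu n)) + Real.log (2 * √2)) (e n - 1)))
      (fun n => Real.exp (e n)) := by
  have hs := fun n => (hsol n).logSol hH0
  have hN := hF.radii
  have hneck := hF.neckState hp hH0 hH1 hs hmu
  have hpos := hN.eventually_height hp hH0 hH1 hs
  have hNR : Tendsto (fun n => (N n : ℝ)) atTop atTop :=
    tendsto_natCast_atTop_atTop.comp hN.N_atTop
  have hdiv : ∀ᶠ n in atTop, Real.exp (e n) / scale p h (lam n) (mu n) = Real.exp (N n) := by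
    filter_upwards [hpos, hF.end_eq] with n h1 h2
    exact exp_div_scale h1.2.2 h2
  -- The minimum with `e n - 1` ensures that the centre lies inside the outer radius for every `n`;
  -- it is inactive for large `n`.
  have hmin : ∀ᶠ n in atTop,
      min (Real.log (scale p h (lam n) (mu n)) + Real.log (2 * √2)) (e n - 1) =
        Real.log (scale p h (lam n) (mu n)) + Real.log (2 * √2) := by
    filter_upwards [hF.end_eq, hNR.eventually_ge_atTop (Real.log (2 * √2) + 1)] with n h1 h2
    exact min_eq_left (by linarith)
  have hmem : ∀ᶠ n in atTop, Real.log (2 * √2) ∈ Icc (-(N n : ℝ)) (N n) := by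
    filter_upwards [hNR.eventually_ge_atTop |Real.log (2 * √2)|] with n hn
    exact abs_le.1 hn
  have hm1 := tendsto_mu_div_mu hmu
  exact {
    rho_mem := fun n => exp_mem_Ioo (hF.end_neg n)
    r_mem := fun n => ⟨Real.exp_pos _, Real.exp_lt_exp.2 ((min_le_right _ _).trans_lt
      (by linarith))⟩
    scale_tendsto := by
      refine (Real.tendsto_exp_atBot.comp (tendsto_atBot_mono' (f₂ := fun n => Real.log
        (scale p h (lam n) (mu n))) _ ?_ (tendsto_neg_atTop_atBot.comp hNR))).congr' ?_
      · filter_upwards [hN.room] with n hn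
        have : (0 : ℝ) ≤ N n := Nat.cast_nonneg _
        simp only [Function.comp]
        linarith
      · filter_upwards [hpos] with n hn
        exact Real.exp_log hn.2.2
    rho_tendsto := by
      refine Real.tendsto_exp_atBot.comp (tendsto_atBot_mono' _ ?_
        (tendsto_neg_atTop_atBot.comp hNR))
      filter_upwards [hN.room, hF.end_eq] with n h1 h2
      simp only [Function.comp]
      linarith
    rho_div_scale := by
      refine (Real.tendsto_exp_atTop.comp hNR).congr' ?_
      filter_upwards [hdiv] with n hn
      exact hn.symm
    height_rho := hneck.height
    profile_tendsto := hF.ckTendsto_one hp hH0 hH1 hsol hdiv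
    energy_tendsto := by
      have h1 := hneck.slope
      rw [Real.one_rpow, div_one] at h1
      refine h1.congr fun n => ?_
      rw [energy, (hsol n).integral_eq_flux hp hH0 (hF.end_neg n)]
    r_div_scale := by
      refine tendsto_const_nhds.congr' ?_
      filter_upwards [hpos, hmin] with n h1 h2
      rw [h2, exp_div_scale h1.2.2 rfl, Real.exp_log (by positivity)]
    height_r := by
      refine (hN.tendsto_height hp hmu one_pos (by norm_num) hm1 hmem).congr' ?_
      filter_upwards [hmin] with n h2
      rw [h2, logHeight]
    phi_r := by
      have h1 := (hN.tendsto_phi_ratio hp hH0 hH1 hs hmem).mul_const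
        (Real.exp (2 * Real.log (2 * √2) + logProfile 2 (1 / 8) (Real.log (2 * √2))))
      have h2 : Real.exp (2 * Real.log (2 * √2) + logProfile 2 (1 / 8) (Real.log (2 * √2))) =
          2 := by
        rw [exp_logProfile two_pos (by norm_num), exp_two_mul_log (by positivity), mul_pow,
          Real.sq_sqrt (by norm_num)]
        norm_num
      rw [one_mul, h2] at h1
      refine h1.congr' ?_
      filter_upwards [hmin] with n h3
      rw [h3, div_mul_cancel₀ _ two_ne_zero] }

end FirstBubbleData

end Sequences

/-! ### Asymptotics of the parameter `lam` and of the heights -/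

section Sequences

variable {p : ℝ} {h : ℝ → ℝ} {lam mu : ℕ → ℝ} {W Q : ℕ → ℝ → ℝ} {e : ℕ → ℝ}

/-- The state after bubble `k` encloses `log λ / μ^p`, up to `o(1)`, between `-δ_k^p` and `δ_k^p
(2p/(2 + a_k) - 1)`. Both bounds vanish as `k → ∞`. -/
theorem tendsto_log_lam_of_neckStates (hp : 2 < p)
    (hs : ∀ n, LogSol p h (lam n) (mu n) (W n) (Q n)) (hmu : Tendsto mu atTop atTop)
    {e : ℕ → ℕ → ℝ}
    (he : ∀ k, NeckState p h lam mu W Q (bubbleDelta p k) (2 + bubbleA p k) (e k)) :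
    Tendsto (fun n => Real.log (lam n) / mu n ^ p) atTop (𝓝 0) := by
  have hp0 : 0 < p := by linarith
  rw [Metric.tendsto_nhds]
  intro ε hε
  have h1 : Tendsto (fun k => bubbleDelta p k ^ p * (p + 1)) atTop (𝓝 0) := by
    have := ((tendsto_bubbleDelta hp).rpow_const (Or.inr hp0.le)).mul_const (p + 1)
    rwa [Real.zero_rpow hp0.ne', zero_mul] at this
  obtain ⟨k, hk⟩ := (h1.eventually_lt_const (half_pos hε)).exists
  obtain ⟨ha, -, hδ⟩ := bubble_range hp k
  have hP := Real.rpow_pos_of_pos hδ p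
  have hup := (he k).log_lam_le hp0 hs hmu hδ (by linarith) (by linarith : 0 < ε / 4)
  have hlo := log_lam_ge hmu (Eventually.of_forall (he k).neg) (he k).log_lam
    (by linarith : 0 < ε / 4)
  filter_upwards [hup, hlo] with n h2 h3
  have h4 : 2 * p / (2 + bubbleA p k) ≤ p := by
    rw [div_le_iff₀ (by linarith)]; nlinarith
  have h5 := mul_le_mul_of_nonneg_left h4 hP.le
  rw [Real.dist_eq, sub_zero, abs_lt]
  constructor <;> nlinarith

/-- For `p = 2`, `A = 4` the critical slope `2p/A` is `1`, and `1 - (1 - y)² = (2 - y) y ≥ (1 + δ/2)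
y` for `y ≤ 1 - δ/2`. So the first neck reaches every positive relative height. -/
theorem NeckState.flux_tendsto_of_eq_two (hH0 : StandingH h) (hH1 : GrowthH 2 h)
    (hs : ∀ n, LogSol 2 h (lam n) (mu n) (W n) (Q n)) (hmu : Tendsto mu atTop atTop)
    (he : NeckState 2 h lam mu W Q 1 4 e) {t : ℕ → ℝ} {δ : ℝ} (hδ : 0 < δ)
    (ht : ∀ᶠ n in atTop, e n ≤ t n ∧ t n < 0)
    (hW : Tendsto (fun n => W n (t n) / mu n) atTop (𝓝 δ)) :
    Tendsto (fun n => (Real.log (lam n) + 2 * t n) / mu n ^ (2 : ℝ)) atTop (𝓝 (-δ)) := by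
  obtain ⟨T, hT, hfl⟩ := he.exists_flux_le two_pos hH0 hH1 hs hmu (c := δ / 2) (Y := 1 - δ / 2)
    one_pos (by norm_num) (by linarith) (fun y hy0 hy => by
      rw [Real.rpow_two]; nlinarith)
  have hWat := tendsto_height_atTop hmu hδ hW
  have hQ : Tendsto (fun n => 2 * mu n ^ ((2 : ℝ) - 1) * Q n (t n)) atTop
      (𝓝 (4 / 1 ^ ((2 : ℝ) - 1))) := by
    rw [Metric.tendsto_nhds]
    intro ε hε
    filter_upwards [hfl (ε / 2) (half_pos hε), ht, hWat.eventually_ge_atTop T,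
      hW.eventually_const_lt (show δ / 2 < δ by linarith), hmu.eventually_gt_atTop 0]
      with n h1 h2 h3 h4 h5
    rw [Real.dist_eq]
    refine ((h1 _ h2.1 h2.2 h3 ?_).2).trans_lt (by linarith)
    rw [lt_div_iff₀ h5] at h4
    have := mul_le_mul_of_nonneg_left ((hs n).W_le (he.neg n)) (by linarith : 0 ≤ δ / 2)
    linarith
  have := he.tendsto_log_lam two_pos hs hmu one_pos (by norm_num) ht hW hQ
  convert this using 2
  rw [Real.one_rpow, Real.one_rpow]
  ring

theorem tendsto_log_lam_of_eq_two (hH0 : StandingH h) (hH1 : GrowthH 2 h)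
    (hs : ∀ n, LogSol 2 h (lam n) (mu n) (W n) (Q n)) (hmu : Tendsto mu atTop atTop)
    (he : NeckState 2 h lam mu W Q 1 4 e) :
    Tendsto (fun n => Real.log (lam n) / mu n ^ (2 : ℝ)) atTop (𝓝 0) := by
  rw [Metric.tendsto_nhds]
  intro ε hε
  obtain ⟨δ, hδ0, hδ⟩ : ∃ δ : ℝ, 0 < δ ∧ δ < min 1 (ε / 2) := exists_between (by positivity)
  rw [lt_min_iff] at hδ
  have hex : ∀ᶠ n in atTop, ∃ t, e n ≤ t ∧ t < 0 ∧ W n t = δ * mu n := by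
    filter_upwards [he.height.eventually_const_lt hδ.1, hmu.eventually_gt_atTop 0] with n h1 h2
    rw [lt_div_iff₀ h2] at h1
    exact (hs n).exists_W_eq (he.neg n) (by positivity) h1.le
  rw [eventually_iff_exists_mem] at hex
  obtain ⟨V, hV, hex⟩ := hex
  choose! t ht1 ht2 ht3 using hex
  have hlim := he.flux_tendsto_of_eq_two hH0 hH1 hs hmu hδ0 (t := t)
    (by filter_upwards [hV] with n hn using ⟨ht1 n hn, ht2 n hn⟩) (by
      refine tendsto_const_nhds.congr' ?_
      filter_upwards [hV, hmu.eventually_gt_atTop 0] with n hn h2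
      rw [ht3 n hn, mul_div_cancel_right₀ _ h2.ne'])
  have hlo := log_lam_ge hmu (by filter_upwards [hV] with n hn using ht2 n hn) hlim
    (by linarith : 0 < ε / 4)
  have hup := he.log_lam_le two_pos hs hmu one_pos (by norm_num) (by linarith : 0 < ε / 4)
  filter_upwards [hup, hlo] with n h2 h3
  norm_num at h2 h3
  rw [Real.dist_eq, sub_zero, abs_lt]
  norm_num
  constructor <;> linarith

/-- For `p < 2` the flux stays constant up to the boundary. -/
theorem NeckState.flux_of_lt_two (hp : 0 < p) (hp2 : p < 2) (hH0 : StandingH h)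
    (hH1 : GrowthH p h) (hs : ∀ n, LogSol p h (lam n) (mu n) (W n) (Q n))
    (hmu : Tendsto mu atTop atTop) (he : NeckState p h lam mu W Q 1 4 e) {η : ℝ} (hη : 0 < η) :
    ∀ᶠ n in atTop, ∀ t, e n ≤ t → t < 0 → |p * mu n ^ (p - 1) * Q n t - 4| ≤ η := by
  -- For `p < 2` the decay condition holds down to height zero: for `p ≥ 1` because `(1 - y)^p ≤ 1 -
  -- y`, for `p ≤ 1` by Bernoulli's inequality.
  have hconc : ∃ c : ℝ, 0 < c ∧ ∀ y : ℝ, 0 ≤ y → y ≤ 1 →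
      (2 * p / 4 + c) * y ≤ 1 - (1 - y) ^ p := by
    rcases le_total 1 p with h1 | h1
    · refine ⟨1 - p / 2, by linarith, fun y hy0 hy1 => ?_⟩
      have : (1 - y) ^ p ≤ 1 - y := by
        rcases hy1.eq_or_lt with h0 | h0
        · rw [h0, sub_self, Real.zero_rpow hp.ne']
        · have := Real.rpow_le_rpow_of_exponent_ge (by linarith : 0 < 1 - y) (by linarith) h1
          rwa [Real.rpow_one] at this
      nlinarith
    · refine ⟨p / 2, by linarith, fun y hy0 hy1 => ?_⟩
      have := rpow_one_add_le_one_add_mul_self (s := -y) (by linarith) hp.le h1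
      rw [← sub_eq_add_neg] at this
      linarith
  obtain ⟨c, hc, hY⟩ := hconc
  obtain ⟨T₁, hT₁, hfl⟩ := he.exists_flux_le hp hH0 hH1 hs hmu one_pos (by norm_num) hc hY
  obtain ⟨T₂, hT₂, hf⟩ := exists_nonlin_le hp hH0 hH1
  set T := max T₁ T₂ with hT
  have hfT := hf T (le_max_right _ _)
  have hT0 : 0 < T := hT₁.trans_le (le_max_left _ _)
  have hup := he.log_lam_le hp hs hmu one_pos (by norm_num)
    (show 0 < (2 - p) / 4 by linarith)
  -- Below the height `T` the neck estimate is not available, but there `f` is bounded by `f(T)` and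
  -- `λ ≤ exp(-(2 - p) μ^p / 4)`, so the flux gained up to the boundary is negligible.
  have hsmall : Tendsto (fun n => p * (nonlin p h T / 2) * (mu n ^ (p - 1) * lam n)) atTop
      (𝓝 0) := by
    have h1 : Tendsto (fun n => (p - 1) * (Real.log (mu n) / mu n ^ p) - (2 - p) / 4) atTop
        (𝓝 ((p - 1) * 0 - (2 - p) / 4)) :=
      ((tendsto_log_height_div hp hmu one_pos (tendsto_mu_div_mu hmu)).const_mul _).sub_const _
    have h2 := (tendsto_rpow_of_atTop hp hmu).atTop_mul_neg (by linarith) h1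
    have h3 := Real.tendsto_exp_atBot.comp h2
    have h4 : Tendsto (fun n => mu n ^ (p - 1) * lam n) atTop (𝓝 0) := by
      refine tendsto_of_tendsto_of_tendsto_of_le_of_le' tendsto_const_nhds h3 ?_ ?_
      · filter_upwards [hmu.eventually_gt_atTop 0] with n hn
        exact mul_nonneg (Real.rpow_nonneg hn.le _) (hs n).lam_pos.le
      · filter_upwards [hmu.eventually_gt_atTop 0, hup] with n hn h5
        have hP := Real.rpow_pos_of_pos hn p
        have hl := (hs n).lam_pos
        rw [div_le_iff₀ hP, Real.one_rpow] at h5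
        rw [Function.comp, ← Real.log_le_iff_le_exp (by positivity),
          Real.log_mul (by positivity) hl.ne', Real.log_rpow hn, mul_sub]
        have : mu n ^ p * ((p - 1) * (Real.log (mu n) / mu n ^ p)) = (p - 1) * Real.log (mu n) := by
          field_simp
        rw [this]
        linarith
    simpa using h4.const_mul (p * (nonlin p h T / 2))
  filter_upwards [hfl (η / 2) (half_pos hη), hsmall.eventually_lt_const (half_pos hη),
    (tendsto_height_atTop hmu one_pos he.height).eventually_ge_atTop T,
    hmu.eventually_gt_atTop 0] with n h1 h2 h3 hm t het ht
  rw [Real.one_rpow, div_one] at h1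
  have hlarge : ∀ t, e n ≤ t → t < 0 → T ≤ W n t → |p * mu n ^ (p - 1) * Q n t - 4| ≤ η / 2 :=
    fun t het ht hW => by
      refine (h1 t het ht ((le_max_left _ _).trans hW) ?_).2
      rw [sub_self, zero_mul]; exact ((hs n).pos t ht).le
  rcases le_or_gt T (W n t) with hW | hW
  · exact (hlarge t het ht hW).trans (by linarith)
  obtain ⟨t₁, het₁, ht₁, hW₁⟩ := (hs n).exists_W_eq (he.neg n) hT0 h3
  have h4 := hlarge t₁ het₁ ht₁ hW₁.ge
  have h5 : t₁ ≤ t := (hs n).le_of_W_lt ht₁ (by rw [hW₁]; exact hW)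
  have h6 := sub_le_sub_of_hasDerivAt_le h5
    (fun x hx => (hs n).deriv_Q x (hx.2.trans_lt ht))
    (g := fun x => lam n * nonlin p h T / 2 * Real.exp (2 * x))
    (g' := fun x => lam n * nonlin p h T * Real.exp (2 * x))
    (fun x _ => by
      have := (((hasDerivAt_id x).const_mul 2).exp).const_mul (lam n * nonlin p h T / 2)
      refine this.congr_deriv ?_
      simp only [id]; ring)
    (fun x hx => by
      have hx0 := hx.2.trans_lt ht
      have h7 := hfT.2 _ ((hs n).pos x hx0).le (((hs n).W_anti hx.1 hx0).trans hW₁.le)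
      have := mul_le_mul_of_nonneg_left h7
        (mul_pos (hs n).lam_pos (Real.exp_pos (2 * x))).le
      linarith)
  have h8 : Q n t - Q n t₁ ≤ lam n * nonlin p h T / 2 := by
    have h9 : 0 ≤ lam n * nonlin p h T / 2 := by
      have := (hs n).lam_pos
      have := hfT.1
      positivity
    have h10 := mul_le_mul_of_nonneg_left (Real.exp_le_one_iff.2 (by linarith : 2 * t ≤ 0)) h9
    have h11 := mul_nonneg h9 (Real.exp_pos (2 * t₁)).le
    linarith
  have h9 := (hs n).Q_mono t₁ t h5 ht
  have hc : 0 < p * mu n ^ (p - 1) := by positivity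
  have h10 := mul_le_mul_of_nonneg_left h8 hc.le
  have h11 := mul_le_mul_of_nonneg_left h9 hc.le
  rw [abs_le] at h4 ⊢
  constructor <;> linarith [h4.1, h4.2]

/-- Integration of the almost constant flux from `t` up to the boundary, where the height is zero.
-/
theorem NeckState.height_of_lt_two (hp : 0 < p) (hp2 : p < 2) (hH0 : StandingH h)
    (hH1 : GrowthH p h) (hs : ∀ n, LogSol p h (lam n) (mu n) (W n) (Q n))
    (hmu : Tendsto mu atTop atTop) (he : NeckState p h lam mu W Q 1 4 e) {t : ℕ → ℝ}
    (ht : ∀ᶠ n in atTop, e n ≤ t n ∧ t n < 0) :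
    Tendsto (fun n => mu n ^ (p - 1) * W n (t n) / -t n) atTop (𝓝 (4 / p)) := by
  suffices h : Tendsto (fun n => p * mu n ^ (p - 1) * W n (t n) / -t n) atTop (𝓝 4) by
    refine (h.div_const p).congr fun n => ?_
    field_simp
  rw [Metric.tendsto_nhds]
  intro ε hε
  filter_upwards [he.flux_of_lt_two hp hp2 hH0 hH1 hs hmu (half_pos hε), ht,
    hmu.eventually_gt_atTop 0] with n h1 h2 hm
  have hc : 0 < p * mu n ^ (p - 1) := by positivity
  have ht0 : 0 < -t n := by linarith
  have h3 := (hs n).Q_mul_le h2.2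
  have h4 := (hs n).W_le_of_Q_le (t := t n) (q := (4 + ε / 2) / (p * mu n ^ (p - 1))) h2.2
    fun x hx hx0 => by
      have := (abs_le.1 (h1 x (h2.1.trans hx) hx0)).2
      rw [le_div_iff₀ hc]; linarith
  have h5 := (abs_le.1 (h1 _ h2.1 h2.2)).1
  rw [div_mul_eq_mul_div, le_div_iff₀ hc] at h4
  have h6 : p * mu n ^ (p - 1) * W n (t n) / -t n ≤ 4 + ε / 2 := by
    rw [div_le_iff₀ ht0]; linarith
  have h7 : 4 - ε / 2 ≤ p * mu n ^ (p - 1) * W n (t n) / -t n := by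
    rw [le_div_iff₀ ht0]
    have h8 := mul_le_mul_of_nonneg_left h3 hc.le
    have h9 := mul_le_mul_of_nonneg_right h5 ht0.le
    linarith
  rw [Real.dist_eq, abs_lt]
  constructor <;> linarith

theorem tendsto_log_lam_of_lt_two (hp : 0 < p) (hp2 : p < 2) (hH0 : StandingH h)
    (hH1 : GrowthH p h) (hs : ∀ n, LogSol p h (lam n) (mu n) (W n) (Q n))
    (hmu : Tendsto mu atTop atTop) (he : NeckState p h lam mu W Q 1 4 e) :
    Tendsto (fun n => Real.log (lam n) / mu n ^ p) atTop (𝓝 (p / 2 - 1)) := by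
  have h1 := he.height_of_lt_two hp hp2 hH0 hH1 hs hmu
    (Eventually.of_forall fun n => ⟨le_rfl, he.neg n⟩)
  have h2 := he.height.div h1 (by positivity)
  have h3 := he.log_lam.add (h2.const_mul 2)
  have e1 : -(1 : ℝ) ^ p + 2 * (1 / (4 / p)) = p / 2 - 1 := by
    rw [Real.one_rpow]; field_simp; ring
  rw [e1] at h3
  refine h3.congr' ?_
  filter_upwards [hmu.eventually_gt_atTop 0] with n hm
  have hW := (hs n).pos _ (he.neg n)
  have ht := he.neg n
  have hP := Real.rpow_pos_of_pos hm (p - 1)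
  have hmp : mu n ^ p = mu n ^ (p - 1) * mu n := by
    rw [← Real.rpow_add_one hm.ne']; congr 1; ring
  simp only [Pi.div_apply]
  rw [hmp]
  field_simp
  ring

end Sequences

/-! ### The asymptotic formulas inside the bubbles and on the necks -/

section Sequences

variable {p : ℝ} {h : ℝ → ℝ} {lam mu m : ℕ → ℝ} {u : ℕ → ℝ → ℝ} {e : ℕ → ℝ} {N : ℕ → ℕ}

theorem log_mul_scale {l mm R s : ℝ} (hγ : 0 < scale p h l mm) (hs : s = R * scale p h l mm)
    (hs0 : 0 < s) : 0 < R ∧ Real.log s = Real.log (scale p h l mm) + Real.log R := by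
  have hR : 0 < R := pos_of_mul_pos_left (hs ▸ hs0) hγ.le
  refine ⟨hR, ?_⟩
  rw [hs, Real.log_mul hR.ne' hγ.ne', add_comm]

theorem exp_two_mul_log_add_logProfile {a b R : ℝ} (ha : 0 < a) (hb : 0 < b) (hR : 0 < R) :
    Real.exp (2 * Real.log R + logProfile a b (Real.log R)) =
      2 * a ^ 2 * b * R ^ a / (1 + b * R ^ a) ^ 2 := by
  rw [exp_logProfile ha hb, Real.rpow_def_of_pos hR, mul_comm a]

theorem FirstBubbleData.phi_isEquivalent (hp : 0 < p) (hH0 : StandingH h) (hH1 : GrowthH p h)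
    (hs : ∀ n, LogSol p h (lam n) (mu n) (logHeight (u n)) (logFlux (u n)))
    (hF : FirstBubbleData p h lam mu (fun n => logHeight (u n)) (fun n => logFlux (u n)) e N)
    {s R : ℕ → ℝ} (hse : ∀ᶠ n in atTop, s n ∈ Ioc 0 (Real.exp (e n)))
    (hsR : ∀ᶠ n in atTop, s n = R n * scale p h (lam n) (mu n)) :
    (fun n => phi p h (lam n) (u n) (s n)) ~[atTop]
      (fun n => 64 * R n ^ 2 / (8 + R n ^ 2) ^ 2) := by
  apply Asymptotics.isEquivalent_of_tendsto_one
  have hpos := hF.radii.eventually_height hp hH0 hH1 hs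
  have hS : ∀ᶠ n in atTop, Real.log (R n) ≤ N n := by
    filter_upwards [hse, hsR, hpos, hF.end_eq] with n h1 h2 h3 h4
    obtain ⟨-, h5⟩ := log_mul_scale h3.2.2 h2 h1.1
    have := (Real.log_le_iff_le_exp h1.1).2 h1.2
    linarith
  have h1 : Tendsto (fun n => (logHeight (u n)
      (Real.log (scale p h (lam n) (mu n)) + Real.log (R n)) / mu n) ^ (p - 1)) atTop (𝓝 1) := by
    rw [tendsto_iff_dist_tendsto_zero]
    refine squeeze_zero' (Eventually.of_forall fun n => dist_nonneg) ?_ hF.radii.tendsto_tol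
    filter_upwards [hS, hF.close] with n c1 c2 using (c2 _ c1).height
  have h2 : Tendsto (fun n => nonlin p h (logHeight (u n)
      (Real.log (scale p h (lam n) (mu n)) + Real.log (R n))) / nonlin p h (mu n)
        * Real.exp (-logProfile 2 (1 / 8) (Real.log (R n)))) atTop (𝓝 1) := by
    rw [tendsto_iff_dist_tendsto_zero]
    refine squeeze_zero' (Eventually.of_forall fun n => dist_nonneg) ?_ hF.radii.tendsto_tol
    filter_upwards [hS, hF.close] with n c1 c2 using (c2 _ c1).ratio
  have h3 := h1.mul h2
  rw [one_mul] at h3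
  refine h3.congr' ?_
  filter_upwards [hse, hsR, hpos, hF.radii.room, hS] with n c1 c2 c3 c4 c5
  obtain ⟨hR, hlog⟩ := log_mul_scale c3.2.2 c2 c1.1
  have hN0 : (0 : ℝ) ≤ N n := Nat.cast_nonneg _
  rw [← phi_ratio hp (hs n).lam_pos c3.1 c3.2.1 _ _ ((hs n).pos _ (by linarith)), ← hlog,
    Real.exp_log c1.1, exp_two_mul_log_add_logProfile two_pos (by norm_num) hR, Pi.div_apply,
    Real.rpow_two]
  congr 1
  have : 0 < 8 + R n ^ 2 := by positivity
  have : 0 < 1 + 1 / 8 * R n ^ 2 := by positivity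
  field_simp
  ring

theorem FirstBubbleData.powLogAsymp (hp : 0 < p) (hH0 : StandingH h) (hH1 : GrowthH p h)
    (hs : ∀ n, LogSol p h (lam n) (mu n) (logHeight (u n)) (logFlux (u n)))
    (hmu : Tendsto mu atTop atTop)
    (hF : FirstBubbleData p h lam mu (fun n => logHeight (u n)) (fun n => logFlux (u n)) e N)
    {l : ℝ} (hl0 : 0 < 1 + l) (hl : Tendsto (fun n => Real.log (lam n) / mu n ^ p) atTop (𝓝 l))
    {s : ℕ → ℝ} (hse : ∀ᶠ n in atTop, s n ∈ Ioc 0 (Real.exp (e n)))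
    (hlog : Tendsto (fun n => mu n ^ (-p) * Real.log (s n / scale p h (lam n) (mu n))) atTop
      (𝓝 0)) :
    PowLogAsymp p (fun n => u n (s n)) s (2 / (1 + l)) := by
  have hpos := hF.radii.eventually_height hp hH0 hH1 hs
  have hm1 := tendsto_mu_div_mu hmu
  have hW : Tendsto (fun n => u n (s n) / mu n) atTop (𝓝 1) := by
    refine tendsto_of_tendsto_of_tendsto_of_le_of_le' (hF.neckState hp hH0 hH1 hs hmu).height
      tendsto_const_nhds ?_ ?_
    · filter_upwards [hse, hmu.eventually_gt_atTop 0] with n h1 h2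
      have := (hs n).W_anti ((Real.log_le_iff_le_exp h1.1).2 h1.2) (hF.end_neg n)
      rw [show logHeight (u n) (Real.log (s n)) = u n (s n) by
        rw [logHeight, Real.exp_log h1.1]] at this
      gcongr
    · filter_upwards [hse, hmu.eventually_gt_atTop 0] with n h1 h2
      have := (hs n).W_le (((Real.log_le_iff_le_exp h1.1).2 h1.2).trans_lt (hF.end_neg n))
      rw [show logHeight (u n) (Real.log (s n)) = u n (s n) by
        rw [logHeight, Real.exp_log h1.1]] at this
      rwa [div_le_one h2]
  have h0 := hF.radii.tendsto_log_lam hp hH0 hH1 hs hmu one_pos hm1 (S := fun _ => 0)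
    (Eventually.of_forall fun n => ⟨by simp, by simp⟩)
  have h1 : Tendsto (fun n => Real.log (1 / s n) / mu n ^ p) atTop (𝓝 ((1 + l) / 2)) := by
    -- At the scale itself `log λ + 2 log γ` is asymptotic to `-μ^p`, which yields `log(1/γ)`. By
    -- hypothesis `log(s/γ)` is negligible.
    have h2 := ((hl.sub h0).div_const 2).sub hlog
    rw [Real.one_rpow, sub_zero, sub_neg_eq_add, add_comm l] at h2
    refine h2.congr' ?_
    filter_upwards [hse, hpos] with n c1 c2
    have hP := Real.rpow_pos_of_pos c2.1 p
    rw [Real.log_div c1.1.ne' c2.2.2.ne', one_div, Real.log_inv, Real.rpow_neg c2.1.le]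
    field_simp
    ring
  have := powLogAsymp_of_tendsto hp hmu one_pos (by positivity) hW h1
  rwa [Real.one_rpow, one_div_div] at this

theorem NeckState.powLog_of_lt_two (hp : 0 < p) (hp2 : p < 2) (hH0 : StandingH h)
    (hH1 : GrowthH p h)
    (hs : ∀ n, LogSol p h (lam n) (mu n) (logHeight (u n)) (logFlux (u n)))
    (hmu : Tendsto mu atTop atTop)
    (he : NeckState p h lam mu (fun n => logHeight (u n)) (fun n => logFlux (u n)) 1 4 e)
    {s δ : ℕ → ℝ} (hse : ∀ᶠ n in atTop, s n ∈ Ico (Real.exp (e n)) 1)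
    (hδ : ∀ᶠ n in atTop, u n (s n) = δ n * mu n) :
    ∃ ε : ℕ → ℝ, Tendsto ε atTop (𝓝 0) ∧ (∀ᶠ n in atTop, 0 < δ n) ∧
      EventuallyEqPowLog p (fun n => u n (s n)) (fun n => (4 / p + ε n) * δ n ^ (p - 1)) s := by
  have hs0 : ∀ᶠ n in atTop, 0 < s n ∧ e n ≤ Real.log (s n) ∧ Real.log (s n) < 0 := by
    filter_upwards [hse] with n hn
    have h0 := (Real.exp_pos _).trans_le hn.1
    exact ⟨h0, (Real.le_log_iff_exp_le h0).2 hn.1, Real.log_neg h0 hn.2⟩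
  have h1 := he.height_of_lt_two hp hp2 hH0 hH1 hs hmu (hs0.mono fun n hn => hn.2)
  refine ⟨fun n => mu n ^ (p - 1) * logHeight (u n) (Real.log (s n)) / -Real.log (s n) - 4 / p,
    by simpa using h1.sub_const (4 / p), ?_, ?_⟩
  · filter_upwards [hs0, hδ, hmu.eventually_gt_atTop 0] with n h2 h3 h4
    have := (hs n).pos _ h2.2.2
    rw [logHeight, Real.exp_log h2.1, h3] at this
    exact pos_of_mul_pos_left this h4.le
  · filter_upwards [hs0, hδ, hmu.eventually_gt_atTop 0] with n h2 h3 h4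
    have hW := (hs n).pos _ h2.2.2
    rw [logHeight, Real.exp_log h2.1] at hW
    have hδ0 : 0 < δ n := pos_of_mul_pos_left (h3 ▸ hW) h4.le
    have hL := h2.2.2
    have key : (4 / p + (mu n ^ (p - 1) * logHeight (u n) (Real.log (s n)) / -Real.log (s n)
        - 4 / p)) * δ n ^ (p - 1) * Real.log (1 / s n) = u n (s n) ^ p := by
      rw [logHeight, Real.exp_log h2.1, add_sub_cancel, one_div, Real.log_inv]
      have e1 : u n (s n) ^ p = u n (s n) ^ (p - 1) * u n (s n) := by
        rw [← Real.rpow_add_one hW.ne']; congr 1; ring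
      have e2 : u n (s n) ^ (p - 1) = δ n ^ (p - 1) * mu n ^ (p - 1) := by
        rw [h3, Real.mul_rpow hδ0.le h4.le]
      rw [e1, e2]
      have := hL.ne
      field_simp
    rw [key]
    refine ⟨Real.rpow_nonneg hW.le _, ?_⟩
    rw [← Real.rpow_mul hW.le, mul_one_div_cancel hp.ne', Real.rpow_one]

theorem NeckState.powLogAsymp_of_eq_two (hH0 : StandingH h) (hH1 : GrowthH 2 h)
    (hs : ∀ n, LogSol 2 h (lam n) (mu n) (logHeight (u n)) (logFlux (u n)))
    (hmu : Tendsto mu atTop atTop)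
    (he : NeckState 2 h lam mu (fun n => logHeight (u n)) (fun n => logFlux (u n)) 1 4 e)
    {s : ℕ → ℝ} {δ : ℝ} (hse : ∀ᶠ n in atTop, s n ∈ Ico (Real.exp (e n)) 1) (hδ : 0 < δ)
    (hW : Tendsto (fun n => u n (s n) / mu n) atTop (𝓝 δ)) :
    PowLogAsymp 2 (fun n => u n (s n)) s (2 * δ) := by
  have hs0 : ∀ᶠ n in atTop, 0 < s n ∧ e n ≤ Real.log (s n) ∧ Real.log (s n) < 0 := by
    filter_upwards [hse] with n hn
    have h0 := (Real.exp_pos _).trans_le hn.1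
    exact ⟨h0, (Real.le_log_iff_exp_le h0).2 hn.1, Real.log_neg h0 hn.2⟩
  have hW' : Tendsto (fun n => logHeight (u n) (Real.log (s n)) / mu n) atTop (𝓝 δ) := by
    refine hW.congr' ?_
    filter_upwards [hs0] with n hn
    rw [logHeight, Real.exp_log hn.1]
  have h1 := he.flux_tendsto_of_eq_two hH0 hH1 hs hmu hδ (hs0.mono fun n hn => hn.2) hW'
  have h2 := tendsto_neg_div_of_log_lam h1 (tendsto_log_lam_of_eq_two hH0 hH1 hs hmu he)
  have h3 := powLogAsymp_of_tendsto two_pos hmu hδ (y := - -δ / 2) (s := s) (by linarith) hW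
    (h2.congr fun n => by rw [one_div, Real.log_inv])
  have h4 : δ ^ (2 : ℝ) / (- -δ / 2) = 2 * δ := by
    rw [Real.rpow_two, neg_neg]; field_simp
  rwa [h4] at h3

/-- The flux is monotone and has the same normalized limit at both ends of the neck, so it has this
limit at every point between them. The passage of time then gives `log(1/s)`. -/
theorem BubbleData.powLogAsymp_neck (hp : 2 < p)
    (hs : ∀ n, LogSol p h (lam n) (mu n) (logHeight (u n)) (logFlux (u n)))
    (hmu : Tendsto mu atTop atTop)
    (hl : Tendsto (fun n => Real.log (lam n) / mu n ^ p) atTop (𝓝 0)) {k : ℕ}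
    {j e' ebar : ℕ → ℝ}
    (hB : BubbleData p h lam mu (fun n => logHeight (u n)) (fun n => logFlux (u n))
      (bubbleDelta p (k + 1)) (bubbleA p (k + 1)) (bubbleB p (k + 1)) j e' ebar N)
    (he : NeckState p h lam mu (fun n => logHeight (u n)) (fun n => logFlux (u n))
      (bubbleDelta p k) (2 + bubbleA p k) e)
    {s : ℕ → ℝ} {δ : ℝ}
    (hse : ∀ᶠ n in atTop, s n ∈ Icc (Real.exp (e n)) (Real.exp (ebar n)))
    (hδ : bubbleDelta p (k + 1) ≤ δ)
    (hW : Tendsto (fun n => u n (s n) / mu n) atTop (𝓝 δ)) :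
    PowLogAsymp p (fun n => u n (s n)) s (beta p k δ) := by
  have hp0 : 0 < p := by linarith
  obtain ⟨⟨hδ1, hδ2⟩, ⟨ha1, -⟩, hroot, hrec, -⟩ := bubble_spec hp k
  obtain ⟨ha, -, hδk⟩ := bubble_range hp k
  have hs0 : ∀ᶠ n in atTop, 0 < s n ∧ e n ≤ Real.log (s n) ∧ Real.log (s n) ≤ ebar n := by
    filter_upwards [hse] with n hn
    have h0 := (Real.exp_pos _).trans_le hn.1
    exact ⟨h0, (Real.le_log_iff_exp_le h0).2 hn.1, (Real.log_le_iff_le_exp h0).2 hn.2⟩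
  have hP := Real.rpow_pos_of_pos hδk (p - 1)
  have hP1 := Real.rpow_pos_of_pos hδ1 (p - 1)
  have hPk := Real.rpow_pos_of_pos hδk p
  have hQ : Tendsto (fun n => p * mu n ^ (p - 1) * logFlux (u n) (Real.log (s n))) atTop
      (𝓝 ((2 + bubbleA p k) / bubbleDelta p k ^ (p - 1))) := by
    have h1 := hB.slope_start hmu ha1 hδ1
    have h2 : (2 - bubbleA p (k + 1)) / bubbleDelta p (k + 1) ^ (p - 1) =
        (2 + bubbleA p k) / bubbleDelta p k ^ (p - 1) := by
      rw [hrec, Real.div_rpow hδ1.le hδk.le]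
      field_simp
      ring
    rw [h2] at h1
    refine tendsto_of_tendsto_of_tendsto_of_le_of_le' he.slope h1 ?_ ?_
    · filter_upwards [hs0, hmu.eventually_gt_atTop 0] with n h3 h4
      exact mul_le_mul_of_nonneg_left ((hs n).Q_mono _ _ h3.2.1
        (h3.2.2.trans_lt (hB.start_neg n))) (by positivity)
    · filter_upwards [hs0, hmu.eventually_gt_atTop 0] with n h3 h4
      exact mul_le_mul_of_nonneg_left ((hs n).Q_mono _ _ h3.2.2 (hB.start_neg n))
        (by positivity)
  have hW' : Tendsto (fun n => logHeight (u n) (Real.log (s n)) / mu n) atTop (𝓝 δ) := by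
    refine hW.congr' ?_
    filter_upwards [hs0] with n hn
    rw [logHeight, Real.exp_log hn.1]
  have h1 := he.tendsto_log_lam hp0 hs hmu hδk (by linarith)
    (hs0.mono fun n hn => ⟨hn.2.1, hn.2.2.trans_lt (hB.start_neg n)⟩) hW' hQ
  have h2 := tendsto_neg_div_of_log_lam h1 hl
  set q := δ / bubbleDelta p k with hq
  have hδq : δ = q * bubbleDelta p k := by rw [hq]; field_simp
  have hδ0 : 0 < δ := hδ1.trans_le hδ
  have h2a : 0 < 2 + bubbleA p k := by linarith
  -- The denominator increases with `δ`. At `δ_{k+1}` the root equation makes it a positive multiple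
  -- of `(δ_{k+1}/δ_k)^p`.
  have hden : 0 < 2 + bubbleA p k - 2 * p * (1 - q) := by
    have h3 : bubbleDelta p (k + 1) / bubbleDelta p k ≤ q :=
      div_le_div_of_nonneg_right hδ hδk.le
    have h4 : 0 < (bubbleDelta p (k + 1) / bubbleDelta p k) ^ p := by positivity
    have h5 : 2 * p / (2 + bubbleA p k) * (1 - bubbleDelta p (k + 1) / bubbleDelta p k) < 1 := by
      linarith
    rw [div_mul_eq_mul_div, div_lt_one h2a] at h5
    nlinarith
  have e1 : bubbleDelta p k ^ p = bubbleDelta p k ^ (p - 1) * bubbleDelta p k := by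
    rw [← Real.rpow_add_one hδk.ne']; congr 1; ring
  have e2 : -(-bubbleDelta p k ^ p + 2 * (p * bubbleDelta p k ^ (p - 1) *
      (bubbleDelta p k - δ) / (2 + bubbleA p k))) / 2 =
      bubbleDelta p k ^ p * (2 + bubbleA p k - 2 * p * (1 - q)) / (2 * (2 + bubbleA p k)) := by
    rw [e1, hδq]
    field_simp
    ring
  rw [e2] at h2
  have h3 := powLogAsymp_of_tendsto hp0 hmu hδ0 (s := s) (by positivity) hW
    (h2.congr fun n => by rw [one_div, Real.log_inv])
  have h4 : δ ^ p / (bubbleDelta p k ^ p * (2 + bubbleA p k - 2 * p * (1 - q)) /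
      (2 * (2 + bubbleA p k))) = beta p k δ := by
    rw [beta, ← hq, hq, Real.div_rpow hδ0.le hδk.le, ← hq]
    field_simp
  rwa [h4] at h3

theorem BubbleData.asymptotics_window (hp : 0 < p) (hH0 : StandingH h) (hH1 : GrowthH p h)
    (hs : ∀ n, LogSol p h (lam n) (mu n) (logHeight (u n)) (logFlux (u n)))
    (hmu : Tendsto mu atTop atTop)
    (hl : Tendsto (fun n => Real.log (lam n) / mu n ^ p) atTop (𝓝 0)) {δ a b : ℝ}
    (hδ : 0 < δ) (ha : 0 < a) (hb : 0 < b) {j ebar : ℕ → ℝ}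
    (hB : BubbleData p h lam mu (fun n => logHeight (u n)) (fun n => logFlux (u n)) δ a b
      j e ebar N) {s R : ℕ → ℝ}
    (hse : ∀ᶠ n in atTop, s n ∈ Icc (Real.exp (ebar n)) (Real.exp (e n)))
    (hsR : ∀ᶠ n in atTop, s n = R n * scale p h (lam n) (u n (Real.exp (j n)))) :
    (fun n => phi p h (lam n) (u n) (s n)) ~[atTop]
      (fun n => 2 * a ^ 2 * b * R n ^ a / (1 + b * R n ^ a) ^ 2) ∧
    PowLogAsymp p (fun n => u n (s n)) s 2 := by
  have hpos := hB.radii.eventually_height hp hH0 hH1 hs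
  have hkey : ∀ᶠ n in atTop, 0 < s n ∧ 0 < R n ∧ Real.log (s n) =
      Real.log (scale p h (lam n) (logHeight (u n) (j n))) + Real.log (R n) ∧
      Real.log (R n) ∈ Icc (-(N n : ℝ)) (N n) := by
    filter_upwards [hse, hsR, hpos, hB.end_eq, hB.start_eq] with n h1 h2 h3 h4 h5
    have h0 := (Real.exp_pos _).trans_le h1.1
    obtain ⟨h6, h7⟩ := log_mul_scale h3.2.2 h2 h0
    have h8 := (Real.le_log_iff_exp_le h0).2 h1.1
    have h9 := (Real.log_le_iff_le_exp h0).2 h1.2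
    exact ⟨h0, h6, h7, by linarith, by linarith⟩
  have hS := hkey.mono fun n hn => hn.2.2.2
  constructor
  · apply Asymptotics.isEquivalent_of_tendsto_one
    refine (hB.radii.tendsto_phi_ratio hp hH0 hH1 hs hS).congr' ?_
    filter_upwards [hkey] with n hn
    rw [← hn.2.2.1, Real.exp_log hn.1, exp_two_mul_log_add_logProfile ha hb hn.2.1, Pi.div_apply]
  · have h1 := hB.radii.tendsto_log_lam hp hH0 hH1 hs hmu hδ hB.height_center hS
    have h2 := tendsto_neg_div_of_log_lam h1 hl
    have h3 := hB.radii.tendsto_height hp hmu hδ hb hB.height_center hS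
    have hP := Real.rpow_pos_of_pos hδ p
    have h4 := powLogAsymp_of_tendsto (w := fun n => u n (s n)) (s := s) hp hmu hδ
      (y := - -δ ^ p / 2) (by rw [neg_neg]; positivity) (h3.congr' (by
        filter_upwards [hkey] with n hn
        rw [← hn.2.2.1, logHeight, Real.exp_log hn.1])) (h2.congr' (by
        filter_upwards [hkey] with n hn
        rw [← hn.2.2.1, one_div, Real.log_inv]))
    have h5 : δ ^ p / (- -δ ^ p / 2) = 2 := by
      rw [neg_neg]; field_simp
    rwa [h5] at h4

end Sequences

end

/-! ### Assembly of the three cases -/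

theorem theorem4p1 (p : ℝ) (hp : 0 < p) (h : ℝ → ℝ) (hH0 : StandingH h) (hH1 : GrowthH p h)
    (lam mu : ℕ → ℝ) (u : ℕ → ℝ → ℝ)
    (hsol : ∀ n, IsRadialSolution p h (lam n) (mu n) (u n))
    (hmu : Tendsto mu atTop atTop) :
    -- a subsequence `φ`, and the sequences `r k n`, `ρ k n`, `ρbar k n` of the bubbles along it
    ∃ φ : ℕ → ℕ, StrictMono φ ∧ ∃ r ρ ρbar : ℕ → ℕ → ℝ,
      IsFirstBubble p h (fun n => lam (φ n)) (fun n => mu (φ n)) (fun n => u (φ n)) (r 0) (ρ 0) ∧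
      (2 < p → ∀ k : ℕ, IsLaterBubble p h (fun n => lam (φ n)) (fun n => mu (φ n))
        (fun n => u (φ n)) (k + 1) (ρ k) (r (k + 1)) (ρ (k + 1)) (ρbar (k + 1))) ∧
      -- inside the first bubble
      (∀ s R : ℕ → ℝ, (∀ᶠ n in atTop, s n ∈ Ioc 0 (ρ 0 n)) →
        (∀ᶠ n in atTop, s n = R n * scale p h (lam (φ n)) (mu (φ n))) →
        (fun n => phi p h (lam (φ n)) (u (φ n)) (s n))
            ~[atTop] (fun n => 64 * R n ^ 2 / (8 + R n ^ 2) ^ 2) ∧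
        (Tendsto (fun n => mu (φ n) ^ (-p) *
            Real.log (s n / scale p h (lam (φ n)) (mu (φ n)))) atTop (𝓝 0) →
          (p < 2 → PowLogAsymp p (fun n => u (φ n) (s n)) s (4 / p)) ∧
          (2 ≤ p → PowLogAsymp p (fun n => u (φ n) (s n)) s 2))) ∧
      -- outside the first bubble, `p < 2`
      (p < 2 → ∀ s δ : ℕ → ℝ, (∀ᶠ n in atTop, s n ∈ Ico (ρ 0 n) 1) →
        (∀ᶠ n in atTop, u (φ n) (s n) = δ n * mu (φ n)) →
        (∃ e : ℕ → ℝ, Tendsto e atTop (𝓝 0) ∧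
          EventuallyEqPowLog p (fun n => u (φ n) (s n))
            (fun n => (4 / p + e n) * δ n ^ (p - 1)) s) ∧
        ((∃ C : ℝ, ∀ᶠ n in atTop, δ n ^ (p - 1) ≤ C) →
          ∃ e : ℕ → ℝ, Tendsto e atTop (𝓝 0) ∧
            EventuallyEqPowLog p (fun n => u (φ n) (s n))
              (fun n => 4 * δ n ^ (p - 1) / p + e n) s)) ∧
      -- outside the first bubble, `p = 2`
      (p = 2 → ∀ (s : ℕ → ℝ) (δ : ℝ), (∀ᶠ n in atTop, s n ∈ Ico (ρ 0 n) 1) →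
        δ ∈ Ioc (0 : ℝ) 1 →
        Tendsto (fun n => u (φ n) (s n) / mu (φ n)) atTop (𝓝 δ) →
        PowLogAsymp 2 (fun n => u (φ n) (s n)) s (2 * δ)) ∧
      -- `p > 2`: between two consecutive bubbles
      (2 < p → ∀ (k : ℕ) (s : ℕ → ℝ) (δ : ℝ),
        (∀ᶠ n in atTop, s n ∈ Icc (ρ k n) (ρbar (k + 1) n)) →
        δ ∈ Icc (bubbleDelta p (k + 1)) (bubbleDelta p k) →
        Tendsto (fun n => u (φ n) (s n) / mu (φ n)) atTop (𝓝 δ) →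
        PowLogAsymp p (fun n => u (φ n) (s n)) s (beta p k δ)) ∧
      -- `p > 2`: inside the bubble with index `k ≥ 1`
      (2 < p → ∀ k : ℕ, 1 ≤ k → ∀ s R : ℕ → ℝ,
        (∀ᶠ n in atTop, s n ∈ Icc (ρbar k n) (ρ k n)) →
        (∀ᶠ n in atTop, s n = R n * scale p h (lam (φ n)) (u (φ n) (r k n))) →
        (fun n => phi p h (lam (φ n)) (u (φ n)) (s n))
            ~[atTop] (fun n => 2 * bubbleA p k ^ 2 * bubbleB p k * R n ^ bubbleA p k /
              (1 + bubbleB p k * R n ^ bubbleA p k) ^ 2) ∧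
        PowLogAsymp p (fun n => u (φ n) (s n)) s 2) := by
  have hs := fun n => (hsol n).logSol hH0
  obtain ⟨e₀, N₀, hF⟩ := exists_firstBubbleData hp hH0 hH1 hs hmu
  have hneck := hF.neckState hp hH0 hH1 hs hmu
  -- The bubble sequences are needed as single objects for all `p`. For `p ≤ 2` the entries of
  -- positive index are arbitrary; only the outer radius of the first bubble matters.
  have hseq : ∃ (j e ebar : ℕ → ℕ → ℝ) (N : ℕ → ℕ → ℕ), e 0 = e₀ ∧ (2 < p →
      (∀ k, NeckState p h lam mu (fun n => logHeight (u n)) (fun n => logFlux (u n))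
        (bubbleDelta p k) (2 + bubbleA p k) (e k)) ∧
      ∀ k, BubbleData p h lam mu (fun n => logHeight (u n)) (fun n => logFlux (u n))
        (bubbleDelta p (k + 1)) (bubbleA p (k + 1)) (bubbleB p (k + 1)) (j (k + 1)) (e (k + 1))
        (ebar (k + 1)) (N (k + 1))) := by
    rcases le_or_gt p 2 with hp2 | hp2
    · exact ⟨fun _ => e₀, fun _ => e₀, fun _ => e₀, fun _ => N₀, rfl, fun h => absurd h hp2.not_gt⟩
    · obtain ⟨j, e, ebar, N, h1, h2, h3⟩ := exists_bubble_sequence hp2 hH0 hH1 hs hmu hneck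
      exact ⟨j, e, ebar, N, h1, fun _ => ⟨h2, h3⟩⟩
  obtain ⟨j, e, ebar, N, he0, hbub⟩ := hseq
  have hl2 : 2 ≤ p → Tendsto (fun n => Real.log (lam n) / mu n ^ p) atTop (𝓝 0) := fun hp2 => by
    rcases hp2.eq_or_lt with rfl | hp2
    · exact tendsto_log_lam_of_eq_two hH0 hH1 hs hmu hneck
    · exact tendsto_log_lam_of_neckStates hp2 hs hmu (hbub hp2).1
  subst he0
  let r : ℕ → ℕ → ℝ := fun k => Nat.casesOn (motive := fun _ => ℕ → ℝ) k (fun n => Real.exp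
      (min (Real.log (scale p h (lam n) (mu n)) + Real.log (2 * √2)) (e 0 n - 1)))
    (fun k n => Real.exp (j (k + 1) n))
  -- The whole sequence serves as the subsequence: all limits come from quantitative estimates with
  -- explicit values, not from compactness.
  refine ⟨id, strictMono_id, r, fun k n => Real.exp (e k n), fun k n => Real.exp (ebar k n), hF.isFirstBubble hp hH0 hH1 hsol hmu,
    fun hp2 k => ((hbub hp2).2 k).isLaterBubble hp2 hH0 hH1 hsol hmu ((hbub hp2).1 k),
    fun s R hse hsR => ⟨hF.phi_isEquivalent hp hH0 hH1 hs hse hsR, fun hlog => ⟨fun hp2 => ?_,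
      fun hp2 => ?_⟩⟩, fun hp2 s δ hse hδ => ?_, fun hp2 s δ hse hδ hW => ?_,
    fun hp2 k s δ hse hδ hW => ((hbub hp2).2 k).powLogAsymp_neck hp2 hs hmu (hl2 hp2.le)
      ((hbub hp2).1 k) hse hδ.1 hW, fun hp2 k hk s R hse hsR => ?_⟩
  · have := hF.powLogAsymp hp hH0 hH1 hs hmu (by linarith)
      (tendsto_log_lam_of_lt_two hp hp2 hH0 hH1 hs hmu hneck) hse hlog
    rwa [show 2 / (1 + (p / 2 - 1)) = 4 / p by
      rw [add_sub_cancel]; field_simp; norm_num] at this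
  · have := hF.powLogAsymp hp hH0 hH1 hs hmu (by linarith) (hl2 hp2) hse hlog
    rwa [add_zero, div_one] at this
  · obtain ⟨ε, hε, hδ0, hpow⟩ := hneck.powLog_of_lt_two hp hp2 hH0 hH1 hs hmu hse hδ
    -- The multiplicative error becomes additive after multiplication by the bounded factor
    -- `δ^(p-1)`.
    refine ⟨⟨ε, hε, hpow⟩, fun ⟨C, hC⟩ => ⟨fun n => ε n * δ n ^ (p - 1), ?_, ?_⟩⟩
    · refine hε.zero_mul_isBoundedUnder_le (isBoundedUnder_of_eventually_le (a := C) ?_)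
      filter_upwards [hC, hδ0] with n h1 h2
      rwa [Function.comp, Real.norm_of_nonneg (Real.rpow_nonneg h2.le _)]
    · filter_upwards [hpow] with n hn
      have : 4 * δ n ^ (p - 1) / p + ε n * δ n ^ (p - 1) = (4 / p + ε n) * δ n ^ (p - 1) := by
        ring
      rwa [this]
  · subst hp2
    exact hneck.powLogAsymp_of_eq_two hH0 hH1 hs hmu hse hδ.1 hW
  · obtain ⟨k, rfl⟩ := Nat.exists_eq_succ_of_ne_zero (by omega : k ≠ 0)
    obtain ⟨ha, -, hδ⟩ := bubble_range hp2 (k + 1)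
    have hb : 0 < bubbleB p (k + 1) := by rw [bubbleB]; positivity
    exact ((hbub hp2).2 k).asymptotics_window hp hH0 hH1 hs hmu (hl2 hp2.le) hδ ha hb hse hsR
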